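/- **Setting.** Let $G$ be a (Hausdorff, second countable, finite-dimensional) Lie group with Lie algebra $\mathfrak g$, Maurer–Cartan form $\Theta$ and coadjoint representation $\langle Ad^*(g)\eta;A\rangle=\langle\eta;Ad(g^{-1})A\rangle$ on $\mathfrak g^*$. For $\mu\in\mathfrak g^*$ let $G_\mu=\{g: Ad^*(g)\mu=\mu\}$, $\mathfrak g_\mu=\{A:\langle\mu;[A,B]\rangle=0\ \forall B\}$, let $\mathcal O(\mu)$ be the coadjoint orbit of $\mu$, and $O(\mu)=ad^*(\mathfrak g)\mu$, where $\langle ad^*(A)\mu;B\rangle=-\langle\mu;[A,B]\rangle$. Let $k=\mathrm{rank}(G)=\min_\mu\dim\mathfrak g_\mu$ and let $\mathfrak g^*_r=\{\mu:\dim\mathfrak g_\mu=k\}$ be the set of regular elements. Let $\mathbb A=P+\mathfrak a\subset\mathfrak g$ be an affine subspace ($\mathfrak a$ a linear subspace, $P\notin\mathfrak a$), let $\omega\in\mathfrak g^*$ with $\langle\omega;P\rangle=1$ and $\omega|_{\mathfrak a}=0$, also regarded as a left-invariant $1$-form, and let $L:\mathbb A\to\mathbb R$ be smooth. On $\widetilde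 Z=\{(g,Q,\eta)\in G\times\mathbb A\times\mathfrak g^*:\langle\eta;Q\rangle=L(Q)\}$ let $\psi|_{(g,Q,\eta)}=\langle\eta;\Theta_g\rangle$ be the Liouville form and $\Psi=d\psi$. The momentum space $Y$ of $L$ is the reduced space of the Cartan system $(\mathcal C(\Psi),\omega)$: a non-empty immersed submanifold of $\widetilde Z$ which has at each of its points a tangent vector $u$ with $\Psi(u,\cdot)=0$ on $T\widetilde Z$ and $\omega(u)\neq0$, and which contains every other immersed submanifold with this property. It has the form $Y=G\times\mathcal F$, where $\mathcal F$ (the phase space) is an immersed submanifold of $\mathbb A\times\mathfrak g^*$. Assume that it exists ($L$ is regular) and that * $L$ is non-degenerate: $\dim Y=2m+1$ is odd and $\omega\wedge(\Psi_Y)^m$ is nowhere zero, where $\Psi_Y=\Psi|_Y$; then there is a unique vector field $\xi$ on $Y$ (the characteristic vector field) with $i_\xi\Psi_Y=0$ and $\omega(\xi)=1$, and $\xi|_{(g,p)}=A_\xi(p)|_g+\Phi_\xi(p)$, where $A|_g$ denotes the left translate of $A\in\mathfrak g$ to $T_gG$; * the Legendre transform $\Lambda:\mathcal F\to\mathfrak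 g^*$, $(Q,\eta)\mapsto\eta$, is one-to-one, so that $\mathcal F$ is regarded as a subset of $\mathfrak g^*$, with tangent spaces $F(\eta)\subset\mathfrak g^*$; * $L$ is coisotropic: with $\mathcal F_r=\{\eta\in\mathcal F:\Phi_\xi(\eta)\neq0\}$ and $Y_r=G\times\mathcal F_r$, for every $y\in Y_r$ every $v\in T_yY$ that is $\Psi_Y$-orthogonal to the tangent space $\mathfrak g^\sharp_y$ of the $G$-orbit ($G$ acts by $h\cdot(g,\eta)=(hg,\eta)$) lies in $\mathfrak g^\sharp_y+\ker(\Psi_Y)_y$. Let $J(g,\eta)=Ad^*(g)\eta$ on $Y_r$, and let $\mathcal P(\mu)=\mathcal F_r\cap\mathcal O(\mu)$ be the (regular part of the) phase portrait of $\mu$. **Proposition.** 1. $J(Y_r)\subset\mathfrak g^*_r$. 2. $Y_r$ is open in $Y$ and $J:Y_r\to\mathfrak g^*$ is a (smooth) submersion. 3. For every $\mu\in J(Y_r)$ the fibre $J^{-1}(\mu)\subset Y_r$ is a $(k+1)$-dimensional embedded submanifold of $Y$ with $$T_{(g,\eta)}J^{-1}(\mu)=\ker dJ|_{(g,\eta)}=\mathrm{span}(\xi|_{(g,\eta)})+\{A|_g: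 A\in\mathfrak g_\eta\};$$ in particular $\xi$ is tangent to $J^{-1}(\mu)$. The group $G_\mu$ is a $k$-dimensional embedded Lie subgroup of $G$ which acts smoothly, freely and properly on $J^{-1}(\mu)$ by $h\cdot(g,\eta)=(hg,\eta)$. 4. With the quotient topology, $Y_\mu:=J^{-1}(\mu)/G_\mu$ is a (Hausdorff, second countable) smooth $1$-manifold, for a smooth structure for which $J^{-1}(\mu)\to Y_\mu$ is a smooth principal $G_\mu$-bundle. 5. The phase portrait $\mathcal P(\mu)$ is a $1$-dimensional immersed submanifold of $\mathcal F$ whose tangent space at $\eta$ is $\Pi(\eta)=F(\eta)\cap O(\eta)$, and $[(g,\eta)]\mapsto\eta$ is a diffeomorphism of $Y_\mu$ onto $\mathcal P(\mu)$. -/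

import Mathlib

open Set Topology
open scoped Manifold ContDiff

namespace CoisotropicVP

noncomputable section

/-! ### Lie groups, adjoint and coadjoint representations

`G` is a Lie group modelled on the finite-dimensional space `E`.  Its Lie algebra `𝔤 = T_1 G` is, by
the definition of tangent spaces in Mathlib, the vector space `E` itself, with the bracket of
`GroupLieAlgebra`.  The dual `𝔤*` is `E →L[ℝ] ℝ`. -/

section LieGroup

variable {E : Type*} [NormedAddCommGroup E] [NormedSpace ℝ E]
variable {G : Type*} [TopologicalSpace G] [ChartedSpace E G] [Group G]

variable (G) in
/-- The Lie bracket `[A, B]` of `𝔤 = T_1 G` (bracket of left-invariant vector fields). -/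
def bracket (A B : E) : E :=
  Bracket.bracket (L := GroupLieAlgebra 𝓘(ℝ, E) G) (M := GroupLieAlgebra 𝓘(ℝ, E) G) A B

/-- The adjoint representation `Ad(g) : 𝔤 → 𝔤`, differential at `1` of `x ↦ g x g⁻¹`. -/
def Ad (g : G) : E →L[ℝ] E :=
  (mfderiv 𝓘(ℝ, E) 𝓘(ℝ, E) (fun x : G => g * x * g⁻¹) 1 :)

/-- The coadjoint representation: `⟨Ad*(g) η; A⟩ = ⟨η; Ad(g⁻¹) A⟩`. -/
def coAd (g : G) (η : E →L[ℝ] ℝ) : E →L[ℝ] ℝ := η.comp (Ad g⁻¹)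

/-- Left translation `A ↦ A|_g = (L_g)_* A`, from `𝔤` to `T_g G`. -/
def leftTrans (g : G) : E →L[ℝ] E :=
  (mfderiv 𝓘(ℝ, E) 𝓘(ℝ, E) (fun x : G => g * x) 1 :)

/-- The Maurer-Cartan form at `g`, from `T_g G` to `𝔤`. -/
def maurerCartan (g : G) : E →L[ℝ] E :=
  (mfderiv 𝓘(ℝ, E) 𝓘(ℝ, E) (fun x : G => g⁻¹ * x) g :)

theorem Ad_one [LieGroup 𝓘(ℝ, E) ∞ G] : Ad (E := E) (1 : G) = ContinuousLinearMap.id ℝ E := by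
  have h : (fun x : G => (1 : G) * x * (1 : G)⁻¹) = id := by ext x; simp
  unfold Ad
  rw [h]
  exact mfderiv_id

theorem contMDiff_conj [LieGroup 𝓘(ℝ, E) ∞ G] (g : G) :
    ContMDiff 𝓘(ℝ, E) 𝓘(ℝ, E) ∞ (fun x : G => g * x * g⁻¹) :=
  (contMDiff_const.mul contMDiff_id).mul contMDiff_const

theorem Ad_mul [LieGroup 𝓘(ℝ, E) ∞ G] (g h : G) :
    Ad (E := E) (g * h) = (Ad g).comp (Ad h) := by
  have e : (fun x : G => (g * h) * x * (g * h)⁻¹)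
      = (fun x : G => g * x * g⁻¹) ∘ (fun x : G => h * x * h⁻¹) := by
    ext x; simp [mul_assoc]
  have hd : ∀ (k x : G), MDifferentiableAt 𝓘(ℝ, E) 𝓘(ℝ, E) (fun x : G => k * x * k⁻¹) x :=
    fun k x => (contMDiff_conj k).mdifferentiableAt (by simp)
  let φ : G → (E →L[ℝ] E) := fun x =>
    (mfderiv 𝓘(ℝ, E) 𝓘(ℝ, E) (fun x : G => g * x * g⁻¹) x :)
  have h1 : φ (h * 1 * h⁻¹) = φ 1 := congrArg φ (by simp)
  have h2 : Ad (E := E) (g * h) = (φ (h * 1 * h⁻¹)).comp (Ad h) := by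
    unfold Ad
    rw [e]
    exact mfderiv_comp (I' := 𝓘(ℝ, E)) 1 (hd g _) (hd h 1)
  rw [h2, h1]
  rfl

theorem coAd_one [LieGroup 𝓘(ℝ, E) ∞ G] (η : E →L[ℝ] ℝ) : coAd (1 : G) η = η := by
  simp [coAd, Ad_one]

theorem coAd_mul [LieGroup 𝓘(ℝ, E) ∞ G] (g h : G) (η : E →L[ℝ] ℝ) :
    coAd (g * h) η = coAd g (coAd h η) := by
  simp [coAd, Ad_mul, ContinuousLinearMap.comp_assoc]

/-- The isotropy group `G_μ = {g : Ad*(g) μ = μ}`. -/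
def isotropyGroup [LieGroup 𝓘(ℝ, E) ∞ G] (μ : E →L[ℝ] ℝ) : Subgroup G where
  carrier := {g | coAd g μ = μ}
  one_mem' := coAd_one μ
  mul_mem' := by
    intro a b ha hb
    simp only [Set.mem_ofPred_eq] at *
    rw [coAd_mul, hb, ha]
  inv_mem' := by
    intro a ha
    simp only [Set.mem_ofPred_eq] at *
    conv_lhs => rw [← ha]
    rw [← coAd_mul, inv_mul_cancel, coAd_one]

theorem lieGroup_min [LieGroup 𝓘(ℝ, E) ∞ G] : LieGroup 𝓘(ℝ, E) (minSmoothness ℝ 3) G := by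
  rw [minSmoothness_of_isRCLikeNormedField]
  infer_instance

theorem bracket_add_left [FiniteDimensional ℝ E] [LieGroup 𝓘(ℝ, E) ∞ G] (A A' B : E) :
    bracket G (A + A') B = bracket G A B + bracket G A' B := by
  have := lieGroup_min (E := E) (G := G)
  have := FiniteDimensional.complete ℝ E
  exact add_lie (L := GroupLieAlgebra 𝓘(ℝ, E) G) (M := GroupLieAlgebra 𝓘(ℝ, E) G) A A' B

theorem bracket_smul_left [FiniteDimensional ℝ E] [LieGroup 𝓘(ℝ, E) ∞ G] (c : ℝ) (A B : E) :
    bracket G (c • A) B = c • bracket G A B := by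
  have := lieGroup_min (E := E) (G := G)
  have := FiniteDimensional.complete ℝ E
  exact smul_lie (R := ℝ) (L := GroupLieAlgebra 𝓘(ℝ, E) G) (M := GroupLieAlgebra 𝓘(ℝ, E) G) c A B

variable (G) in
/-- The isotropy algebra `𝔤_μ = {A : ⟨μ; [A, B]⟩ = 0 for all B}`. -/
def isotropyAlgebra [FiniteDimensional ℝ E] [LieGroup 𝓘(ℝ, E) ∞ G] (μ : E →L[ℝ] ℝ) :
    Submodule ℝ E where
  carrier := {A | ∀ B : E, μ (bracket G A B) = 0}
  add_mem' := by
    intro A A' hA hA' B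
    rw [bracket_add_left, map_add, hA B, hA' B, add_zero]
  zero_mem' := by
    intro B
    have h := bracket_smul_left (G := G) (0 : ℝ) (0 : E) B
    rw [zero_smul, zero_smul] at h
    rw [h, map_zero]
  smul_mem' := by
    intro c A hA B
    rw [bracket_smul_left, map_smul, hA B, smul_zero]

variable (G) in
/-- The rank of `G`: the minimum of the dimensions of the isotropy algebras `𝔤_μ`. -/
def groupRank [FiniteDimensional ℝ E] [LieGroup 𝓘(ℝ, E) ∞ G] : ℕ := ⨅ μ : E →L[ℝ] ℝ, Module.finrank ℝ (isotropyAlgebra G μ)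

variable (G) in
/-- The set `𝔤*_r` of regular elements of `𝔤*`. -/
def regularElements [FiniteDimensional ℝ E] [LieGroup 𝓘(ℝ, E) ∞ G] : Set (E →L[ℝ] ℝ) :=
  {μ | Module.finrank ℝ (isotropyAlgebra G μ) = groupRank (E := E) G}

variable (G) in
/-- The coadjoint orbit `𝒪(μ)`. -/
def coadjointOrbit (μ : E →L[ℝ] ℝ) : Set (E →L[ℝ] ℝ) := range fun g : G => coAd g μ

variable (G) in
/-- The tangent space `O(μ) = ad*(𝔤) μ` of the coadjoint orbit at `μ`, where
`⟨ad*(A) μ; B⟩ = -⟨μ; [A, B]⟩`. -/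
def orbitTangent (μ : E →L[ℝ] ℝ) : Set (E →L[ℝ] ℝ) :=
  {v | ∃ A : E, ∀ B : E, v B = -μ (bracket G A B)}

end LieGroup

/-! ### Exterior calculus -/

/-- The exterior derivative `dα(u, w)` at `x` of a differential 1-form `α` on a manifold without
boundary, with the normalisation `dα(X, Y) = (X α(Y) - Y α(X) - α([X, Y])) / 2`.  It is computed in
the preferred chart at `x`, the one through which Mathlib identifies `T_x M` with `V`. -/
def extDerivOneForm {V H M : Type*} [NormedAddCommGroup V] [NormedSpace ℝ V] [TopologicalSpace H]
    (I : ModelWithCorners ℝ V H) [TopologicalSpace M] [ChartedSpace H M]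
    (α : M → (V →L[ℝ] ℝ)) (x : M) (u w : V) : ℝ :=
  let c : V → M := (extChartAt I x).symm
  let β : V → (V →L[ℝ] ℝ) := fun e => (α (c e)).comp (mfderiv 𝓘(ℝ, V) I c e :)
  (fderiv ℝ β (extChartAt I x x) u w - fderiv ℝ β (extChartAt I x x) w u) / 2

/-- Up to a positive normalisation factor, the value of `α ∧ Ψ^m` on `2 m + 1` vectors, for a
1-form `α` and a 2-form `Ψ` on a vector space. -/
def wedgePow {V : Type*} (α : V → ℝ) (Ψ : V → V → ℝ) (m : ℕ) (v : Fin (2 * m + 1) → V) : ℝ :=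
  ∑ σ : Equiv.Perm (Fin (2 * m + 1)), ((Equiv.Perm.sign σ : ℤ) : ℝ) *
    (α (v (σ 0)) * ∏ i : Fin m,
      Ψ (v (σ ⟨2 * i + 1, by omega⟩)) (v (σ ⟨2 * i + 2, by omega⟩)))

/-- `f : N → M` is a smooth one-to-one immersion, i.e. it presents `N` as a (not necessarily
embedded) submanifold of `M`. -/
def IsImmersedSubmanifold {V H N V' H' M : Type*}
    [NormedAddCommGroup V] [NormedSpace ℝ V] [TopologicalSpace H] (I : ModelWithCorners ℝ V H)
    [TopologicalSpace N] [ChartedSpace H N]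
    [NormedAddCommGroup V'] [NormedSpace ℝ V'] [TopologicalSpace H'] (I' : ModelWithCorners ℝ V' H')
    [TopologicalSpace M] [ChartedSpace H' M] (f : N → M) : Prop :=
  ContMDiff I I' ∞ f ∧ Function.Injective f ∧ ∀ x, Function.Injective (mfderiv I I' f x)

/-! ### Linear control systems and invariant Lagrangians -/

/-- The data of a linear control system: an affine subspace `𝔸 = P + 𝔞` of `𝔤`, with `P ∉ 𝔞`, and
the independence condition `ω ∈ 𝔤*` with `⟨ω; P⟩ = 1`, `ω ∈ 𝔞^⊥`. -/
structure ControlSystem (E : Type*) [NormedAddCommGroup E] [NormedSpace ℝ E] where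
  P : E
  a : Submodule ℝ E
  om : E →L[ℝ] ℝ
  P_notMem : P ∉ a
  om_P : om P = 1
  om_a : ∀ A ∈ a, om A = 0

section Control

variable {E : Type*} [NormedAddCommGroup E] [NormedSpace ℝ E]
variable {G : Type*} [TopologicalSpace G] [ChartedSpace E G] [Group G]
variable (D : ControlSystem E)

/-- The manifold `G × 𝔸 × 𝔤*`, where the point `Q = P + A` of `𝔸` is written as the vector
`A ∈ 𝔞`. -/
abbrev Ambient (G : Type*) {E : Type*} [NormedAddCommGroup E] [NormedSpace ℝ E]
    (D : ControlSystem E) : Type _ := G × (D.a × (E →L[ℝ] ℝ))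

/-- The tangent spaces `T_g G ⊕ 𝔞 ⊕ 𝔤*` of `G × 𝔸 × 𝔤*`. -/
abbrev AmbientVec {E : Type*} [NormedAddCommGroup E] [NormedSpace ℝ E]
    (D : ControlSystem E) : Type _ := E × (D.a × (E →L[ℝ] ℝ))

/-- The model of the manifold `G × 𝔸 × 𝔤*`. -/
abbrev ambientModel : ModelWithCorners ℝ (AmbientVec D) (ModelProd E (D.a × (E →L[ℝ] ℝ))) :=
  𝓘(ℝ, E).prod 𝓘(ℝ, D.a × (E →L[ℝ] ℝ))

/-- The 1-form `ω` (pulled back from `G`). -/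
def omegaForm (g : G) (u : E) : ℝ := D.om (maurerCartan g u)

/-- The Liouville form on `G × 𝔸 × 𝔤*`: at `(g, Q, η)` it is the pull-back of the left-invariant
form `η`. -/
def liouville (z : Ambient G D) : AmbientVec D →L[ℝ] ℝ :=
  (z.2.2.comp (maurerCartan z.1)).comp (ContinuousLinearMap.fst ℝ E (D.a × (E →L[ℝ] ℝ)))

/-- The canonical 2-form `Ψ = dψ`. -/
def canonicalForm (z : Ambient G D) (u w : AmbientVec D) : ℝ :=
  extDerivOneForm (ambientModel D) (liouville D) z u w

variable (G) in
/-- The affine sub-bundle `Z̃ = {(g, Q, η) : ⟨η; Q⟩ = L(Q)}`. -/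
def affineBundle (L : D.a → ℝ) : Set (Ambient G D) :=
  {z | z.2.2 (D.P + z.2.1) = L z.2.1}

/-- The tangent space of `Z̃` at `z`. -/
def affineBundleTangent (L : D.a → ℝ) (z : Ambient G D) : Set (AmbientVec D) :=
  {u | u.2.2 (D.P + z.2.1) + z.2.2 u.2.1 = fderiv ℝ L z.2.1 u.2.1}

/-- The submanifold `f : N → Z̃` is tangent, at each of its points, to an integral element of the
Cartan system `(𝒞(Ψ), ω)` on `Z̃`: there is a tangent vector `u` of `N` with `Ψ(u, ·) = 0` on
`Z̃` and `ω(u) ≠ 0`. -/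
def TangentToIntegralElements (L : D.a → ℝ) {V H N : Type*} [NormedAddCommGroup V]
    [NormedSpace ℝ V] [TopologicalSpace H] (I : ModelWithCorners ℝ V H)
    [TopologicalSpace N] [ChartedSpace H N] (f : N → Ambient G D) : Prop :=
  ∀ x : N, f x ∈ affineBundle G D L ∧ ∃ v : V,
    let u : AmbientVec D := (mfderiv I (ambientModel D) f x : V →L[ℝ] AmbientVec D) v
    (∀ w ∈ affineBundleTangent D L (f x), canonicalForm D (f x) u w = 0) ∧
      omegaForm D (f x).1 u.1 ≠ 0

/-- The submanifold `f : N → Z̃` is the reduced space of the Cartan system `(𝒞(Ψ), ω)` on `Z̃`: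
it is a non-empty submanifold tangent to an integral element at each of its points, and contains
every other submanifold with this property. -/
def IsReducedSpace (L : D.a → ℝ) {V H N : Type*} [NormedAddCommGroup V]
    [NormedSpace ℝ V] [TopologicalSpace H] (I : ModelWithCorners ℝ V H)
    [TopologicalSpace N] [ChartedSpace H N] (f : N → Ambient G D) : Prop :=
  Nonempty N ∧ IsImmersedSubmanifold I (ambientModel D) f ∧ TangentToIntegralElements D L I f ∧
    ∀ (r : ℕ) (N' : Type) [TopologicalSpace N'] [T2Space N'] [SecondCountableTopology N']
      [ChartedSpace (EuclideanSpace ℝ (Fin r)) N'] [IsManifold (𝓡 r) ∞ N'] (f' : N' → Ambient G D),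
      IsImmersedSubmanifold (𝓡 r) (ambientModel D) f' →
      TangentToIntegralElements D L (𝓡 r) f' → range f' ⊆ range f

end Control

/-! ### The momentum space `Y = G × ℱ` -/

section Momentum

variable {E : Type*} [NormedAddCommGroup E] [NormedSpace ℝ E]
variable {G : Type*} [TopologicalSpace G] [ChartedSpace E G] [Group G]
variable (D : ControlSystem E)
variable {E' : Type*} [NormedAddCommGroup E'] [NormedSpace ℝ E']
variable {F : Type*} [TopologicalSpace F] [ChartedSpace E' F]
variable (j : F → D.a × (E →L[ℝ] ℝ))

variable (E E') in
/-- The model of the manifold `G × ℱ`. -/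
abbrev yModel : ModelWithCorners ℝ (E × E') (ModelProd E E') := 𝓘(ℝ, E).prod 𝓘(ℝ, E')

variable (G) in
/-- The map `(g, p) ↦ (g, j p)` from `G × ℱ` to `G × 𝔸 × 𝔤*`. -/
def momentumMap (y : G × F) : Ambient G D := (y.1, j y.2)

variable (G E') in
/-- `ℱ` (with `j : ℱ → 𝔸 × 𝔤*`) is the phase space of the variational problem defined by `L`: the
momentum space, i.e. the reduced space of the Cartan system on `Z̃`, is `Y = G × ℱ`. -/
def IsPhaseSpace (L : D.a → ℝ) : Prop :=
  IsReducedSpace D L (yModel E E') (momentumMap G D j)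

/-- The Legendre transform `Λ : ℱ → 𝔤*`. -/
def legendre (p : F) : E →L[ℝ] ℝ := (j p).2

/-- The differential of the Legendre transform. -/
def legendreDeriv (p : F) : E' →L[ℝ] (E →L[ℝ] ℝ) :=
  (mfderiv 𝓘(ℝ, E') 𝓘(ℝ, E →L[ℝ] ℝ) (legendre D j) p :)

/-- `Ψ_Y`, the restriction of the canonical 2-form to `Y = G × ℱ`. -/
def formY (y : G × F) (u w : E × E') : ℝ :=
  let d : E × E' →L[ℝ] AmbientVec D :=
    (mfderiv (yModel E E') (ambientModel D) (momentumMap G D j) y :)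
  canonicalForm D (momentumMap G D j y) (d u) (d w)

variable (G E') in
/-- `L` is non-degenerate: `dim Y = 2 m + 1` is odd and `ω ∧ (Ψ_Y)^m` is nowhere zero. -/
def IsNondegenerate : Prop :=
  ∃ m : ℕ, Module.finrank ℝ E + Module.finrank ℝ E' = 2 * m + 1 ∧
    ∀ y : G × F, ∃ v : Fin (2 * m + 1) → E × E',
      wedgePow (fun u => omegaForm D y.1 u.1) (formY D j y) m v ≠ 0

/-- The characteristic vector field `ξ` of `Y`: the vector `ξ|_y` is the unique one with
`Ψ_Y(ξ, ·) = 0` and `ω(ξ) = 1`. -/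
def charField (y : G × F) : E × E' :=
  Classical.epsilon fun u : E × E' => (∀ w, formY D j y u w = 0) ∧ omegaForm D y.1 u.1 = 1

variable (G E') in
/-- The component `Φ_ξ` of `ξ|_{(g, p)} = A_ξ(p)|_g + Φ_ξ(p)`, evaluated at `g = 1` (it does not
depend on `g`, since `ξ` is invariant under left translations). -/
def phaseField (p : F) : E' := (charField D j ((1 : G), p)).2

variable (G E') in
/-- The regular part `ℱ_r` of the phase space. -/
def regularPhase : Set F := {p | phaseField G D E' j p ≠ 0}

variable (G E') in
/-- The regular part `Y_r = G × ℱ_r` of the momentum space. -/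
def regularMomentum : Set (G × F) := {y | y.2 ∈ regularPhase G D E' j}

/-- The value at `y ∈ Y` of the fundamental vector field of `A ∈ 𝔤` for the action
`h • (g, p) = (h g, p)` of `G` on `Y`. -/
def fundamental (y : G × F) (A : E) : E × E' :=
  (mfderiv 𝓘(ℝ, E) (yModel E E') (fun h : G => ((h * y.1, y.2) : G × F)) 1 : E →L[ℝ] E × E') A

variable (G E') in
/-- The action of `G` on the regular part of `Y` is coisotropic with respect to `Ψ_Y`: the polar
space of the orbit directions is contained in their sum with the kernel of `Ψ_Y`. -/
def IsCoisotropic : Prop :=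
  ∀ y ∈ regularMomentum G D E' j, ∀ v : E × E',
    (∀ A : E, formY D j y v (fundamental y A) = 0) →
      ∃ (A : E) (n : E × E'), (∀ w, formY D j y n w = 0) ∧ v = fundamental y A + n

/-! ### The moment map and its fibres -/

/-- The moment map `J(g, η) = Ad*(g) η`. -/
def momentJ (y : G × F) : E →L[ℝ] ℝ := coAd y.1 (legendre D j y.2)

variable (G E') in
/-- The fibre `J⁻¹(μ)` of the moment map on the regular part of `Y`. -/
def fiber (μ : E →L[ℝ] ℝ) : Set (G × F) :=
  {y | y ∈ regularMomentum G D E' j ∧ momentJ D j y = μ}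

/-- The action `h • (g, p) = (h g, p)` of `G_μ` on `J⁻¹(μ)`. -/
instance fiberAction [LieGroup 𝓘(ℝ, E) ∞ G] (μ : E →L[ℝ] ℝ) :
    MulAction (isotropyGroup (G := G) μ) (fiber G D E' j μ) where
  smul h y := ⟨((h : G) * y.1.1, y.1.2), y.2.1, by
    have hy : coAd y.1.1 (legendre D j y.1.2) = μ := y.2.2
    have hh : coAd (h : G) μ = μ := h.2
    change coAd ((h : G) * y.1.1) (legendre D j y.1.2) = μ
    rw [coAd_mul, hy, hh]⟩
  one_smul y := Subtype.ext (Prod.ext (one_mul _) rfl)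
  mul_smul a b y := Subtype.ext (Prod.ext (mul_assoc _ _ _) rfl)

variable (G E') in
/-- The reduced space `Y_μ = J⁻¹(μ) / G_μ`, with the quotient topology. -/
abbrev ReducedSpace [LieGroup 𝓘(ℝ, E) ∞ G] (μ : E →L[ℝ] ℝ) : Type _ :=
  MulAction.orbitRel.Quotient (isotropyGroup (G := G) μ) (fiber G D E' j μ)

variable (G E') in
/-- The projection `π_μ : J⁻¹(μ) → Y_μ`. -/
def reducedProj [LieGroup 𝓘(ℝ, E) ∞ G] (μ : E →L[ℝ] ℝ) (y : fiber G D E' j μ) :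
    ReducedSpace G D E' j μ := Quotient.mk _ y

/-- The subspace `span(ξ|_y) + 𝔤_η` of `T_y Y`, where `y = (g, η)` and `A ∈ 𝔤_η` is regarded as the
tangent vector `A|_g`. -/
def fiberTangent [FiniteDimensional ℝ E] [LieGroup 𝓘(ℝ, E) ∞ G] (y : G × F) : Submodule ℝ (E × E') :=
  Submodule.span ℝ {charField D j y} ⊔
    (isotropyAlgebra G (legendre D j y.2)).map
      ((LinearMap.inl ℝ E E').comp (leftTrans (E := E) y.1 : E →L[ℝ] E).toLinearMap)

variable (G E') in
/-- The (regular part of the) phase portrait `𝒫(μ) = ℱ_r ∩ 𝒪(μ)`, where `ℱ` is regarded as a subset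
of `𝔤*` through the Legendre transform.  As a submanifold of `ℱ` it need not carry the subspace
topology, so no topology is put on this type. -/
def PhasePortrait (μ : E →L[ℝ] ℝ) : Type _ :=
  {p : F // p ∈ regularPhase G D E' j ∧ legendre D j p ∈ coadjointOrbit G μ}

/-- The inclusion `𝒫(μ) → ℱ`. -/
def PhasePortrait.incl {D : ControlSystem E} {j : F → D.a × (E →L[ℝ] ℝ)} {μ : E →L[ℝ] ℝ}
    (p : PhasePortrait G D E' j μ) : F := p.1

variable (G E') in
/-- The linearized phase portrait `Π(η) = F(η) ∩ O(η)` at `η = Λ(p)`, where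
`F(η) = dΛ(T_p ℱ)`. -/
def linearizedPortrait (p : F) : Set (E →L[ℝ] ℝ) :=
  range (legendreDeriv (E' := E') D j p) ∩ orbitTangent G (legendre D j p)

end Momentum

/-! ### Principal bundles -/

/-- `π : P → B` is a smooth principal bundle for the action of the Lie group `K` on `P`: `π` is a
smooth surjection whose fibres are the `K`-orbits, and is locally `K`-equivariantly diffeomorphic to
`U × K → U`. -/
structure IsSmoothPrincipalBundle {VK HK K VP HP P VB HB B : Type*}
    [NormedAddCommGroup VK] [NormedSpace ℝ VK] [TopologicalSpace HK] (IK : ModelWithCorners ℝ VK HK)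
    [TopologicalSpace K] [ChartedSpace HK K] [Group K]
    [NormedAddCommGroup VP] [NormedSpace ℝ VP] [TopologicalSpace HP] (IP : ModelWithCorners ℝ VP HP)
    [TopologicalSpace P] [ChartedSpace HP P] [MulAction K P]
    [NormedAddCommGroup VB] [NormedSpace ℝ VB] [TopologicalSpace HB] (IB : ModelWithCorners ℝ VB HB)
    [TopologicalSpace B] [ChartedSpace HB B] (π : P → B) : Prop where
  smooth_proj : ContMDiff IP IB ∞ π
  surjective_proj : Function.Surjective π
  fibre_eq_orbit : ∀ x y : P, π x = π y ↔ ∃ h : K, h • x = y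
  locally_trivial : ∀ b : B, ∃ U : Set B, IsOpen U ∧ b ∈ U ∧
    ∃ τ : OpenPartialHomeomorph (B × K) P, τ.source = U ×ˢ univ ∧ τ.target = π ⁻¹' U ∧
      ContMDiffOn (IB.prod IK) IP ∞ τ τ.source ∧
      ContMDiffOn IP (IB.prod IK) ∞ τ.symm τ.target ∧
      ∀ b' ∈ U, ∀ h : K, π (τ (b', h)) = b' ∧ ∀ h' : K, τ (b', h' * h) = h' • τ (b', h)

end

end CoisotropicVP

open CoisotropicVP

open Set Topology
open scoped Manifold ContDiff

set_option linter.unusedSectionVars false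

namespace CoisotropicVP
noncomputable section

/-! ### Derivatives in charts -/

section MD

variable {V H M : Type*} [NormedAddCommGroup V] [NormedSpace ℝ V] [TopologicalSpace H]
  {I : ModelWithCorners ℝ V H} [TopologicalSpace M] [ChartedSpace H M]
  {V' H' M' : Type*} [NormedAddCommGroup V'] [NormedSpace ℝ V'] [TopologicalSpace H']
  {I' : ModelWithCorners ℝ V' H'} [TopologicalSpace M'] [ChartedSpace H' M']
  {V'' H'' M'' : Type*} [NormedAddCommGroup V''] [NormedSpace ℝ V''] [TopologicalSpace H'']
  {I'' : ModelWithCorners ℝ V'' H''} [TopologicalSpace M''] [ChartedSpace H'' M'']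

/-! Left translation identifies `T_y Y` with `𝔤 × E'`, and the Maurer-Cartan equation turns `Ψ_Y`
into an algebraic expression: up to the factor 1/2, `Ψ_Y((A, e), (B, f)) = ⟨dΛ(e); B⟩ - ⟨dΛ(f); A⟩ +
⟨ad*(A)η; B⟩` (`canonicalForm_eq`, `formY_eq`). Everything is read off from it together with `dJ(A,
e) = Ad*(g)(ad*(A)η + dΛ(e))` (`hasMFDerivAt_momentJ`). A vector is in the kernel of `Ψ_Y` iff
`dΛ(e) = -ad*(A)η` and `A` annihilates the image of `dΛ` (`forall_formY_eq_zero_iff`). The first of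
these conditions alone is orthogonality to the `G`-orbit, and it is also `dJ(A, e) = 0`.

Non-degeneracy forces the kernel of `Ψ_Y` to be the line of `ξ`, since a nonzero kernel vector
annihilated by `ω` would kill `ω ∧ Ψ_Y^m` (`wedgePow_eq_zero_of_kernel`, `exists_isCharacteristic`).
The annihilator of the image of `dJ` consists, after translation, of the `B` such that `(B, 0)` is a
kernel vector. Hence `dJ` is onto exactly where `Φ_ξ ≠ 0` (`momentDeriv_surjective_iff`), an open
condition. Coisotropy says that `ker dJ = span ξ + 𝔤_η` (`ker_momentDeriv`), a direct sum because
`Φ_ξ ≠ 0`.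

Rank-nullity now gives `dim 𝔤_η + 1 = dim ℱ` on `ℱ_r`, so `dim 𝔤_μ` is constant on the open set
`J(Y_r)`. Moving from a point of this set along the line towards an element of minimal isotropy, the
kernel dimension is at most the minimum for all small nonzero parameters; hence the constant value
is the rank (`finrank_isotropyAlgebra_eq_groupRank`).

The geometric part rests on one constant rank theorem, `exists_rank_chart`. Applied to `J` and to `g
↦ Ad*(g)μ` it makes `J⁻¹(μ)` and `G_μ` embedded submanifolds. Two points of `J⁻¹(μ)` lie in the same
`G_μ`-orbit iff they have the same component in `ℱ` (`smul_fiber_eq_iff`), that is, the same value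
of `Λ`. On `J⁻¹(μ)` the map `(g, p) ↦ Λ(p)` has rank one, its differential killing `𝔤_η` and sending
`ξ` to `dΛ(Φ_ξ) ≠ 0`. The constant rank theorem then gives charts whose last coordinate separates
orbits; these provide both the charts of `Y_μ` and local sections, hence the bundle
(`exists_chartedSpace_quotient`, `isSmoothPrincipalBundle_reducedProj`). The structure of `𝒫(μ)` is
carried over from `Y_μ` by the bijection `[(g, η)] ↦ η`, and the rank-one computation shows that the
inclusion is an immersion tangent to `Π`. -/

variable (I I') in
/-- The manifold derivative, as a linear map between the model vector spaces. -/
def md (f : M → M') (x : M) : V →L[ℝ] V' := (mfderiv I I' f x :)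

theorem hasMFDerivAt_md {f : M → M'} {x : M} (hf : MDifferentiableAt I I' f x) :
    HasMFDerivAt I I' f x (md I I' f x : V →L[ℝ] V') := hf.hasMFDerivAt

theorem md_eq_of_hasMFDerivAt {f : M → M'} {x : M} {f' : V →L[ℝ] V'}
    (hf : HasMFDerivAt I I' f x f') : md I I' f x = f' := hf.mfderiv

/-- The intermediate point is only propositionally `f x`: typical base points are `g * 1` or `g⁻¹ *
g`, where rewriting inside the tangent spaces is awkward. -/
theorem hasMFDerivAt_comp_of_eq {f : M → M'} {g : M' → M''} {x : M} {y : M'}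
    {f' : V →L[ℝ] V'} {g' : V' →L[ℝ] V''}
    (hg : HasMFDerivAt I' I'' g y g') (hf : HasMFDerivAt I I' f x f') (h : f x = y) :
    HasMFDerivAt I I'' (fun z => g (f z)) x (g'.comp f' : V →L[ℝ] V'') := by
  subst h
  exact HasMFDerivAt.comp x hg hf

theorem md_comp_of_eq {f : M → M'} {g : M' → M''} {x : M} {y : M'}
    (hg : MDifferentiableAt I' I'' g y) (hf : MDifferentiableAt I I' f x) (h : f x = y) :
    md I I'' (fun z => g (f z)) x = (md I' I'' g y).comp (md I I' f x) :=
  md_eq_of_hasMFDerivAt (hasMFDerivAt_comp_of_eq (hasMFDerivAt_md hg) (hasMFDerivAt_md hf) h)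

theorem md_id (x : M) : md I I (fun y : M => y) x = ContinuousLinearMap.id ℝ V := mfderiv_id

theorem md_congr {f g : M → M'} {x : M} (h : f =ᶠ[𝓝 x] g) : md I I' f x = md I I' g x :=
  Filter.EventuallyEq.mfderiv_eq h

theorem md_extChartAt_self [IsManifold I 1 M] (x : M) :
    md I 𝓘(ℝ, V) (extChartAt I x) x = ContinuousLinearMap.id ℝ V := mfderiv_extChartAt_self

/-- The manifold derivative at `x` is by definition that of the expression in the preferred chart at
`x`; a vector-valued target needs no chart of its own. -/
theorem hasFDerivAt_comp_extChartAt_symm [I.Boundaryless] {W : Type*}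
    [NormedAddCommGroup W] [NormedSpace ℝ W] {f : M → W} {x : M} {f' : V →L[ℝ] W}
    (hf : HasMFDerivAt I 𝓘(ℝ, W) f x f') :
    HasFDerivAt (fun y => f ((extChartAt I x).symm y)) f' (extChartAt I x x) := by
  have h : HasFDerivWithinAt (fun y => f ((extChartAt I x).symm y)) f' (range I)
    (extChartAt I x x) := hf.2
  rwa [I.range_eq_univ, hasFDerivWithinAt_univ] at h

theorem md_eq_fderiv_comp_extChartAt_symm [I.Boundaryless] {W : Type*}
    [NormedAddCommGroup W] [NormedSpace ℝ W] {f : M → W} {x : M}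
    (hf : MDifferentiableAt I 𝓘(ℝ, W) f x) :
    md I 𝓘(ℝ, W) f x = fderiv ℝ (fun y => f ((extChartAt I x).symm y)) (extChartAt I x x) :=
  (hasFDerivAt_comp_extChartAt_symm (hasMFDerivAt_md hf)).fderiv.symm

theorem hasMFDerivAt_of_comp_extChartAt_symm [I.Boundaryless] {W : Type*}
    [NormedAddCommGroup W] [NormedSpace ℝ W] {f : M → W} {x : M} {f' : V →L[ℝ] W}
    (hc : ContinuousAt f x)
    (hf : HasFDerivAt (fun y => f ((extChartAt I x).symm y)) f' (extChartAt I x x)) :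
    HasMFDerivAt I 𝓘(ℝ, W) f x f' :=
  ⟨hc, hf.hasFDerivWithinAt⟩

theorem hasMFDerivAt_iff {W W' : Type*} [NormedAddCommGroup W] [NormedSpace ℝ W]
    [NormedAddCommGroup W'] [NormedSpace ℝ W'] {f : W → W'} {x : W} {f' : W →L[ℝ] W'} :
    HasMFDerivAt 𝓘(ℝ, W) 𝓘(ℝ, W') f x f' ↔ HasFDerivAt f f' x := hasMFDerivAt_iff_hasFDerivAt

theorem contMDiffAt_extChartAt_symm [I.Boundaryless] [IsManifold I ∞ M] (g : M) {x : V}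
    (hx : x ∈ (extChartAt I g).target) :
    ContMDiffAt 𝓘(ℝ, V) I ∞ (extChartAt I g).symm x :=
  (contMDiffOn_extChartAt_symm g).contMDiffAt ((isOpen_extChartAt_target g).mem_nhds hx)

theorem md_extChartAt_symm_comp [I.Boundaryless] [IsManifold I ∞ M] (g : M) {x : V}
    (hx : x ∈ (extChartAt I g).target) :
    (md 𝓘(ℝ, V) I (extChartAt I g).symm x).comp
      (md I 𝓘(ℝ, V) (extChartAt I g) ((extChartAt I g).symm x)) = ContinuousLinearMap.id ℝ V := by
  have : IsManifold I 1 M := IsManifold.of_le (n := ∞) (by simp)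
  have h := mfderivWithin_extChartAt_symm_comp_mfderiv_extChartAt (I := I) hx
  rw [ModelWithCorners.range_eq_univ, mfderivWithin_univ] at h
  exact h

theorem md_extChartAt_comp_symm [I.Boundaryless] [IsManifold I ∞ M] (g : M) {x : V}
    (hx : x ∈ (extChartAt I g).target) :
    (md I 𝓘(ℝ, V) (extChartAt I g) ((extChartAt I g).symm x)).comp
      (md 𝓘(ℝ, V) I (extChartAt I g).symm x) = ContinuousLinearMap.id ℝ V := by
  have : IsManifold I 1 M := IsManifold.of_le (n := ∞) (by simp)
  have h := mfderiv_extChartAt_comp_mfderivWithin_extChartAt_symm (I := I) hx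
  rw [ModelWithCorners.range_eq_univ, mfderivWithin_univ] at h
  exact h

end MD

/-! ### Left-invariant vector fields and the bracket in preferred charts. -/

section LieGroup

variable {E : Type*} [NormedAddCommGroup E] [NormedSpace ℝ E]
variable {G : Type*} [TopologicalSpace G] [ChartedSpace E G] [Group G]

theorem leftTrans_one (A : E) : leftTrans (1 : G) A = A := by
  have h : (fun x : G => (1 : G) * x) = fun x => x := by ext x; simp
  change md 𝓘(ℝ, E) 𝓘(ℝ, E) (fun x : G => (1 : G) * x) 1 A = A
  rw [h, md_id]
  rfl

variable [LieGroup 𝓘(ℝ, E) ∞ G]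

theorem mdifferentiableAt_mul_left (g x : G) :
    MDifferentiableAt 𝓘(ℝ, E) 𝓘(ℝ, E) (fun y : G => g * y) x :=
  (contMDiff_mul_left (I := 𝓘(ℝ, E)) (n := ∞)).mdifferentiableAt (by simp)

theorem mdifferentiableAt_mul_right (g x : G) :
    MDifferentiableAt 𝓘(ℝ, E) 𝓘(ℝ, E) (fun y : G => y * g) x :=
  (contMDiff_mul_right (I := 𝓘(ℝ, E)) (n := ∞)).mdifferentiableAt (by simp)

theorem mdifferentiableAt_conj (g x : G) :
    MDifferentiableAt 𝓘(ℝ, E) 𝓘(ℝ, E) (fun y : G => g * y * g⁻¹) x :=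
  (contMDiff_conj g).mdifferentiableAt (by simp)

@[simp]
theorem maurerCartan_leftTrans (g : G) (A : E) : maurerCartan g (leftTrans g A) = A := by
  have hc := md_comp_of_eq (mdifferentiableAt_mul_left (E := E) g⁻¹ g)
    (mdifferentiableAt_mul_left (E := E) g 1) (mul_one g)
  simp only [inv_mul_cancel_left, md_id] at hc
  exact congrArg (fun T : E →L[ℝ] E => T A) hc.symm

@[simp]
theorem leftTrans_maurerCartan (g : G) (A : E) : leftTrans g (maurerCartan g A) = A := by
  have hc := md_comp_of_eq (mdifferentiableAt_mul_left (E := E) g 1)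
    (mdifferentiableAt_mul_left (E := E) g⁻¹ g) (inv_mul_cancel g)
  simp only [mul_inv_cancel_left, md_id] at hc
  exact congrArg (fun T : E →L[ℝ] E => T A) hc.symm

theorem maurerCartan_one (A : E) : maurerCartan (1 : G) A = A := by
  conv_rhs => rw [← maurerCartan_leftTrans (1 : G) A, leftTrans_one]

variable (E G) in
/-- The coordinates of `1` in its preferred chart. -/
def chartOne : E := extChartAt 𝓘(ℝ, E) (1 : G) 1

variable (G) in
/-- The function `(x, y) ↦ f (x, y)` on `G × G` in the preferred charts at `g` and, on the target
side, at `1`. -/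
def chartFun (g : G) (f : G → G → G) (p : E × E) : E :=
  extChartAt 𝓘(ℝ, E) (1 : G)
    (f ((extChartAt 𝓘(ℝ, E) g).symm p.1) ((extChartAt 𝓘(ℝ, E) g).symm p.2))

theorem contDiffAt_chartFun (g : G) {f : G → G → G} (hfg : f g g = 1)
    (hf : ContMDiff (𝓘(ℝ, E).prod 𝓘(ℝ, E)) 𝓘(ℝ, E) ∞ fun p : G × G => f p.1 p.2) :
    ContDiffAt ℝ ∞ (chartFun G g f) (extChartAt 𝓘(ℝ, E) g g, extChartAt 𝓘(ℝ, E) g g) := by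
  rw [← contMDiffAt_iff_contDiffAt]
  set e := extChartAt 𝓘(ℝ, E) g g with he
  have hs : ContMDiffAt 𝓘(ℝ, E) 𝓘(ℝ, E) ∞ (extChartAt 𝓘(ℝ, E) g).symm e :=
    contMDiffAt_extChartAt_symm g (mem_extChartAt_target g)
  have h1 : ContMDiffAt 𝓘(ℝ, E × E) 𝓘(ℝ, E) ∞
      (fun p : E × E => (extChartAt 𝓘(ℝ, E) g).symm p.1) (e, e) :=
    ContMDiffAt.comp (x := (e, e)) (I' := 𝓘(ℝ, E))
      (g := (extChartAt 𝓘(ℝ, E) g).symm) (f := Prod.fst) hs contDiff_fst.contMDiff.contMDiffAt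
  have h2 : ContMDiffAt 𝓘(ℝ, E × E) 𝓘(ℝ, E) ∞
      (fun p : E × E => (extChartAt 𝓘(ℝ, E) g).symm p.2) (e, e) :=
    ContMDiffAt.comp (x := (e, e)) (I' := 𝓘(ℝ, E))
      (g := (extChartAt 𝓘(ℝ, E) g).symm) (f := Prod.snd) hs contDiff_snd.contMDiff.contMDiffAt
  have h12 := hf.contMDiffAt.comp (e, e) (h1.prodMk h2)
  refine ContMDiffAt.comp (x := (e, e)) (I' := 𝓘(ℝ, E)) (g := extChartAt 𝓘(ℝ, E) (1 : G)) ?_ h12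
  have : f ((extChartAt 𝓘(ℝ, E) g).symm e) ((extChartAt 𝓘(ℝ, E) g).symm e) = 1 := by
    rw [he, extChartAt_to_inv, hfg]
  simp only [this]
  exact contMDiffAt_extChartAt

theorem md_eq_fderiv_chart {f : G → G} {g h : G} (hfg : f g = h)
    (hf : MDifferentiableAt 𝓘(ℝ, E) 𝓘(ℝ, E) f g) :
    md 𝓘(ℝ, E) 𝓘(ℝ, E) f g =
      fderiv ℝ (fun y => extChartAt 𝓘(ℝ, E) h (f ((extChartAt 𝓘(ℝ, E) g).symm y)))
        (extChartAt 𝓘(ℝ, E) g g) := by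
  subst hfg
  have : IsManifold 𝓘(ℝ, E) 1 G := IsManifold.of_le (n := ∞) (by simp)
  have hd : MDifferentiableAt 𝓘(ℝ, E) 𝓘(ℝ, E) (extChartAt 𝓘(ℝ, E) (f g)) (f g) :=
    mdifferentiableAt_extChartAt (mem_chart_source E (f g))
  have h1 := hasMFDerivAt_comp_of_eq (hasMFDerivAt_md hd) (hasMFDerivAt_md hf) rfl
  rw [md_extChartAt_self] at h1
  exact (hasFDerivAt_comp_extChartAt_symm h1).fderiv.symm

/-- `L(x) B` is the left-invariant vector field of `B` in the preferred chart at `1`. -/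
def chartLeft (x : E) : E →L[ℝ] E :=
  fderiv ℝ (fun y => chartFun G 1 (fun a b => a * b) (x, y)) (chartOne E G)

theorem contDiffAt_chartMul :
    ContDiffAt ℝ ∞ (chartFun (E := E) G 1 fun a b => a * b) (chartOne E G, chartOne E G) :=
  contDiffAt_chartFun 1 (mul_one 1) (contMDiff_mul 𝓘(ℝ, E) ∞)

theorem contDiffAt_chartLeft : ContDiffAt ℝ ∞ (chartLeft (E := E) (G := G)) (chartOne E G) :=
  ContDiffAt.fderiv (n := ∞) (f := fun x y => chartFun G 1 (fun a b => a * b) (x, y))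
    (g := fun _ => chartOne E G) contDiffAt_chartMul contDiffAt_const (by simp)

variable (G) in
/-- The left-invariant vector field of `B` in the preferred chart at `g`. -/
def leftField (g : G) (B : E) (x : E) : E :=
  md 𝓘(ℝ, E) 𝓘(ℝ, E) (extChartAt 𝓘(ℝ, E) g) ((extChartAt 𝓘(ℝ, E) g).symm x)
    (leftTrans ((extChartAt 𝓘(ℝ, E) g).symm x) B)

/-- The manifold bracket is defined through pull-backs under charts. The derivative of the chart
inverts that of its inverse, so the pull-back is the explicit field `leftField`. -/
theorem mpullbackWithin_mulInvariantVectorField (g : G) (B : E) {x : E}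
    (hx : x ∈ (extChartAt 𝓘(ℝ, E) g).target) :
    (VectorField.mpullbackWithin 𝓘(ℝ, E) 𝓘(ℝ, E) (extChartAt 𝓘(ℝ, E) g).symm
      (mulInvariantVectorField (I := 𝓘(ℝ, E)) B) univ x : E) = leftField G g B x := by
  have h3 : (md 𝓘(ℝ, E) 𝓘(ℝ, E) (extChartAt 𝓘(ℝ, E) g).symm x).inverse =
      md 𝓘(ℝ, E) 𝓘(ℝ, E) (extChartAt 𝓘(ℝ, E) g) ((extChartAt 𝓘(ℝ, E) g).symm x) :=
    ContinuousLinearMap.inverse_eq (md_extChartAt_symm_comp g hx) (md_extChartAt_comp_symm g hx)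
  rw [VectorField.mpullbackWithin_apply, mfderivWithin_univ]
  exact congrArg (fun T : E →L[ℝ] E => T (leftTrans ((extChartAt 𝓘(ℝ, E) g).symm x) B)) h3

theorem leftField_self (g : G) (B : E) :
    leftField G g B (extChartAt 𝓘(ℝ, E) g g) = leftTrans g B := by
  have : IsManifold 𝓘(ℝ, E) 1 G := IsManifold.of_le (n := ∞) (by simp)
  rw [leftField, extChartAt_to_inv, md_extChartAt_self]
  rfl

/-- In the chart at `1` the invariant fields are partial derivatives of the multiplication, so
brackets become second derivatives of one smooth function. -/
theorem leftField_one (B : E) {x : E} (hx : x ∈ (extChartAt 𝓘(ℝ, E) (1 : G)).target) :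
    leftField G 1 B x = chartLeft (G := G) x B := by
  set h := (extChartAt 𝓘(ℝ, E) (1 : G)).symm x with hh
  have hs : h ∈ (chartAt E (1 : G)).source := by
    rw [← extChartAt_source 𝓘(ℝ, E)]
    exact (extChartAt 𝓘(ℝ, E) (1 : G)).map_target hx
  have : IsManifold 𝓘(ℝ, E) 1 G := IsManifold.of_le (n := ∞) (by simp)
  have hd : MDifferentiableAt 𝓘(ℝ, E) 𝓘(ℝ, E) (extChartAt 𝓘(ℝ, E) (1 : G)) h :=
    mdifferentiableAt_extChartAt hs
  have hc := hasMFDerivAt_comp_of_eq (hasMFDerivAt_md hd)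
    (hasMFDerivAt_md (mdifferentiableAt_mul_left (E := E) h 1)) (mul_one h)
  have h2 := (hasFDerivAt_comp_extChartAt_symm hc).fderiv
  exact congrArg (fun T : E →L[ℝ] E => T B) h2.symm

theorem chartLeft_chartOne (B : E) : chartLeft (G := G) (chartOne E G) B = B :=
  (leftField_one B (mem_extChartAt_target 1)).symm.trans
    ((leftField_self 1 B).trans (leftTrans_one B))

variable [FiniteDimensional ℝ E]

theorem eventuallyEq_leftField (g : G) (B : E) :
    (VectorField.mpullbackWithin 𝓘(ℝ, E) 𝓘(ℝ, E) (extChartAt 𝓘(ℝ, E) g).symm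
      (mulInvariantVectorField (I := 𝓘(ℝ, E)) B) univ : E → E)
      =ᶠ[𝓝 (extChartAt 𝓘(ℝ, E) g g)] leftField G g B :=
  Filter.eventually_of_mem ((isOpen_extChartAt_target g).mem_nhds (mem_extChartAt_target g))
    fun _ hx => mpullbackWithin_mulInvariantVectorField g B hx

theorem differentiableAt_leftField (g : G) (B : E) :
    DifferentiableAt ℝ (leftField G g B) (extChartAt 𝓘(ℝ, E) g g) := by
  have := FiniteDimensional.complete ℝ E
  have := lieGroup_min (E := E) (G := G)
  have : IsManifold 𝓘(ℝ, E) 2 G :=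
    IsManifold.of_le (n := ∞) (WithTop.coe_le_coe.mpr (le_top : (2 : ℕ∞) ≤ ⊤))
  have h := (mdifferentiableAt_mulInvariantVectorField (I := 𝓘(ℝ, E)) (G := G) B (g := g)
    ).mdifferentiableWithinAt (s := univ)
  have h' := h.differentiableWithinAt_mpullbackWithin_vectorField
  rw [ModelWithCorners.range_eq_univ, preimage_univ, inter_univ] at h'
  have h'' : DifferentiableAt ℝ (VectorField.mpullbackWithin 𝓘(ℝ, E) 𝓘(ℝ, E)
    (extChartAt 𝓘(ℝ, E) g).symm (mulInvariantVectorField (I := 𝓘(ℝ, E)) B) univ : E → E)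
    (extChartAt 𝓘(ℝ, E) g g) := differentiableWithinAt_univ.mp h'
  exact h''.congr_of_eventuallyEq (eventuallyEq_leftField g B).symm

/-- The bracket is computed by the left-invariant vector fields in any preferred chart. -/
theorem leftTrans_bracket (g : G) (A B : E) :
    leftTrans g (bracket G A B) =
      VectorField.lieBracket ℝ (leftField G g A) (leftField G g B) (extChartAt 𝓘(ℝ, E) g g) := by
  have := FiniteDimensional.complete ℝ E
  have := lieGroup_min (E := E) (G := G)
  have : IsManifold 𝓘(ℝ, E) 1 G := IsManifold.of_le (n := ∞) (by simp)
  have h := congrFun (mulInvariantVector_mlieBracket (I := 𝓘(ℝ, E)) (G := G) A B) g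
  refine h.trans ?_
  rw [VectorField.mlieBracket, VectorField.mlieBracketWithin_apply, mfderiv_extChartAt_self]
  have hid : (ContinuousLinearMap.id ℝ E).inverse = ContinuousLinearMap.id ℝ E :=
    ContinuousLinearMap.inverse_id
  refine (congrArg (fun T : E →L[ℝ] E => T _) hid).trans ?_
  simp only [ModelWithCorners.range_eq_univ, preimage_univ, inter_univ]
  rw [← (eventuallyEq_leftField g A).lieBracket_vectorField_eq (eventuallyEq_leftField g B)]
  exact congrFun (VectorField.lieBracketWithin_univ (𝕜 := ℝ) (E := E)) _

/-- This is `[X, Y] = DY·X - DX·Y` at the identity, where the fields take the values `A` and `B`. -/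
theorem bracket_eq_fderiv_chartLeft (A B : E) :
    bracket G A B = fderiv ℝ (chartLeft (G := G)) (chartOne E G) A B -
      fderiv ℝ (chartLeft (G := G)) (chartOne E G) B A := by
  have h := leftTrans_bracket (1 : G) A B
  rw [leftTrans_one] at h
  have hev : ∀ C : E, leftField G 1 C =ᶠ[𝓝 (chartOne E G)] fun x => chartLeft (G := G) x C :=
    fun C => Filter.eventually_of_mem ((isOpen_extChartAt_target (1 : G)).mem_nhds
      (mem_extChartAt_target 1)) fun x hx => leftField_one C hx
  have hd : DifferentiableAt ℝ (chartLeft (E := E) (G := G)) (chartOne E G) :=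
    contDiffAt_chartLeft.differentiableAt (by simp)
  have hf : ∀ C D : E, fderiv ℝ (leftField G 1 C) (chartOne E G) D =
      fderiv ℝ (chartLeft (G := G)) (chartOne E G) D C := by
    intro C D
    rw [(hev C).fderiv_eq]
    have := hd.hasFDerivAt.clm_apply (hasFDerivAt_const C (chartOne E G))
    rw [this.fderiv]
    simp
  have hv : ∀ C : E, leftField G 1 C (chartOne E G) = C := fun C =>
    (leftField_self 1 C).trans (leftTrans_one C)
  rw [h, VectorField.lieBracket]
  change fderiv ℝ (leftField G 1 B) (chartOne E G) (leftField G 1 A (chartOne E G)) -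
    fderiv ℝ (leftField G 1 A) (chartOne E G) (leftField G 1 B (chartOne E G)) = _
  rw [hv, hv, hf, hf]

end LieGroup

/-! ### The adjoint representation -/

section PartialDerivatives

variable {E W : Type*} [NormedAddCommGroup E] [NormedSpace ℝ E] [NormedAddCommGroup W]
  [NormedSpace ℝ W] {m : E × E → W} {e : E}

theorem hasFDerivAt_partial_snd (hm : ContDiffAt ℝ ∞ m (e, e)) :
    HasFDerivAt (fun x => fderiv ℝ (fun y => m (x, y)) e)
      (((ContinuousLinearMap.compL ℝ E (E × E) W).flip (ContinuousLinearMap.inr ℝ E E)).comp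
        ((fderiv ℝ (fderiv ℝ m) (e, e)).comp (ContinuousLinearMap.inl ℝ E E))) e := by
  have h1 : HasFDerivAt (fderiv ℝ m) (fderiv ℝ (fderiv ℝ m) (e, e)) (e, e) :=
    ((hm.fderiv_right (m := ∞) (by simp)).differentiableAt (by simp)).hasFDerivAt
  have h2 : HasFDerivAt (fun x => fderiv ℝ m (x, e))
      ((fderiv ℝ (fderiv ℝ m) (e, e)).comp (ContinuousLinearMap.inl ℝ E E)) e :=
    h1.comp (f := fun x : E => (x, e)) e (hasFDerivAt_prodMk_left e e)
  have h3 := (((ContinuousLinearMap.compL ℝ E (E × E) W).flip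
    (ContinuousLinearMap.inr ℝ E E)).hasFDerivAt (x := fderiv ℝ m (e, e))).comp e h2
  refine h3.congr_of_eventuallyEq ?_
  have hd : ∀ᶠ p in 𝓝 (e, e), DifferentiableAt ℝ m p :=
    ((hm.of_le (m := 1) (by simp)).eventually (by simp)).mono fun p hp =>
      hp.differentiableAt (by simp)
  have hc : Filter.Tendsto (fun x : E => (x, e)) (𝓝 e) (𝓝 (e, e)) :=
    (Continuous.prodMk_left e).tendsto e
  filter_upwards [hc.eventually hd] with x hx
  exact (hx.hasFDerivAt.comp (f := fun y : E => (x, y)) e (hasFDerivAt_prodMk_right x e)).fderiv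

theorem hasFDerivAt_partial_fst (hm : ContDiffAt ℝ ∞ m (e, e)) :
    HasFDerivAt (fun x => fderiv ℝ (fun y => m (y, x)) e)
      (((ContinuousLinearMap.compL ℝ E (E × E) W).flip (ContinuousLinearMap.inl ℝ E E)).comp
        ((fderiv ℝ (fderiv ℝ m) (e, e)).comp (ContinuousLinearMap.inr ℝ E E))) e := by
  have h1 : HasFDerivAt (fderiv ℝ m) (fderiv ℝ (fderiv ℝ m) (e, e)) (e, e) :=
    ((hm.fderiv_right (m := ∞) (by simp)).differentiableAt (by simp)).hasFDerivAt
  have h2 : HasFDerivAt (fun x => fderiv ℝ m (e, x))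
      ((fderiv ℝ (fderiv ℝ m) (e, e)).comp (ContinuousLinearMap.inr ℝ E E)) e :=
    h1.comp (f := fun x : E => (e, x)) e (hasFDerivAt_prodMk_right e e)
  have h3 := (((ContinuousLinearMap.compL ℝ E (E × E) W).flip
    (ContinuousLinearMap.inl ℝ E E)).hasFDerivAt (x := fderiv ℝ m (e, e))).comp e h2
  refine h3.congr_of_eventuallyEq ?_
  have hd : ∀ᶠ p in 𝓝 (e, e), DifferentiableAt ℝ m p :=
    ((hm.of_le (m := 1) (by simp)).eventually (by simp)).mono fun p hp =>
      hp.differentiableAt (by simp)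
  have hc : Filter.Tendsto (fun x : E => (e, x)) (𝓝 e) (𝓝 (e, e)) :=
    (Continuous.prodMk_right e).tendsto e
  filter_upwards [hc.eventually hd] with x hx
  exact (hx.hasFDerivAt.comp (f := fun y : E => (y, x)) e (hasFDerivAt_prodMk_left e x)).fderiv

/-- Symmetry of the second derivative of `m`, evaluated on `(0, a)` and `(b, 0)`. For the
multiplication it exchanges left and right translations in the computation of `ad`. -/
theorem fderiv_partial_symm (hm : ContDiffAt ℝ ∞ m (e, e)) (a b : E) :
    fderiv ℝ (fun x => fderiv ℝ (fun y => m (y, x)) e) e a b =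
      fderiv ℝ (fun x => fderiv ℝ (fun y => m (x, y)) e) e b a := by
  rw [(hasFDerivAt_partial_fst hm).fderiv, (hasFDerivAt_partial_snd hm).fderiv]
  have h : IsSymmSndFDerivAt ℝ m (e, e) := hm.isSymmSndFDerivAt (by
    rw [minSmoothness_of_isRCLikeNormedField]
    exact WithTop.coe_le_coe.mpr (le_top : (2 : ℕ∞) ≤ ⊤))
  simpa using h.eq (0, a) (b, 0)

end PartialDerivatives

section LieGroup

variable {E : Type*} [NormedAddCommGroup E] [NormedSpace ℝ E]
variable {G : Type*} [TopologicalSpace G] [ChartedSpace E G] [Group G]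
variable [LieGroup 𝓘(ℝ, E) ∞ G]

/-- The adjoint representation in the preferred chart at `1`. -/
def chartAd (x : E) : E →L[ℝ] E :=
  fderiv ℝ (fun y => chartFun G 1 (fun a b => a * b * a⁻¹) (x, y)) (chartOne E G)

theorem Ad_eq_chartAd (x : E) :
    Ad ((extChartAt 𝓘(ℝ, E) (1 : G)).symm x) = chartAd (G := G) x :=
  md_eq_fderiv_chart (by simp) (mdifferentiableAt_conj _ 1)

theorem contDiffAt_chartAd : ContDiffAt ℝ ∞ (chartAd (E := E) (G := G)) (chartOne E G) := by
  have h : ContDiffAt ℝ ∞ (chartFun (E := E) G 1 fun a b => a * b * a⁻¹)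
      (chartOne E G, chartOne E G) :=
    contDiffAt_chartFun 1 (by simp) ((contMDiff_fst.mul contMDiff_snd).mul contMDiff_fst.inv)
  exact ContDiffAt.fderiv (n := ∞)
    (f := fun x y => chartFun G 1 (fun a b => a * b * a⁻¹) (x, y))
    (g := fun _ => chartOne E G) h contDiffAt_const (by simp)

/-- Near `1` smoothness is visible in the chart; `Ad(x) = Ad(g) Ad(g⁻¹x)` carries it to any `g`. -/
theorem contMDiff_Ad : ContMDiff 𝓘(ℝ, E) 𝓘(ℝ, E →L[ℝ] E) ∞ (Ad : G → E →L[ℝ] E) := by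
  have h1 : ContMDiffAt 𝓘(ℝ, E) 𝓘(ℝ, E →L[ℝ] E) ∞ (Ad : G → E →L[ℝ] E) 1 := by
    have h := ContMDiffAt.comp (I' := 𝓘(ℝ, E)) (1 : G) (f := extChartAt 𝓘(ℝ, E) (1 : G))
      (contDiffAt_chartAd (E := E) (G := G)).contMDiffAt contMDiffAt_extChartAt
    refine h.congr_of_eventuallyEq ?_
    filter_upwards [extChartAt_source_mem_nhds (I := 𝓘(ℝ, E)) (1 : G)] with g hg
    rw [Function.comp_apply, ← Ad_eq_chartAd, (extChartAt 𝓘(ℝ, E) (1 : G)).left_inv hg]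
  intro g
  have h2 : ContMDiffAt 𝓘(ℝ, E) 𝓘(ℝ, E →L[ℝ] E) ∞ (fun x : G => Ad (E := E) (g⁻¹ * x)) g :=
    ContMDiffAt.comp (I' := 𝓘(ℝ, E)) g (g := (Ad : G → E →L[ℝ] E)) (f := fun x => g⁻¹ * x)
      (by simpa using h1) contMDiff_mul_left.contMDiffAt
  have h3 : (Ad : G → E →L[ℝ] E) = fun x => (Ad g).comp (Ad (g⁻¹ * x)) := by
    ext1 x
    rw [← Ad_mul, mul_inv_cancel_left]
  rw [h3]
  exact contMDiffAt_const.clm_comp h2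

/-- From `h z = (h z h⁻¹) h`: left translation is conjugation followed by right translation. -/
theorem chartLeft_eq {x : E} (hx : x ∈ (extChartAt 𝓘(ℝ, E) (1 : G)).target) :
    chartLeft (G := G) x =
      (fderiv ℝ (fun y => chartFun G 1 (fun a b => a * b) (y, x)) (chartOne E G)).comp
        (chartAd (G := G) x) := by
  set h := (extChartAt 𝓘(ℝ, E) (1 : G)).symm x with hh
  have hs : h ∈ (chartAt E (1 : G)).source := by
    rw [← extChartAt_source 𝓘(ℝ, E)]
    exact (extChartAt 𝓘(ℝ, E) (1 : G)).map_target hx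
  have : IsManifold 𝓘(ℝ, E) 1 G := IsManifold.of_le (n := ∞) (by simp)
  have hd : MDifferentiableAt 𝓘(ℝ, E) 𝓘(ℝ, E) (extChartAt 𝓘(ℝ, E) (1 : G)) h :=
    mdifferentiableAt_extChartAt hs
  have hl := hasMFDerivAt_comp_of_eq (hasMFDerivAt_md hd)
    (hasMFDerivAt_md (mdifferentiableAt_mul_left (E := E) h 1)) (mul_one h)
  have hr := hasMFDerivAt_comp_of_eq (hasMFDerivAt_md hd)
    (hasMFDerivAt_md (mdifferentiableAt_mul_right (E := E) h 1)) (one_mul h)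
  have h2 := hasMFDerivAt_comp_of_eq hr (hasMFDerivAt_md (mdifferentiableAt_conj (E := E) h 1))
    (show h * 1 * h⁻¹ = 1 by simp)
  have h0 : (fun z : G => extChartAt 𝓘(ℝ, E) (1 : G) (h * z * h⁻¹ * h)) =
      fun z => extChartAt 𝓘(ℝ, E) (1 : G) (h * z) := by
    ext1 z
    rw [inv_mul_cancel_right]
  rw [h0] at h2
  have h3 := (md_eq_of_hasMFDerivAt hl).symm.trans (md_eq_of_hasMFDerivAt h2)
  have h4 := (hasFDerivAt_comp_extChartAt_symm hl).fderiv
  have h5 := (hasFDerivAt_comp_extChartAt_symm hr).fderiv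
  rw [← h5] at h3
  rw [← Ad_eq_chartAd]
  exact h4.trans h3

variable [FiniteDimensional ℝ E]

variable (E G) in
/-- The adjoint representation of the Lie algebra, as a continuous bilinear map. -/
def adL : E →L[ℝ] E →L[ℝ] E := fderiv ℝ (chartAd (G := G)) (chartOne E G)

theorem chartAd_chartOne : chartAd (G := G) (chartOne E G) = ContinuousLinearMap.id ℝ E := by
  rw [← Ad_eq_chartAd, chartOne, extChartAt_to_inv, Ad_one]

/-- Write `chartLeft` as `L = R ∘ Ad`, with all three factors equal to the identity at `1`. The
product rule gives `DL(A)B = DR(A)B + ad(A)B`, and symmetry of second derivatives gives `DR(A)B =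
DL(B)A`. Hence `ad(A)B = DL(A)B - DL(B)A`, which is the bracket. -/
theorem adL_apply (A B : E) : adL E G A B = bracket G A B := by
  have hm := contDiffAt_chartMul (E := E) (G := G)
  have hR := hasFDerivAt_partial_fst hm
  have hA : HasFDerivAt (chartAd (G := G)) (adL E G) (chartOne E G) :=
    (contDiffAt_chartAd.differentiableAt (by simp)).hasFDerivAt
  have hL : HasFDerivAt (chartLeft (G := G)) (fderiv ℝ (chartLeft (G := G)) (chartOne E G))
    (chartOne E G) := (contDiffAt_chartLeft.differentiableAt (by simp)).hasFDerivAt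
  have hRA := hR.clm_comp hA
  have hev : chartLeft (G := G) =ᶠ[𝓝 (chartOne E G)] fun x =>
      (fderiv ℝ (fun y => chartFun G 1 (fun a b => a * b) (y, x)) (chartOne E G)).comp
        (chartAd (G := G) x) :=
    Filter.eventually_of_mem ((isOpen_extChartAt_target (1 : G)).mem_nhds
      (mem_extChartAt_target 1)) fun x hx => chartLeft_eq hx
  have hone : fderiv ℝ (fun y => chartFun G 1 (fun a b => a * b) (y, chartOne E G))
      (chartOne E G) = ContinuousLinearMap.id ℝ E := by
    have h := hev.self_of_nhds
    simp only [chartAd_chartOne, ContinuousLinearMap.comp_id] at h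
    rw [← h]
    ext B
    exact chartLeft_chartOne B
  have key := hL.unique (hRA.congr_of_eventuallyEq hev)
  have h1 := congrArg (fun T : E →L[ℝ] E →L[ℝ] E => T A B) key
  have hsym := fderiv_partial_symm hm A B
  rw [hR.fderiv] at hsym
  simp only [hone, chartAd_chartOne, add_apply,
    ContinuousLinearMap.comp_apply, ContinuousLinearMap.compL_apply,
    ContinuousLinearMap.flip_apply, ContinuousLinearMap.id_apply] at h1 hsym
  rw [bracket_eq_fderiv_chartLeft, h1]
  rw [hsym]
  exact (add_sub_cancel_right _ _).symm

theorem hasMFDerivAt_Ad_one :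
    HasMFDerivAt 𝓘(ℝ, E) 𝓘(ℝ, E →L[ℝ] E) (Ad : G → E →L[ℝ] E) 1 (adL E G) := by
  refine hasMFDerivAt_of_comp_extChartAt_symm contMDiff_Ad.continuous.continuousAt ?_
  simp only [Ad_eq_chartAd]
  exact (contDiffAt_chartAd.differentiableAt (by simp)).hasFDerivAt

/-- The coadjoint representation `ad*` of the Lie algebra at `η`: `⟨ad*(A) η; B⟩ = -⟨η; [A, B]⟩`. -/
def adStar (G : Type*) [TopologicalSpace G] [ChartedSpace E G] [Group G] [LieGroup 𝓘(ℝ, E) ∞ G]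
    (η : E →L[ℝ] ℝ) : E →L[ℝ] (E →L[ℝ] ℝ) :=
  -((ContinuousLinearMap.compL ℝ E E ℝ η).comp (adL E G))

theorem adStar_apply (η : E →L[ℝ] ℝ) (A B : E) : adStar G η A B = -η (bracket G A B) := by
  simp [adStar, adL_apply]

/-- Differentiating `Ad(g) Ad(g⁻¹) = id` at `1` shows that `g ↦ Ad(g⁻¹)` has derivative `-ad`. -/
theorem hasMFDerivAt_coAd_one (η : E →L[ℝ] ℝ) :
    HasMFDerivAt 𝓘(ℝ, E) 𝓘(ℝ, E →L[ℝ] ℝ) (fun g : G => coAd g η) 1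
      (adStar G η : E →L[ℝ] (E →L[ℝ] ℝ)) := by
  have hs : ContMDiff 𝓘(ℝ, E) 𝓘(ℝ, E →L[ℝ] E) ∞ fun g : G => Ad (E := E) g⁻¹ :=
    contMDiff_Ad.comp contMDiff_id.inv
  have h1 := hasFDerivAt_comp_extChartAt_symm
    (hasMFDerivAt_md ((hs 1).mdifferentiableAt (by simp)))
  have h2 := hasFDerivAt_comp_extChartAt_symm (hasMFDerivAt_Ad_one (E := E) (G := G))
  set T := md 𝓘(ℝ, E) 𝓘(ℝ, E →L[ℝ] E) (fun g : G => Ad (E := E) g⁻¹) 1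
  have h3 := h2.clm_comp h1
  simp only [← Ad_mul, mul_inv_cancel, extChartAt_to_inv, inv_one, Ad_one] at h3
  have h4 := h3.unique (hasFDerivAt_const _ _)
  have h5 : T = -adL E G := by
    ext A B
    have := congrArg (fun S : E →L[ℝ] E →L[ℝ] E => S A B) h4
    simpa [add_eq_zero_iff_eq_neg] using this
  refine hasMFDerivAt_of_comp_extChartAt_symm
    (contMDiff_const.clm_comp hs).continuous.continuousAt ?_
  have h6 := (ContinuousLinearMap.compL ℝ E E ℝ η).hasFDerivAt.comp
    (extChartAt 𝓘(ℝ, E) (1 : G) 1) h1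
  rw [h5, ContinuousLinearMap.comp_neg] at h6
  exact h6

theorem contMDiff_coAd {V H M : Type*} [NormedAddCommGroup V] [NormedSpace ℝ V]
    [TopologicalSpace H] {I : ModelWithCorners ℝ V H} [TopologicalSpace M] [ChartedSpace H M]
    {f : M → G} {η : M → E →L[ℝ] ℝ} (hf : ContMDiff I 𝓘(ℝ, E) ∞ f)
    (hη : ContMDiff I 𝓘(ℝ, E →L[ℝ] ℝ) ∞ η) :
    ContMDiff I 𝓘(ℝ, E →L[ℝ] ℝ) ∞ fun x => coAd (f x) (η x) :=
  hη.clm_comp ((contMDiff_Ad (E := E) (G := G)).comp hf.inv)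

variable (G) in
/-- `Ad*(g)` as a continuous linear map. -/
def coAdL (g : G) : (E →L[ℝ] ℝ) →L[ℝ] (E →L[ℝ] ℝ) :=
  (ContinuousLinearMap.compL ℝ E E ℝ).flip (Ad g⁻¹)

theorem coAdL_apply (g : G) (η : E →L[ℝ] ℝ) : coAdL G g η = coAd g η := rfl

/-- By `Ad*(x)η = Ad*(g) Ad*(g⁻¹x)η` the derivative at `g` is a translate of the one at `1`. -/
theorem hasMFDerivAt_coAd (g : G) (η : E →L[ℝ] ℝ) :
    HasMFDerivAt 𝓘(ℝ, E) 𝓘(ℝ, E →L[ℝ] ℝ) (fun x : G => coAd x η) g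
      ((coAdL G g).comp ((adStar G η).comp (maurerCartan g)) : E →L[ℝ] (E →L[ℝ] ℝ)) := by
  have h1 := hasMFDerivAt_comp_of_eq (hasMFDerivAt_coAd_one (G := G) η)
    (hasMFDerivAt_md (mdifferentiableAt_mul_left (E := E) g⁻¹ g)) (inv_mul_cancel g)
  have h2 := hasMFDerivAt_comp_of_eq
    (hasMFDerivAt_iff.mpr ((coAdL G g).hasFDerivAt (x := coAd (g⁻¹ * g) η))) h1 rfl
  have h3 : (fun x : G => coAdL G g (coAd (g⁻¹ * x) η)) = fun x => coAd x η := by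
    ext1 x
    rw [coAdL_apply, ← coAd_mul, mul_inv_cancel_left]
  rw [h3] at h2
  exact h2

end LieGroup

/-! ### The Maurer-Cartan equation and the canonical 2-form -/

section MaurerCartan

variable {E : Type*} [NormedAddCommGroup E] [NormedSpace ℝ E]
variable {G : Type*} [TopologicalSpace G] [ChartedSpace E G] [Group G]
variable [LieGroup 𝓘(ℝ, E) ∞ G]

/-- The Maurer-Cartan form in the preferred chart at `g`. -/
def chartMC (g : G) (x : E) : E →L[ℝ] E :=
  fderiv ℝ (fun y => chartFun G g (fun a b => a⁻¹ * b) (x, y)) x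

/-- The form is a partial derivative of the single smooth function `(a, b) ↦ a⁻¹b`, evaluated on the
diagonal; its smoothness follows from that. -/
theorem contDiffAt_chartMC (g : G) :
    ContDiffAt ℝ ∞ (chartMC (E := E) g) (extChartAt 𝓘(ℝ, E) g g) := by
  have h : ContDiffAt ℝ ∞ (chartFun (E := E) G g fun a b => a⁻¹ * b)
      (extChartAt 𝓘(ℝ, E) g g, extChartAt 𝓘(ℝ, E) g g) :=
    contDiffAt_chartFun g (by simp) (contMDiff_fst.inv.mul contMDiff_snd)
  exact ContDiffAt.fderiv (n := ∞)
    (f := fun x y => chartFun G g (fun a b => a⁻¹ * b) (x, y))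
    (g := fun x => x) h contDiffAt_id (by simp)

theorem chartMC_eq (g : G) {x : E} (hx : x ∈ (extChartAt 𝓘(ℝ, E) g).target) :
    chartMC g x = (maurerCartan ((extChartAt 𝓘(ℝ, E) g).symm x)).comp
      (md 𝓘(ℝ, E) 𝓘(ℝ, E) (extChartAt 𝓘(ℝ, E) g).symm x) := by
  set h := (extChartAt 𝓘(ℝ, E) g).symm x with hh
  have : IsManifold 𝓘(ℝ, E) 1 G := IsManifold.of_le (n := ∞) (by simp)
  have h1 := hasMFDerivAt_md ((contMDiffAt_extChartAt_symm g hx).mdifferentiableAt (by simp))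
  have h2 := hasMFDerivAt_comp_of_eq
    (hasMFDerivAt_md (mdifferentiableAt_mul_left (E := E) h⁻¹ h)) h1 rfl
  have hd : MDifferentiableAt 𝓘(ℝ, E) 𝓘(ℝ, E) (extChartAt 𝓘(ℝ, E) (1 : G)) 1 :=
    mdifferentiableAt_extChartAt (mem_chart_source E 1)
  have h3 := hasMFDerivAt_iff.mp (hasMFDerivAt_comp_of_eq (hasMFDerivAt_md hd) h2
    (inv_mul_cancel h))
  rw [md_extChartAt_self] at h3
  exact h3.fderiv

theorem chartMC_self (g : G) : chartMC g (extChartAt 𝓘(ℝ, E) g g) = maurerCartan g := by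
  have : IsManifold 𝓘(ℝ, E) 1 G := IsManifold.of_le (n := ∞) (by simp)
  have h := md_extChartAt_symm_comp (I := 𝓘(ℝ, E)) g (mem_extChartAt_target g)
  rw [extChartAt_to_inv, md_extChartAt_self, ContinuousLinearMap.comp_id] at h
  rw [chartMC_eq g (mem_extChartAt_target g), extChartAt_to_inv, h, ContinuousLinearMap.comp_id]

theorem chartMC_leftField (g : G) (A : E) {x : E} (hx : x ∈ (extChartAt 𝓘(ℝ, E) g).target) :
    chartMC g x (leftField G g A x) = A := by
  have h := congrArg (fun T : E →L[ℝ] E => T (leftTrans ((extChartAt 𝓘(ℝ, E) g).symm x) A))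
    (md_extChartAt_symm_comp (I := 𝓘(ℝ, E)) g hx)
  simp only [ContinuousLinearMap.comp_apply, ContinuousLinearMap.id_apply] at h
  rw [chartMC_eq g hx, ContinuousLinearMap.comp_apply, leftField, h, maurerCartan_leftTrans]

variable [FiniteDimensional ℝ E]

/-- `Θ` is constant on the invariant field `X_A`, so `DΘ(B)(X_A) = -Θ(DX_A(B))`. Antisymmetrizing
turns the right-hand side into the bracket of invariant fields. -/
theorem maurerCartan_equation (g : G) (u w : E) :
    fderiv ℝ (chartMC g) (extChartAt 𝓘(ℝ, E) g g) u w -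
      fderiv ℝ (chartMC g) (extChartAt 𝓘(ℝ, E) g g) w u =
    -bracket G (maurerCartan g u) (maurerCartan g w) := by
  set e := extChartAt 𝓘(ℝ, E) g g with he
  have hM : HasFDerivAt (chartMC g) (fderiv ℝ (chartMC g) e) e :=
    ((contDiffAt_chartMC g).differentiableAt (by simp)).hasFDerivAt
  have key : ∀ A B : E, fderiv ℝ (chartMC g) e B (leftTrans g A) =
      -maurerCartan g (fderiv ℝ (leftField G g A) e B) := by
    intro A B
    have h1 := hM.clm_apply (differentiableAt_leftField g A).hasFDerivAt
    have h2 : (fun x => chartMC g x (leftField G g A x)) =ᶠ[𝓝 e] fun _ => A :=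
      Filter.eventually_of_mem ((isOpen_extChartAt_target g).mem_nhds (mem_extChartAt_target g))
        fun x hx => chartMC_leftField g A hx
    have h3 := congrArg (fun T : E →L[ℝ] E => T B)
      ((h1.congr_of_eventuallyEq h2.symm).unique (hasFDerivAt_const A e))
    simp only [add_apply, ContinuousLinearMap.comp_apply, zero_apply,
      ContinuousLinearMap.flip_apply, leftField_self, chartMC_self, he] at h3
    rw [eq_neg_iff_add_eq_zero, add_comm]
    exact h3
  have h := leftTrans_bracket g (maurerCartan g u) (maurerCartan g w)
  rw [VectorField.lieBracket, leftField_self, leftField_self, leftTrans_maurerCartan,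
    leftTrans_maurerCartan, ← he] at h
  have h4 := congrArg (maurerCartan g) h
  rw [maurerCartan_leftTrans, map_sub] at h4
  have k1 := key (maurerCartan g w) u
  have k2 := key (maurerCartan g u) w
  rw [leftTrans_maurerCartan] at k1 k2
  rw [k1, k2, h4]
  abel

variable (D : ControlSystem E)

/-- In the product chart the Liouville form at `p` is `η ∘ Θ`, with `η` the linear coordinate of
`p`. The product rule differentiates `η`, giving the first two terms, and `Θ`, giving the bracket;
the 1/2 is the normalisation of `dα`. -/
theorem canonicalForm_eq (z : Ambient G D) (u w : AmbientVec D) :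
    canonicalForm D z u w = (u.2.2 (maurerCartan z.1 w.1) - w.2.2 (maurerCartan z.1 u.1) -
      z.2.2 (bracket G (maurerCartan z.1 u.1) (maurerCartan z.1 w.1))) / 2 := by
  set c : AmbientVec D → Ambient G D :=
    fun p => (extChartAt (ambientModel D) z).symm p with hc
  set β : AmbientVec D → (AmbientVec D →L[ℝ] ℝ) := fun e =>
    (liouville D (c e)).comp (md 𝓘(ℝ, AmbientVec D) (ambientModel D) c e) with hβ
  set e := extChartAt 𝓘(ℝ, E) z.1 z.1 with he
  have hcoord : extChartAt (ambientModel D) z z = (e, z.2) := by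
    rw [extChartAt_prod]
    rfl
  have hce : ∀ p : AmbientVec D, c p = ((extChartAt 𝓘(ℝ, E) z.1).symm p.1, p.2) := by
    intro p
    rw [hc, extChartAt_prod]
    rfl
  -- The Liouville form factors through `T_g G`, so only this component of the derivative of the
  -- inverse chart matters.
  have hfirst : ∀ p ∈ (extChartAt (ambientModel D) z).target, ∀ v : AmbientVec D,
      (md 𝓘(ℝ, AmbientVec D) (ambientModel D) c p v).1 =
        md 𝓘(ℝ, E) 𝓘(ℝ, E) (extChartAt 𝓘(ℝ, E) z.1).symm p.1 v.1 := by
    intro p hp v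
    have hp1 : p.1 ∈ (extChartAt 𝓘(ℝ, E) z.1).target := by
      rw [extChartAt_prod] at hp
      exact hp.1
    have h1 := hasMFDerivAt_md ((contMDiffAt_extChartAt_symm z hp).mdifferentiableAt (by simp))
    have h2 := hasMFDerivAt_comp_of_eq
      (hasMFDerivAt_fst (I := 𝓘(ℝ, E)) (I' := 𝓘(ℝ, D.a × (E →L[ℝ] ℝ))) (x := c p)) h1 rfl
    have h3 := hasMFDerivAt_comp_of_eq (hasMFDerivAt_md
      ((contMDiffAt_extChartAt_symm z.1 hp1).mdifferentiableAt (by simp)))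
      (hasMFDerivAt_iff.mpr (hasFDerivAt_fst (𝕜 := ℝ) (p := p))) rfl
    have h4 : (fun q => (c q).1) = fun q : AmbientVec D =>
        (extChartAt 𝓘(ℝ, E) z.1).symm q.1 := by
      ext1 q
      rw [hce]
    rw [← h4] at h3
    have h5 := (md_eq_of_hasMFDerivAt h2).symm.trans (md_eq_of_hasMFDerivAt h3)
    exact congrArg (fun T : AmbientVec D →L[ℝ] E => T v) h5
  have hev : β =ᶠ[𝓝 (e, z.2)] fun p =>
      (p.2.2.comp (chartMC z.1 p.1)).comp (ContinuousLinearMap.fst ℝ E (D.a × (E →L[ℝ] ℝ))) := by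
    refine Filter.eventually_of_mem (((isOpen_extChartAt_target z).mem_nhds
      (hcoord ▸ mem_extChartAt_target z))) fun p hp => ?_
    have hp1 : p.1 ∈ (extChartAt 𝓘(ℝ, E) z.1).target := by
      rw [extChartAt_prod] at hp
      exact hp.1
    refine ContinuousLinearMap.ext fun v => ?_
    change (c p).2.2 (maurerCartan (c p).1 (md 𝓘(ℝ, AmbientVec D) (ambientModel D) c p v).1) =
      p.2.2 (chartMC z.1 p.1 v.1)
    rw [hfirst p hp v, hce, chartMC_eq z.1 hp1]
    rfl
  have hM : HasFDerivAt (chartMC z.1) (fderiv ℝ (chartMC z.1) e) e :=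
    ((contDiffAt_chartMC z.1).differentiableAt (by simp)).hasFDerivAt
  have hd : ∀ a b, fderiv ℝ β (e, z.2) a b = 
      a.2.2 (maurerCartan z.1 b.1) + z.2.2 (fderiv ℝ (chartMC z.1) e a.1 b.1) := by
    intro a b
    rw [hev.fderiv_eq]
    have h1 : HasFDerivAt (fun p : AmbientVec D => chartMC z.1 p.1)
        ((fderiv ℝ (chartMC z.1) e).comp (ContinuousLinearMap.fst ℝ E _)) (e, z.2) :=
      hM.comp (f := Prod.fst) (e, z.2) hasFDerivAt_fst
    have h2 : HasFDerivAt (fun p : AmbientVec D => p.2.2)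
        ((ContinuousLinearMap.snd ℝ D.a (E →L[ℝ] ℝ)).comp (ContinuousLinearMap.snd ℝ E _))
        (e, z.2) :=
      ((ContinuousLinearMap.snd ℝ D.a (E →L[ℝ] ℝ)).comp
        (ContinuousLinearMap.snd ℝ E _)).hasFDerivAt
    rw [((h2.clm_comp h1).clm_comp (hasFDerivAt_const _ _)).fderiv]
    simp [← chartMC_self, he]
    ring
  change (fderiv ℝ β (extChartAt (ambientModel D) z z) u w -
    fderiv ℝ β (extChartAt (ambientModel D) z z) w u) / 2 = _
  rw [hcoord, hd, hd]
  have h := congrArg z.2.2 (maurerCartan_equation z.1 u.1 w.1)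
  rw [map_sub, map_neg, ← he] at h
  congr 1
  linarith

end MaurerCartan

/-! ### Top-degree forms with a common kernel vector -/

section Wedge

variable {V : Type*} [AddCommGroup V] [Module ℝ V]

/-- The multilinear map `v ↦ α(v₀) Ψ(v₁, v₂) ⋯ Ψ(v_{2m-1}, v_{2m})`. -/
def wedgeMultilinear (α : V →ₗ[ℝ] ℝ) (Ψ : V →ₗ[ℝ] V →ₗ[ℝ] ℝ) (m : ℕ) :
    MultilinearMap ℝ (fun _ : Fin (2 * m + 1) => V) ℝ := by
  classical
  refine MultilinearMap.mk' (fun v => α (v 0) * ∏ i : Fin m,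
    Ψ (v ⟨2 * i + 1, by omega⟩) (v ⟨2 * i + 2, by omega⟩)) ?_ ?_
  · intro v i x y
    obtain ⟨i, hi⟩ := i
    rcases Nat.eq_zero_or_pos i with rfl | hpos
    · have h0 : (⟨0, hi⟩ : Fin (2 * m + 1)) = 0 := rfl
      simp [h0, Function.update, Fin.ext_iff, add_mul]
    -- A slot other than `0` belongs to exactly one pair, the one with index `(i - 1) / 2`; only
    -- that factor of the product changes.
    obtain ⟨k, hk⟩ : ∃ k : Fin m, i = 2 * k + 1 ∨ i = 2 * k + 2 :=
      ⟨⟨(i - 1) / 2, by omega⟩, by simp only; omega⟩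
    rw [← Finset.mul_prod_erase _ _ (Finset.mem_univ k),
      ← Finset.mul_prod_erase _ _ (Finset.mem_univ k),
      ← Finset.mul_prod_erase _ _ (Finset.mem_univ k)]
    have hp : ∀ z : V, ∏ l ∈ Finset.univ.erase k,
        Ψ (Function.update v ⟨i, hi⟩ z ⟨2 * l + 1, by omega⟩)
          (Function.update v ⟨i, hi⟩ z ⟨2 * l + 2, by omega⟩) =
        ∏ l ∈ Finset.univ.erase k, Ψ (v ⟨2 * l + 1, by omega⟩) (v ⟨2 * l + 2, by omega⟩) := by
      intro z
      refine Finset.prod_congr rfl fun l hl => ?_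
      have hne : (l : ℕ) ≠ k := fun h => (Finset.ne_of_mem_erase hl) (Fin.ext h)
      rw [Function.update_of_ne, Function.update_of_ne] <;> simp only [ne_eq, Fin.mk.injEq] <;> omega
    have h0 : ∀ z : V, Function.update v ⟨i, hi⟩ z 0 = v 0 := fun z => by
      rw [Function.update_of_ne]
      simp only [ne_eq, Fin.ext_iff, Fin.val_zero]
      omega
    rw [hp, hp, hp, h0, h0, h0]
    rcases hk with rfl | rfl
    · simp [Function.update, Fin.ext_iff]
      ring
    · simp [Function.update, Fin.ext_iff]
      ring
  · intro v i c x
    obtain ⟨i, hi⟩ := i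
    rcases Nat.eq_zero_or_pos i with rfl | hpos
    · have h0 : (⟨0, hi⟩ : Fin (2 * m + 1)) = 0 := rfl
      simp [h0, Function.update, Fin.ext_iff, mul_assoc]
    obtain ⟨k, hk⟩ : ∃ k : Fin m, i = 2 * k + 1 ∨ i = 2 * k + 2 :=
      ⟨⟨(i - 1) / 2, by omega⟩, by simp only; omega⟩
    rw [← Finset.mul_prod_erase _ _ (Finset.mem_univ k),
      ← Finset.mul_prod_erase _ _ (Finset.mem_univ k)]
    have hp : ∀ z : V, ∏ l ∈ Finset.univ.erase k,
        Ψ (Function.update v ⟨i, hi⟩ z ⟨2 * l + 1, by omega⟩)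
          (Function.update v ⟨i, hi⟩ z ⟨2 * l + 2, by omega⟩) =
        ∏ l ∈ Finset.univ.erase k, Ψ (v ⟨2 * l + 1, by omega⟩) (v ⟨2 * l + 2, by omega⟩) := by
      intro z
      refine Finset.prod_congr rfl fun l hl => ?_
      have hne : (l : ℕ) ≠ k := fun h => (Finset.ne_of_mem_erase hl) (Fin.ext h)
      rw [Function.update_of_ne, Function.update_of_ne] <;> simp only [ne_eq, Fin.mk.injEq] <;> omega
    have h0 : ∀ z : V, Function.update v ⟨i, hi⟩ z 0 = v 0 := fun z => by
      rw [Function.update_of_ne]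
      simp only [ne_eq, Fin.ext_iff, Fin.val_zero]
      omega
    rw [hp, hp, h0, h0]
    rcases hk with rfl | rfl
    · simp [Function.update, Fin.ext_iff]
      ring
    · simp [Function.update, Fin.ext_iff]
      ring

theorem wedgeMultilinear_apply (α : V →ₗ[ℝ] ℝ) (Ψ : V →ₗ[ℝ] V →ₗ[ℝ] ℝ) (m : ℕ)
    (v : Fin (2 * m + 1) → V) : wedgeMultilinear α Ψ m v = α (v 0) * ∏ i : Fin m,
      Ψ (v ⟨2 * i + 1, by omega⟩) (v ⟨2 * i + 2, by omega⟩) := rfl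

theorem wedgePow_eq_alternatization (α : V →ₗ[ℝ] ℝ) (Ψ : V →ₗ[ℝ] V →ₗ[ℝ] ℝ) (m : ℕ)
    (v : Fin (2 * m + 1) → V) :
    wedgePow (fun u => α u) (fun u w => Ψ u w) m v =
      (wedgeMultilinear α Ψ m).alternatization v := by
  simp only [wedgePow, MultilinearMap.alternatization_apply, MultilinearMap.domDomCongr_apply,
    wedgeMultilinear_apply]
  refine Finset.sum_congr rfl fun σ _ => ?_
  rw [Units.smul_def, zsmul_eq_mul]

/-- Extend `n` to a basis. An alternating map is determined by its values on injective families of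
basis vectors. As the degree equals the dimension, such a family exhausts the basis, and then `n`
sits in some slot of every term of the sum and kills it. -/
theorem wedgePow_eq_zero_of_kernel [FiniteDimensional ℝ V] {α : V →ₗ[ℝ] ℝ}
    {Ψ : V →ₗ[ℝ] V →ₗ[ℝ] ℝ} {m : ℕ} (hdim : Module.finrank ℝ V = 2 * m + 1) {n : V} (hn : n ≠ 0)
    (hα : α n = 0) (hl : ∀ w, Ψ n w = 0) (hr : ∀ w, Ψ w n = 0) (v : Fin (2 * m + 1) → V) :
    wedgePow (fun u => α u) (fun u w => Ψ u w) m v = 0 := by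
  rw [wedgePow_eq_alternatization]
  have hli : LinearIndepOn ℝ id ({n} : Set V) := by
    simpa using LinearIndepOn.singleton (R := ℝ) (v := id) (i := n) hn
  set b := Module.Basis.extend hli with hb
  have hfin := Module.Finite.finite_basis b
  have hcard := (Module.finrank_eq_nat_card_basis b).symm.trans hdim
  suffices h : (wedgeMultilinear α Ψ m).alternatization = 0 by rw [h]; rfl
  refine b.ext_alternating fun w hw => ?_
  have hbij : Function.Bijective w :=
    (Nat.bijective_iff_injective_and_card w).mpr ⟨hw, by rw [hcard]; simp⟩
  obtain ⟨i, hi⟩ := hbij.2 ⟨n, hli.subset_extend (subset_univ _) rfl⟩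
  have hbn : b (w i) = n := by rw [hi, hb, Module.Basis.extend_apply_self]
  rw [MultilinearMap.alternatization_apply]
  refine Finset.sum_eq_zero fun σ _ => ?_
  rw [MultilinearMap.domDomCongr_apply, wedgeMultilinear_apply]
  obtain ⟨l, rfl⟩ := σ.surjective i
  have : α (b (w (σ 0))) * ∏ i : Fin m, Ψ (b (w (σ ⟨2 * i + 1, by omega⟩)))
      (b (w (σ ⟨2 * i + 2, by omega⟩))) = 0 := by
    obtain ⟨l, hl'⟩ := l
    rcases Nat.eq_zero_or_pos l with rfl | hpos
    · have : b (w (σ 0)) = n := hbn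
      rw [this, hα, zero_mul]
    obtain ⟨k, hk⟩ : ∃ k : Fin m, l = 2 * k + 1 ∨ l = 2 * k + 2 :=
      ⟨⟨(l - 1) / 2, by omega⟩, by simp only; omega⟩
    refine mul_eq_zero_of_right _ (Finset.prod_eq_zero (Finset.mem_univ k) ?_)
    rcases hk with rfl | rfl
    · rw [hbn, hl]
    · rw [hbn, hr]
  rw [this, smul_zero]

end Wedge

/-! ### The characteristic vector field -/

section Momentum

variable {E : Type*} [NormedAddCommGroup E] [NormedSpace ℝ E] [FiniteDimensional ℝ E]
variable {G : Type*} [TopologicalSpace G] [ChartedSpace E G] [Group G] [LieGroup 𝓘(ℝ, E) ∞ G]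
variable {D : ControlSystem E} {L : D.a → ℝ}
variable {E' : Type*} [NormedAddCommGroup E'] [NormedSpace ℝ E'] [FiniteDimensional ℝ E']
variable {F : Type*} [TopologicalSpace F] [ChartedSpace E' F] [IsManifold 𝓘(ℝ, E') ∞ F]
variable {j : F → D.a × (E →L[ℝ] ℝ)}

theorem contMDiff_of_isPhaseSpace (hY : IsPhaseSpace G D E' j L) :
    ContMDiff 𝓘(ℝ, E') 𝓘(ℝ, D.a × (E →L[ℝ] ℝ)) ∞ j := by
  have h : ContMDiff (yModel E E') (ambientModel D) ∞ (momentumMap G D j) := hY.2.1.1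
  exact contMDiff_snd.comp (h.comp ((contMDiff_const (c := (1 : G))).prodMk contMDiff_id))

theorem contMDiff_legendre (hj : ContMDiff 𝓘(ℝ, E') 𝓘(ℝ, D.a × (E →L[ℝ] ℝ)) ∞ j) :
    ContMDiff 𝓘(ℝ, E') 𝓘(ℝ, E →L[ℝ] ℝ) ∞ (legendre D j) :=
  (ContinuousLinearMap.snd ℝ D.a (E →L[ℝ] ℝ)).contDiff.contMDiff.comp hj

theorem hasMFDerivAt_momentumMap (hj : ContMDiff 𝓘(ℝ, E') 𝓘(ℝ, D.a × (E →L[ℝ] ℝ)) ∞ j)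
    (y : G × F) : HasMFDerivAt (yModel E E') (ambientModel D) (momentumMap G D j) y
      ((ContinuousLinearMap.fst ℝ E E').prod
        ((md 𝓘(ℝ, E') 𝓘(ℝ, D.a × (E →L[ℝ] ℝ)) j y.2).comp (ContinuousLinearMap.snd ℝ E E')) :
        E × E' →L[ℝ] AmbientVec D) :=
  (hasMFDerivAt_fst (I := 𝓘(ℝ, E)) (I' := 𝓘(ℝ, E')) (x := y)).prodMk
    (hasMFDerivAt_comp_of_eq (hasMFDerivAt_md ((hj y.2).mdifferentiableAt (by simp)))
      (hasMFDerivAt_snd (I := 𝓘(ℝ, E)) (I' := 𝓘(ℝ, E')) (x := y)) rfl)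

theorem md_momentumMap (hj : ContMDiff 𝓘(ℝ, E') 𝓘(ℝ, D.a × (E →L[ℝ] ℝ)) ∞ j)
    (y : G × F) (u : E × E') : md (yModel E E') (ambientModel D) (momentumMap G D j) y u =
      (u.1, md 𝓘(ℝ, E') 𝓘(ℝ, D.a × (E →L[ℝ] ℝ)) j y.2 u.2) := by
  rw [md_eq_of_hasMFDerivAt (hasMFDerivAt_momentumMap hj y)]
  rfl

theorem legendreDeriv_apply (hj : ContMDiff 𝓘(ℝ, E') 𝓘(ℝ, D.a × (E →L[ℝ] ℝ)) ∞ j)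
    (p : F) (e : E') :
    legendreDeriv D j p e = (md 𝓘(ℝ, E') 𝓘(ℝ, D.a × (E →L[ℝ] ℝ)) j p e).2 := by
  have h := hasMFDerivAt_comp_of_eq (hasMFDerivAt_iff.mpr
    ((ContinuousLinearMap.snd ℝ D.a (E →L[ℝ] ℝ)).hasFDerivAt (x := j p)))
    (hasMFDerivAt_md ((hj p).mdifferentiableAt (by simp))) rfl
  exact congrArg (fun T : E' →L[ℝ] (E →L[ℝ] ℝ) => T e) (md_eq_of_hasMFDerivAt h)

theorem formY_eq (hj : ContMDiff 𝓘(ℝ, E') 𝓘(ℝ, D.a × (E →L[ℝ] ℝ)) ∞ j)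
    (y : G × F) (u w : E × E') :
    formY D j y u w = (legendreDeriv D j y.2 u.2 (maurerCartan y.1 w.1) -
      legendreDeriv D j y.2 w.2 (maurerCartan y.1 u.1) +
      adStar G (legendre D j y.2) (maurerCartan y.1 u.1) (maurerCartan y.1 w.1)) / 2 := by
  change canonicalForm D (momentumMap G D j y)
    (md (yModel E E') (ambientModel D) (momentumMap G D j) y u)
    (md (yModel E E') (ambientModel D) (momentumMap G D j) y w) = _
  rw [canonicalForm_eq, md_momentumMap hj, md_momentumMap hj, legendreDeriv_apply hj,
    legendreDeriv_apply hj, adStar_apply, ← sub_eq_add_neg]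
  rfl

/-- Differentiate the identity `⟨η; Q⟩ = L(Q)`, which holds along `Y`. -/
theorem md_momentumMap_mem_affineBundleTangent (hL : ContDiff ℝ ∞ L)
    (hY : IsPhaseSpace G D E' j L) (y : G × F) (u : E × E') :
    md (yModel E E') (ambientModel D) (momentumMap G D j) y u ∈
      affineBundleTangent D L (momentumMap G D j y) := by
  have hj := contMDiff_of_isPhaseSpace hY
  rw [md_momentumMap hj]
  set dj := md 𝓘(ℝ, E') 𝓘(ℝ, D.a × (E →L[ℝ] ℝ)) j y.2 with hdj
  change (dj u.2).2 (D.P + (j y.2).1) + (j y.2).2 ((dj u.2).1 : E) =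
    fderiv ℝ L (j y.2).1 (dj u.2).1
  have h1 := hasFDerivAt_comp_extChartAt_symm
    (hasMFDerivAt_md ((hj y.2).mdifferentiableAt (by simp)))
  rw [← hdj] at h1
  set x := extChartAt 𝓘(ℝ, E') y.2 y.2 with hx
  have hinv : (extChartAt 𝓘(ℝ, E') y.2).symm x = y.2 := extChartAt_to_inv y.2
  have h2 := (D.a.subtypeL.hasFDerivAt.comp x h1.fst).const_add D.P
  have h3 := h1.snd.clm_apply h2
  have h4 := HasFDerivAt.comp x
    ((hL.differentiable (by simp)) (j ((extChartAt 𝓘(ℝ, E') y.2).symm x)).1).hasFDerivAt h1.fst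
  have h5 : (fun z => (j ((extChartAt 𝓘(ℝ, E') y.2).symm z)).2
      (D.P + D.a.subtypeL (j ((extChartAt 𝓘(ℝ, E') y.2).symm z)).1)) =
      fun z => L (j ((extChartAt 𝓘(ℝ, E') y.2).symm z)).1 := by
    ext1 z
    exact (hY.2.2.1 ((1 : G), (extChartAt 𝓘(ℝ, E') y.2).symm z)).1
  have h6 := congrArg (fun T : E' →L[ℝ] ℝ => T u.2) ((h5 ▸ h3).unique h4)
  simp only [hinv, add_apply, ContinuousLinearMap.comp_apply, ContinuousLinearMap.flip_apply,
    Submodule.subtypeL_apply, Function.comp_apply] at h6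
  rw [add_comm]
  exact h6

/-- `(A, e)`, in the left trivialization, lies in the kernel of `Ψ_Y` over `p`. -/
def IsKernelVector (G : Type*) [TopologicalSpace G] [ChartedSpace E G] [Group G]
    [LieGroup 𝓘(ℝ, E) ∞ G] (D : ControlSystem E) (j : F → D.a × (E →L[ℝ] ℝ)) (p : F) (A : E)
    (e : E') : Prop :=
  legendreDeriv D j p e = -adStar G (legendre D j p) A ∧ ∀ f : E', legendreDeriv D j p f A = 0

/-- Pairing with the vectors `(B|_g, 0)` yields the equation for `dΛ(e)`; pairing with the vectors
`(0, f)` yields the annihilation condition. -/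
theorem forall_formY_eq_zero_iff (hj : ContMDiff 𝓘(ℝ, E') 𝓘(ℝ, D.a × (E →L[ℝ] ℝ)) ∞ j)
    (y : G × F) (u : E × E') :
    (∀ w, formY D j y u w = 0) ↔ IsKernelVector G D j y.2 (maurerCartan y.1 u.1) u.2 := by
  constructor
  · intro h
    refine ⟨?_, fun f => ?_⟩
    · ext B
      have := h (leftTrans y.1 B, 0)
      rw [formY_eq hj] at this
      simp only [maurerCartan_leftTrans, map_zero, zero_apply, sub_zero] at this
      simp only [neg_apply]
      linarith
    · have := h (0, f)
      rw [formY_eq hj] at this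
      simp only [map_zero] at this
      linarith
  · rintro ⟨h1, h2⟩ w
    rw [formY_eq hj, h1, h2]
    simp

variable (D j) in
/-- `Ψ_Y` as a bilinear map. -/
def formYL (y : G × F) : E × E' →ₗ[ℝ] E × E' →ₗ[ℝ] ℝ :=
  LinearMap.mk₂ ℝ (fun u w => (legendreDeriv D j y.2 u.2 (maurerCartan y.1 w.1) -
      legendreDeriv D j y.2 w.2 (maurerCartan y.1 u.1) +
      adStar G (legendre D j y.2) (maurerCartan y.1 u.1) (maurerCartan y.1 w.1)) / 2)
    (fun u u' w => by simp; ring) (fun c u w => by simp; ring)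
    (fun u w w' => by simp; ring) (fun c u w => by simp; ring)

theorem adStar_antisymm (η : E →L[ℝ] ℝ) (A B : E) : adStar G η A B = -adStar G η B A := by
  have := lieGroup_min (E := E) (G := G)
  have := FiniteDimensional.complete ℝ E
  rw [adStar_apply, adStar_apply, neg_neg]
  have h : bracket G A B = -bracket G B A :=
    (lie_skew (L := GroupLieAlgebra 𝓘(ℝ, E) G) A B).symm
  rw [h, map_neg, neg_neg]

/-- The use of non-degeneracy: a nonzero such vector would annihilate both `ω` and `Ψ_Y`, hence the
top form `ω ∧ Ψ_Y^m`. -/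
theorem IsKernelVector.eq_zero (hj : ContMDiff 𝓘(ℝ, E') 𝓘(ℝ, D.a × (E →L[ℝ] ℝ)) ∞ j)
    (hnd : IsNondegenerate G D E' j) {p : F} {A : E} {e : E'} (h : IsKernelVector G D j p A e)
    (hom : D.om A = 0) : A = 0 ∧ e = 0 := by
  obtain ⟨m, hdim, hw⟩ := hnd
  obtain ⟨v, hv⟩ := hw ((1 : G), p)
  by_contra hne
  have hn : ((A, e) : E × E') ≠ 0 := fun h0 => hne (Prod.mk_eq_zero.mp h0)
  refine hv ?_
  have hk : ∀ w, formY D j ((1 : G), p) (A, e) w = 0 :=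
    (forall_formY_eq_zero_iff hj _ _).mpr (by simpa [maurerCartan_one] using h)
  have hform : formY (E' := E') D j ((1 : G), p) = fun u w => formYL D j ((1 : G), p) u w := by
    ext u w
    exact formY_eq hj _ _ _
  have hα : (fun u : E × E' => omegaForm D (1 : G) u.1) =
      fun u => (D.om.toLinearMap ∘ₗ (maurerCartan (1 : G)).toLinearMap ∘ₗ
        LinearMap.fst ℝ E E') u := rfl
  rw [hform] at hk
  have hskew : ∀ u w : E × E', formYL D j ((1 : G), p) u w = -formYL D j ((1 : G), p) w u := by
    intro u w
    simp only [formYL, LinearMap.mk₂_apply]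
    rw [adStar_antisymm]
    ring
  rw [hform]
  change wedgePow (fun u : E × E' => omegaForm D (1 : G) u.1) _ m v = 0
  rw [hα]
  refine wedgePow_eq_zero_of_kernel ?_ hn ?_ hk (fun w => ?_) v
  · rw [Module.finrank_prod, hdim]
  · simpa [maurerCartan_one] using hom
  · exact (hskew _ _).trans (neg_eq_zero.mpr (hk w))

/-- The integral element at `(1, p)` supplies a vector tangent to `Y` that is `Ψ`-orthogonal to all
of `T Z̃`, in particular to `TY`. It remains to rescale it. -/
theorem exists_isKernelVector (hL : ContDiff ℝ ∞ L) (hY : IsPhaseSpace G D E' j L) (p : F) :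
    ∃ (A : E) (e : E'), IsKernelVector G D j p A e ∧ D.om A = 1 := by
  have hj := contMDiff_of_isPhaseSpace hY
  obtain ⟨-, v, hv, hom⟩ := hY.2.2.1 ((1 : G), p)
  have hom' : D.om (maurerCartan (1 : G)
      (md (yModel E E') (ambientModel D) (momentumMap G D j) ((1 : G), p) v).1) ≠ 0 := hom
  rw [md_momentumMap hj, maurerCartan_one] at hom'
  have hk : IsKernelVector G D j p (maurerCartan (1 : G) v.1) v.2 :=
    (forall_formY_eq_zero_iff hj ((1 : G), p) v).mp fun w =>
      hv _ (md_momentumMap_mem_affineBundleTangent hL hY ((1 : G), p) w)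
  rw [maurerCartan_one] at hk
  set c := (D.om v.1)⁻¹ with hc
  refine ⟨c • v.1, c • v.2, ⟨?_, fun f => ?_⟩, ?_⟩
  · rw [map_smul, map_smul, hk.1, smul_neg]
  · rw [map_smul, hk.2, smul_zero]
  · rw [map_smul, smul_eq_mul, hc, inv_mul_cancel₀ hom']

/-- Coisotropy is used only through the component in `E'`, so the other component of a fundamental
vector never has to be computed. -/
theorem fundamental_snd (y : G × F) (B : E) : (fundamental (E' := E') y B).2 = 0 := by
  have h1 : MDifferentiableAt 𝓘(ℝ, E) (yModel E E') (fun h : G => ((h * y.1, y.2) : G × F)) 1 :=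
    (mdifferentiableAt_mul_right y.1 1).prodMk mdifferentiableAt_const
  have h2 := md_eq_of_hasMFDerivAt (hasMFDerivAt_comp_of_eq
    (hasMFDerivAt_snd (I := 𝓘(ℝ, E)) (I' := 𝓘(ℝ, E')) (x := (1 * y.1, y.2)))
    (hasMFDerivAt_md h1) rfl)
  have h3 := md_eq_of_hasMFDerivAt (I := 𝓘(ℝ, E)) (I' := 𝓘(ℝ, E')) (f' := (0 : E →L[ℝ] E'))
    (hasMFDerivAt_const y.2 (1 : G))
  exact congrArg (fun T : E →L[ℝ] E' => T B) (h2.symm.trans h3)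

/-- The structure of the characteristic vector field `ξ = A_ξ + Φ_ξ` and of the derivative of the
Legendre transform, for a coisotropic Lagrangian. -/
structure IsCharacteristic (G : Type*) [TopologicalSpace G] [ChartedSpace E G] [Group G]
    [LieGroup 𝓘(ℝ, E) ∞ G] (D : ControlSystem E) (j : F → D.a × (E →L[ℝ] ℝ))
    (Aξ : F → E) : Prop where
  smooth : ContMDiff 𝓘(ℝ, E') 𝓘(ℝ, E →L[ℝ] ℝ) ∞ (legendre D j)
  charField_eq : ∀ (g : G) (p : F),
    charField D j (g, p) = (leftTrans g (Aξ p), phaseField G D E' j p)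
  om_eq_one : ∀ p, D.om (Aξ p) = 1
  isKernelVector : ∀ p, IsKernelVector G D j p (Aξ p) (phaseField G D E' j p)
  eq_smul : ∀ (p : F) (A : E) (e : E'), IsKernelVector G D j p A e →
    ∃ c : ℝ, A = c • Aξ p ∧ e = c • phaseField G D E' j p
  injective : ∀ p, Function.Injective (legendreDeriv (E' := E') D j p)
  coisotropic : ∀ p ∈ regularPhase G D E' j, ∀ (A : E) (e : E'),
    legendreDeriv D j p e = -adStar G (legendre D j p) A → ∃ c : ℝ, e = c • phaseField G D E' j p

/-- Everything follows from the kernel of `Ψ_Y` being a line on which `ω` is nonzero. In particular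
`dΛ` is injective because `dΛ(e) = 0` makes `(0, e)` a kernel vector annihilated by `ω`; the
injectivity of `Λ` itself plays no role in this. -/
theorem exists_isCharacteristic (hL : ContDiff ℝ ∞ L) (hY : IsPhaseSpace G D E' j L)
    (hnd : IsNondegenerate G D E' j) (hco : IsCoisotropic G D E' j) :
    ∃ Aξ : F → E, IsCharacteristic G D (E' := E') j Aξ := by
  have hj := contMDiff_of_isPhaseSpace hY
  choose Aξ Φ hk hom using exists_isKernelVector (E' := E') (G := G) hL hY
  have huniq : ∀ (p : F) (A : E) (e : E'), IsKernelVector G D j p A e →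
      A = D.om A • Aξ p ∧ e = D.om A • Φ p := by
    intro p A e h
    -- Subtracting the multiple of the normalised vector with the same value of `ω` leaves a kernel
    -- vector annihilated by `ω`.
    have h' : IsKernelVector G D j p (A - D.om A • Aξ p) (e - D.om A • Φ p) := by
      refine ⟨?_, fun f => ?_⟩
      · rw [map_sub, map_sub, h.1, map_smul, map_smul, (hk p).1]
        module
      · rw [map_sub, map_smul, h.2, (hk p).2, smul_zero, sub_zero]
    have := h'.eq_zero hj hnd (by simp [hom])
    exact ⟨sub_eq_zero.mp this.1, sub_eq_zero.mp this.2⟩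
  have hchar : ∀ (g : G) (p : F), charField D j (g, p) = (leftTrans g (Aξ p), Φ p) := by
    intro g p
    have hex : ∃ u : E × E', (∀ w, formY D j (g, p) u w = 0) ∧ omegaForm D g u.1 = 1 := by
      refine ⟨(leftTrans g (Aξ p), Φ p), (forall_formY_eq_zero_iff hj _ _).mpr ?_, ?_⟩
      · simpa using hk p
      · simp [omegaForm, hom]
    obtain ⟨h1, h2⟩ := Classical.epsilon_spec hex
    change (∀ w, formY D j (g, p) (charField D j (g, p)) w = 0) at h1
    change D.om (maurerCartan g (charField D j (g, p)).1) = 1 at h2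
    have h3 := huniq p _ _ ((forall_formY_eq_zero_iff hj _ _).mp h1)
    rw [h2, one_smul, one_smul] at h3
    refine Prod.ext ?_ h3.2
    rw [← leftTrans_maurerCartan g (charField D j (g, p)).1]
    exact congrArg _ h3.1
  have hΦ : ∀ p, phaseField G D E' j p = Φ p := fun p => by rw [phaseField, hchar]
  refine ⟨Aξ, contMDiff_legendre hj, fun g p => by rw [hΦ, hchar], hom,
    fun p => by rw [hΦ]; exact hk p, fun p A e h => ⟨D.om A, by rw [hΦ]; exact huniq p A e h⟩,
    fun p => ?_, fun p hp A e h => ?_⟩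
  · rw [injective_iff_map_eq_zero]
    intro e he
    have h0 : IsKernelVector G D j p 0 e := ⟨by simp [he], fun f => by simp⟩
    exact (h0.eq_zero hj hnd (by simp)).2
  -- The equation `dΛ(e) = -ad*(A)η` is orthogonality to the orbit. Coisotropy splits `(A, e)` into
  -- an orbit vector, invisible in `E'`, and a multiple of `ξ`.
  · have hv : ∀ B : E, formY D j ((1 : G), p) (A, e) (fundamental ((1 : G), p) B) = 0 := by
      intro B
      rw [formY_eq hj, fundamental_snd, h]
      simp [maurerCartan_one]
    obtain ⟨B, n, hn, hv⟩ := hco ((1 : G), p) hp (A, e) hv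
    have h3 := (huniq p _ _ ((forall_formY_eq_zero_iff hj _ _).mp hn)).2
    have h4 := congrArg Prod.snd hv
    simp only [Prod.snd_add, fundamental_snd, zero_add] at h4
    rw [hΦ]
    exact ⟨_, h4.trans h3⟩

end Momentum

/-! ### The moment map -/

/-- If the range were proper, a nonzero functional on `𝔤*` would vanish on it; by reflexivity in
finite dimension this functional is evaluation at some `B`. -/
theorem surjective_of_annihilator_eq_zero {E V : Type*} [NormedAddCommGroup E] [NormedSpace ℝ E]
    [FiniteDimensional ℝ E] [AddCommGroup V] [Module ℝ V] (T : V →ₗ[ℝ] (E →L[ℝ] ℝ))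
    (h : ∀ B : E, (∀ v, T v B = 0) → B = 0) : Function.Surjective T := by
  rw [← LinearMap.range_eq_top]
  by_contra hne
  obtain ⟨f, hf, hle⟩ := Submodule.exists_le_ker_of_lt_top _ (lt_top_iff_ne_top.mpr hne)
  set c : Module.Dual ℝ E ≃ₗ[ℝ] (E →L[ℝ] ℝ) := LinearMap.toContinuousLinearMap with hc
  obtain ⟨B, hB⟩ := (Module.evalEquiv ℝ E).surjective (f ∘ₗ c.toLinearMap)
  have hfB : ∀ φ : E →L[ℝ] ℝ, f φ = φ B := by
    intro φ
    have := congrArg (fun S : Module.Dual ℝ (Module.Dual ℝ E) => S (c.symm φ)) hB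
    simp only [Module.evalEquiv_apply, Module.Dual.eval_apply, LinearMap.comp_apply,
      LinearEquiv.coe_coe, LinearEquiv.apply_symm_apply] at this
    exact this.symm
  have hB0 : B = 0 := h B fun v => by
    rw [← hfB]
    exact hle (LinearMap.mem_range_self T v)
  refine hf (LinearMap.ext fun φ => ?_)
  rw [hfB, hB0, map_zero]
  rfl

theorem finrank_map_eq_of_injective {V W : Type*} [AddCommGroup V] [Module ℝ V] [AddCommGroup W]
    [Module ℝ W] {f : V →ₗ[ℝ] W} (hf : Function.Injective f) (N : Submodule ℝ V) :
    Module.finrank ℝ (N.map f) = Module.finrank ℝ N :=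
  (Submodule.equivMapOfInjective f hf N).finrank_eq.symm

section Momentum

variable {E : Type*} [NormedAddCommGroup E] [NormedSpace ℝ E] [FiniteDimensional ℝ E]
variable {G : Type*} [TopologicalSpace G] [ChartedSpace E G] [Group G] [LieGroup 𝓘(ℝ, E) ∞ G]
variable {D : ControlSystem E}
variable {E' : Type*} [NormedAddCommGroup E'] [NormedSpace ℝ E'] [FiniteDimensional ℝ E']
variable {F : Type*} [TopologicalSpace F] [ChartedSpace E' F] [IsManifold 𝓘(ℝ, E') ∞ F]
variable {j : F → D.a × (E →L[ℝ] ℝ)} {Aξ : F → E}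

theorem mem_isotropyAlgebra_iff (η : E →L[ℝ] ℝ) (A : E) :
    A ∈ isotropyAlgebra G η ↔ adStar G η A = 0 := by
  constructor
  · intro h
    ext B
    rw [adStar_apply, h B]
    simp
  · intro h B
    have := congrArg (fun φ : E →L[ℝ] ℝ => φ B) h
    simpa [adStar_apply] using this

theorem coAd_inv_coAd (g : G) (η : E →L[ℝ] ℝ) : coAd g⁻¹ (coAd g η) = η := by
  rw [← coAd_mul, inv_mul_cancel, coAd_one]

theorem coAdL_injective (g : G) : Function.Injective (coAdL (E := E) G g) :=
  Function.LeftInverse.injective (g := coAd g⁻¹) fun η => coAd_inv_coAd g η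

theorem coAdL_surjective (g : G) : Function.Surjective (coAdL (E := E) G g) := fun η =>
  ⟨coAd g⁻¹ η, by rw [coAdL_apply, ← coAd_mul, mul_inv_cancel, coAd_one]⟩

variable (D j) in
/-- The derivative of the moment map. -/
def momentDeriv (y : G × F) : E × E' →L[ℝ] (E →L[ℝ] ℝ) :=
  (coAdL G y.1).comp (((adStar G (legendre D j y.2)).comp (maurerCartan y.1)).coprod
    (legendreDeriv D j y.2))

theorem momentDeriv_apply (y : G × F) (u : E × E') : momentDeriv D j y u =
    coAdL G y.1 (adStar G (legendre D j y.2) (maurerCartan y.1 u.1) +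
      legendreDeriv D j y.2 u.2) := rfl

theorem contMDiff_momentJ
    (hj : ContMDiff 𝓘(ℝ, E') 𝓘(ℝ, E →L[ℝ] ℝ) ∞ (legendre D j)) :
    ContMDiff (yModel E E') 𝓘(ℝ, E →L[ℝ] ℝ) ∞ (momentJ (G := G) D j) :=
  contMDiff_coAd contMDiff_fst (hj.comp contMDiff_snd)

/-- Since `J` is already known to be differentiable, its derivative is the sum of those of its
restrictions to the slices `G × {p}` and `{g} × ℱ`. -/
theorem hasMFDerivAt_momentJ
    (hj : ContMDiff 𝓘(ℝ, E') 𝓘(ℝ, E →L[ℝ] ℝ) ∞ (legendre D j)) (y : G × F) :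
    HasMFDerivAt (yModel E E') 𝓘(ℝ, E →L[ℝ] ℝ) (momentJ (G := G) D j) y
      (momentDeriv D j y : E × E' →L[ℝ] (E →L[ℝ] ℝ)) := by
  have hJ := hasMFDerivAt_md ((contMDiff_momentJ (G := G) hj y).mdifferentiableAt (by simp))
  set T := md (yModel E E') 𝓘(ℝ, E →L[ℝ] ℝ) (momentJ (G := G) D j) y with hT
  have h1 := md_eq_of_hasMFDerivAt (hasMFDerivAt_comp_of_eq hJ
    (HasMFDerivAt.prodMk (df := ContinuousLinearMap.id ℝ E) (dg := (0 : E →L[ℝ] E'))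
      (hasMFDerivAt_id (I := 𝓘(ℝ, E)) y.1)
      (hasMFDerivAt_const (I := 𝓘(ℝ, E)) (I' := 𝓘(ℝ, E')) y.2 y.1)) rfl)
  have h2 := md_eq_of_hasMFDerivAt (hasMFDerivAt_comp_of_eq hJ
    (HasMFDerivAt.prodMk (df := (0 : E' →L[ℝ] E)) (dg := ContinuousLinearMap.id ℝ E')
      (hasMFDerivAt_const (I := 𝓘(ℝ, E')) (I' := 𝓘(ℝ, E)) y.1 y.2)
      (hasMFDerivAt_id (I := 𝓘(ℝ, E')) y.2)) rfl)
  have h3 := md_eq_of_hasMFDerivAt (hasMFDerivAt_coAd y.1 (legendre D j y.2))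
  have h4 := md_eq_of_hasMFDerivAt (hasMFDerivAt_comp_of_eq (hasMFDerivAt_iff.mpr
    ((coAdL G y.1).hasFDerivAt (x := legendre D j y.2)))
    (hasMFDerivAt_md ((hj y.2).mdifferentiableAt (by simp))) rfl)
  have h5 : T = momentDeriv D j y := by
    refine ContinuousLinearMap.ext fun u => ?_
    have hu : u = (u.1, 0) + (0, u.2) := by simp
    have e1 := congrArg (fun S : E →L[ℝ] (E →L[ℝ] ℝ) => S u.1) (h1.symm.trans h3)
    have e2 := congrArg (fun S : E' →L[ℝ] (E →L[ℝ] ℝ) => S u.2) (h2.symm.trans h4)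
    conv_lhs => rw [hu]
    rw [map_add, momentDeriv_apply, map_add]
    exact congrArg₂ (· + ·) e1 e2
  rw [← h5]
  exact hJ

/-- After undoing `Ad*(g)`, the annihilator of the image consists of the `B` for which `(B, 0)` is a
kernel vector, that is, a multiple of `ξ`. If `Φ_ξ ≠ 0` only `B = 0` remains; if `Φ_ξ = 0`, the
vector `A_ξ`, nonzero because `ω(A_ξ) = 1`, annihilates the image. -/
theorem momentDeriv_surjective_iff (h : IsCharacteristic G D (E' := E') j Aξ) (y : G × F) :
    Function.Surjective (momentDeriv (E' := E') D j y) ↔ y.2 ∈ regularPhase G D E' j := by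
  constructor
  · intro hs h0
    have hk := h.isKernelVector y.2
    rw [show phaseField G D E' j y.2 = 0 from h0] at hk
    have hall : ∀ φ : E →L[ℝ] ℝ, φ (Aξ y.2) = 0 := by
      intro φ
      obtain ⟨u, hu⟩ := hs (coAdL G y.1 φ)
      rw [momentDeriv_apply] at hu
      rw [← coAdL_injective y.1 hu, add_apply, hk.2, add_zero, adStar_antisymm]
      have h2 := hk.1
      rw [map_zero, eq_comm, neg_eq_zero] at h2
      rw [h2]
      simp
    have := h.om_eq_one y.2
    rw [hall] at this
    exact zero_ne_one this
  · intro hp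
    refine (coAdL_surjective y.1).comp ?_
    refine surjective_of_annihilator_eq_zero
      (((adStar G (legendre D j y.2)).comp (maurerCartan y.1)).coprod
        (legendreDeriv (E' := E') D j y.2)).toLinearMap fun B hB => ?_
    have hk : IsKernelVector (E' := E') G D j y.2 B 0 := by
      refine ⟨?_, fun f => ?_⟩
      · ext C
        have := hB (leftTrans y.1 C, 0)
        simp only [ContinuousLinearMap.coe_coe, ContinuousLinearMap.coprod_apply,
          ContinuousLinearMap.comp_apply, maurerCartan_leftTrans, map_zero, add_zero] at this
        rw [neg_apply, adStar_antisymm, this]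
        simp
      · simpa using hB (0, f)
    obtain ⟨c, hc1, hc2⟩ := h.eq_smul y.2 B 0 hk
    have hc : c = 0 := by
      rcases smul_eq_zero.mp hc2.symm with h0 | h0
      · exact h0
      · exact absurd h0 hp
    rw [hc1, hc, zero_smul]

/-- The kernel of `dJ` is the polar of the orbit directions. Coisotropy determines the component in
`E'` up to a scalar `c`, and after subtracting `c ξ` what is left lies in `𝔤_η`. -/
theorem momentDeriv_eq_zero_iff (h : IsCharacteristic G D (E' := E') j Aξ) {y : G × F}
    (hy : y.2 ∈ regularPhase G D E' j) (u : E × E') :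
    momentDeriv D j y u = 0 ↔ ∃ c : ℝ, ∃ A ∈ isotropyAlgebra G (legendre D j y.2),
      u = c • charField D j y + (leftTrans y.1 A, (0 : E')) := by
  have hker : momentDeriv D j y u = 0 ↔ legendreDeriv D j y.2 u.2 =
      -adStar G (legendre D j y.2) (maurerCartan y.1 u.1) := by
    rw [momentDeriv_apply, map_eq_zero_iff _ (coAdL_injective y.1), add_comm,
      add_eq_zero_iff_eq_neg]
  rw [hker, show charField (E' := E') D j y = _ from h.charField_eq y.1 y.2]
  constructor
  · intro hu
    obtain ⟨c, hc⟩ := h.coisotropic y.2 hy _ _ hu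
    refine ⟨c, maurerCartan y.1 u.1 - c • Aξ y.2, ?_, ?_⟩
    · rw [mem_isotropyAlgebra_iff, map_sub, map_smul]
      rw [hc, map_smul, (h.isKernelVector y.2).1, smul_neg, neg_inj] at hu
      rw [hu, sub_self]
    · refine Prod.ext ?_ ?_
      · simp
      · simp [hc]
  · rintro ⟨c, A, hA, rfl⟩
    rw [mem_isotropyAlgebra_iff] at hA
    simp [(h.isKernelVector y.2).1, hA]

theorem mem_fiberTangent_iff (y : G × F) (u : E × E') :
    u ∈ fiberTangent (E' := E') D j y ↔ ∃ c : ℝ, ∃ A ∈ isotropyAlgebra G (legendre D j y.2),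
      u = c • charField D j y + (leftTrans y.1 A, (0 : E')) := by
  rw [fiberTangent, Submodule.mem_sup]
  constructor
  · rintro ⟨a, ha, b, hb, rfl⟩
    obtain ⟨c, rfl⟩ := Submodule.mem_span_singleton.mp ha
    obtain ⟨A, hA, rfl⟩ := Submodule.mem_map.mp hb
    exact ⟨c, A, hA, rfl⟩
  · rintro ⟨c, A, hA, rfl⟩
    exact ⟨_, Submodule.mem_span_singleton.mpr ⟨c, rfl⟩, _, Submodule.mem_map.mpr ⟨A, hA, rfl⟩, rfl⟩

theorem ker_momentDeriv (h : IsCharacteristic G D (E' := E') j Aξ) {y : G × F}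
    (hy : y.2 ∈ regularPhase G D E' j) :
    (momentDeriv D j y).ker = fiberTangent (E' := E') D j y := by
  ext u
  rw [mem_fiberTangent_iff, ← momentDeriv_eq_zero_iff h hy]
  exact LinearMap.mem_ker

theorem finrank_ker_momentDeriv (h : IsCharacteristic G D (E' := E') j Aξ) {y : G × F}
    (hy : y.2 ∈ regularPhase G D E' j) :
    Module.finrank ℝ (momentDeriv (E' := E') D j y).ker =
      Module.finrank ℝ (isotropyAlgebra G (legendre D j y.2)) + 1 := by
  set N := (isotropyAlgebra G (legendre D j y.2)).map
      ((LinearMap.inl ℝ E E').comp (leftTrans (E := E) y.1 : E →L[ℝ] E).toLinearMap) with hN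
  have hinj : Function.Injective ((LinearMap.inl ℝ E E').comp
      (leftTrans (E := E) y.1 : E →L[ℝ] E).toLinearMap) :=
    LinearMap.inl_injective.comp
      (Function.LeftInverse.injective (g := maurerCartan y.1) (maurerCartan_leftTrans y.1))
  have hchar : (charField (E' := E') D j y).2 ≠ 0 := by
    rw [show charField (E' := E') D j y = _ from h.charField_eq y.1 y.2]
    exact hy
  have hdisj : Submodule.span ℝ {charField (E' := E') D j y} ⊓ N = ⊥ := by
    rw [Submodule.eq_bot_iff]
    rintro u ⟨h1, h2⟩
    obtain ⟨c, rfl⟩ := Submodule.mem_span_singleton.mp h1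
    obtain ⟨A, hA, hu⟩ := Submodule.mem_map.mp h2
    have h3 := congrArg Prod.snd hu
    have h4 : c • (charField (E' := E') D j y).2 = 0 := h3.symm
    rcases smul_eq_zero.mp h4 with h0 | h0
    · rw [h0, zero_smul]
    · exact absurd h0 hchar
  have hsum := Submodule.finrank_sup_add_finrank_inf_eq
    (Submodule.span ℝ {charField (E' := E') D j y}) N
  rw [hdisj, finrank_bot, add_zero, finrank_span_singleton
    (fun h0 => hchar (by rw [h0]; rfl)), hN, finrank_map_eq_of_injective hinj] at hsum
  rw [ker_momentDeriv h hy, fiberTangent, hsum, add_comm]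

/-- Rank-nullity for the surjection `dJ : 𝔤 × E' → 𝔤*`. The point is that the right-hand side does
not depend on `p`. -/
theorem finrank_isotropyAlgebra_add_one (h : IsCharacteristic G D (E' := E') j Aξ) {p : F}
    (hp : p ∈ regularPhase G D E' j) :
    Module.finrank ℝ (isotropyAlgebra G (legendre D j p)) + 1 = Module.finrank ℝ E' := by
  have h1 := finrank_ker_momentDeriv (y := ((1 : G), p)) h hp
  have h2 := (momentDeriv (E' := E') D j ((1 : G), p)).toLinearMap.finrank_range_add_finrank_ker
  have hs := (momentDeriv_surjective_iff h ((1 : G), p)).mpr hp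
  rw [LinearMap.range_eq_top.mpr hs, finrank_top, Module.finrank_prod] at h2
  have h3 : Module.finrank ℝ (E →L[ℝ] ℝ) = Module.finrank ℝ E := by
    rw [← (LinearMap.toContinuousLinearMap (𝕜 := ℝ) (E := E) (F' := ℝ)).finrank_eq]
    exact Subspace.dual_finrank_eq
  have h4 : Module.finrank ℝ (momentDeriv (E' := E') D j ((1 : G), p)).toLinearMap.ker =
    Module.finrank ℝ (isotropyAlgebra G (legendre D j p)) + 1 := h1
  omega

/-- Differentiate `Ad*(x) Ad*(g)η = Ad*(g) Ad*(g⁻¹xg)η` at `x = 1`. -/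
theorem adStar_coAd (g : G) (η : E →L[ℝ] ℝ) (A : E) :
    adStar G (coAd g η) A = coAdL G g (adStar G η (Ad g⁻¹ A)) := by
  have h1 := hasMFDerivAt_coAd_one (G := G) (coAd g η)
  have h2 := hasMFDerivAt_comp_of_eq (hasMFDerivAt_iff.mpr
    ((coAdL G g).hasFDerivAt (x := coAd (1 : G) η))) (hasMFDerivAt_comp_of_eq
      (hasMFDerivAt_coAd_one (G := G) η)
      (hasMFDerivAt_md (mdifferentiableAt_conj (E := E) g⁻¹ 1))
      (show g⁻¹ * 1 * g⁻¹⁻¹ = 1 by simp)) (by simp)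
  have h3 : (fun x : G => coAdL G g (coAd (g⁻¹ * x * g⁻¹⁻¹) η)) = fun x => coAd x (coAd g η) := by
    ext1 x
    rw [coAdL_apply, ← coAd_mul, ← coAd_mul]
    congr 1
    group
  rw [h3] at h2
  exact congrArg (fun T : E →L[ℝ] (E →L[ℝ] ℝ) => T A)
    ((md_eq_of_hasMFDerivAt h1).symm.trans (md_eq_of_hasMFDerivAt h2))

theorem finrank_isotropyAlgebra_coAd (g : G) (η : E →L[ℝ] ℝ) :
    Module.finrank ℝ (isotropyAlgebra G (coAd g η)) =
      Module.finrank ℝ (isotropyAlgebra G η) := by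
  have hinv : ∀ k : G, Function.LeftInverse (Ad (E := E) k⁻¹) (Ad k) := fun k A => by
    have := Ad_mul (E := E) k⁻¹ k
    rw [inv_mul_cancel, Ad_one] at this
    exact congrArg (fun T : E →L[ℝ] E => T A) this.symm
  have : isotropyAlgebra G η = (isotropyAlgebra G (coAd g η)).map (Ad g⁻¹).toLinearMap := by
    ext A
    rw [Submodule.mem_map]
    constructor
    · intro hA
      refine ⟨Ad g A, ?_, hinv g A⟩
      rw [mem_isotropyAlgebra_iff, adStar_coAd, hinv g A, (mem_isotropyAlgebra_iff _ _).mp hA,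
        map_zero]
    · rintro ⟨B, hB, rfl⟩
      rw [mem_isotropyAlgebra_iff] at hB ⊢
      rw [adStar_coAd] at hB
      exact (map_eq_zero_iff _ (coAdL_injective g)).mp hB
  rw [this]
  exact (finrank_map_eq_of_injective
    (f := (Ad g⁻¹).toLinearMap) (by exact (hinv g⁻¹).injective) _).symm

end Momentum

/-! ### The constant rank theorem -/

section Rank

variable {V W A R : Type*} [NormedAddCommGroup V] [NormedSpace ℝ V] [FiniteDimensional ℝ V]
  [NormedAddCommGroup W] [NormedSpace ℝ W] [FiniteDimensional ℝ W]
  [NormedAddCommGroup A] [NormedSpace ℝ A] [FiniteDimensional ℝ A]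
  [NormedAddCommGroup R] [NormedSpace ℝ R] [FiniteDimensional ℝ R]

/-- `Q` projects `V` onto `ker T ≅ A` and `P` projects `W` onto `range T ≅ R`: a vector killed by `P
∘ T` lies in `ker T`, where `Q` is injective. -/
theorem exists_complementary_projections (T : V →L[ℝ] W)
    (hA : Module.finrank ℝ T.ker = Module.finrank ℝ A)
    (hR : Module.finrank ℝ A + Module.finrank ℝ R = Module.finrank ℝ V) :
    ∃ (Q : V →L[ℝ] A) (P : W →L[ℝ] R), Function.Injective (Q.prod (P.comp T)) := by
  have hrn := T.toLinearMap.finrank_range_add_finrank_ker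
  have hrR : Module.finrank ℝ T.toLinearMap.range = Module.finrank ℝ R := by omega
  obtain ⟨q, hq⟩ := LinearMap.exists_leftInverse_of_injective T.toLinearMap.ker.subtype
    (Submodule.ker_subtype _)
  obtain ⟨p, hp⟩ := LinearMap.exists_leftInverse_of_injective T.toLinearMap.range.subtype
    (Submodule.ker_subtype _)
  let eA : T.toLinearMap.ker ≃ₗ[ℝ] A := LinearEquiv.ofFinrankEq _ _ hA
  let eR : T.toLinearMap.range ≃ₗ[ℝ] R := LinearEquiv.ofFinrankEq _ _ hrR
  refine ⟨LinearMap.toContinuousLinearMap (eA.toLinearMap ∘ₗ q),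
    LinearMap.toContinuousLinearMap (eR.toLinearMap ∘ₗ p), ?_⟩
  rw [injective_iff_map_eq_zero]
  intro v hv
  obtain ⟨h1, h2⟩ := Prod.mk_eq_zero.mp hv
  have h1' : q v = 0 := eA.map_eq_zero_iff.mp h1
  have h2' : p (T v) = 0 := eR.map_eq_zero_iff.mp h2
  have h3 : p (T v) = ⟨T v, LinearMap.mem_range_self _ v⟩ :=
    congrArg (fun S => S ⟨T v, LinearMap.mem_range_self T.toLinearMap v⟩) hp
  have h4 : T v = 0 := by
    rw [h2'] at h3
    exact (congrArg Subtype.val h3).symm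
  have h5 : q v = ⟨v, h4⟩ := congrArg (fun S => S ⟨v, h4⟩) hq
  rw [h1'] at h5
  exact (congrArg Subtype.val h5).symm

/-- The chart is `x ↦ (Q x, P (f x))`, a local diffeomorphism by the inverse function theorem.
Constancy of the rank makes the derivative of `f` vanish along the first coordinate, so `f` is
constant on the slices, which are connected because the target is a ball. -/
theorem exists_rank_chart_vectorSpace {f : V → W} {x₀ : V} {s : Set V} (hs : IsOpen s)
    (hx₀ : x₀ ∈ s) (hf : ContDiffOn ℝ ∞ f s)
    (hker : ∀ x ∈ s, Module.finrank ℝ (fderiv ℝ f x).ker = Module.finrank ℝ A)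
    (hR : Module.finrank ℝ A + Module.finrank ℝ R = Module.finrank ℝ V) :
    ∃ φ : OpenPartialHomeomorph V (A × R), x₀ ∈ φ.source ∧ φ.source ⊆ s ∧
      ContDiffOn ℝ ∞ φ φ.source ∧ ContDiffOn ℝ ∞ φ.symm φ.target ∧
      (∃ ρ > 0, φ.target = Metric.ball (φ x₀) ρ) ∧
      ∀ x ∈ φ.source, ∀ y ∈ φ.source, f x = f y ↔ (φ x).2 = (φ y).2 := by
  have := FiniteDimensional.complete ℝ V
  have hfx : ∀ x ∈ s, ContDiffAt ℝ ∞ f x := fun x hx => hf.contDiffAt (hs.mem_nhds hx)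
  obtain ⟨Q, P, hinj⟩ := exists_complementary_projections (R := R) (fderiv ℝ f x₀)
    (hker x₀ hx₀) hR
  have hfr : Module.finrank ℝ V = Module.finrank ℝ (A × R) := by
    rw [Module.finrank_prod, hR]
  set Φ : V → A × R := fun x => (Q x, P (f x)) with hΦ
  have hΦd : ∀ x ∈ s, HasFDerivAt Φ (Q.prod (P.comp (fderiv ℝ f x))) x := fun x hx =>
    Q.hasFDerivAt.prodMk (P.hasFDerivAt.comp x ((hfx x hx).differentiableAt (by simp)).hasFDerivAt)
  have hΦc : ∀ x ∈ s, ContDiffAt ℝ ∞ Φ x := fun x hx =>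
    Q.contDiff.contDiffAt.prodMk (P.contDiff.contDiffAt.comp x (hfx x hx))
  let equiv : ∀ S : V →L[ℝ] A × R, Function.Injective S → (V ≃L[ℝ] A × R) := fun S hS =>
    (LinearEquiv.ofInjectiveOfFinrankEq S.toLinearMap hS hfr).toContinuousLinearEquiv
  have hequiv : ∀ S hS, (equiv S hS : V →L[ℝ] A × R) = S := fun S hS => rfl
  have hd0 : HasFDerivAt Φ (equiv _ hinj : V →L[ℝ] A × R) x₀ := hΦd x₀ hx₀
  set ψ := (hΦc x₀ hx₀).toOpenPartialHomeomorph Φ hd0 (by simp) with hψ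
  have hψx₀ : x₀ ∈ ψ.source := (hΦc x₀ hx₀).mem_toOpenPartialHomeomorph_source hd0 (by simp)
  have hψΦ : ∀ x, ψ x = Φ x := fun x => rfl
  have hcont : ContinuousOn (fun x => Q.prod (P.comp (fderiv ℝ f x))) s := by
    have h1 : ContinuousOn (fderiv ℝ f) s := hf.continuousOn_fderiv_of_isOpen hs (by simp)
    have h2 : (fun x => Q.prod (P.comp (fderiv ℝ f x))) = fun x =>
        (ContinuousLinearMap.inl ℝ A R).comp Q +
          (ContinuousLinearMap.inr ℝ A R).comp (P.comp (fderiv ℝ f x)) := by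
      ext x v <;> simp
    rw [h2]
    exact continuousOn_const.add
      (continuousOn_const.clm_comp (continuousOn_const.clm_comp h1))
  set s' := s ∩ (fun x => Q.prod (P.comp (fderiv ℝ f x))) ⁻¹' {S | Function.Injective S} with hs'
  have hs'o : IsOpen s' := hcont.isOpen_inter_preimage hs ContinuousLinearMap.isOpen_injective
  have hx₀' : x₀ ∈ s' := ⟨hx₀, hinj⟩
  have hO : IsOpen (ψ.target ∩ ψ.symm ⁻¹' s') := ψ.symm.isOpen_inter_preimage hs'o
  -- A ball of `A × R` is a product of balls, so its slices are convex. The same shape is needed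
  -- later for the charts of the quotient.
  obtain ⟨ρ, hρ, hball⟩ := Metric.isOpen_iff.mp hO (ψ x₀)
    ⟨ψ.map_source hψx₀, by rw [mem_preimage, ψ.left_inv hψx₀]; exact hx₀'⟩
  set φ := (ψ.symm.restrOpen (Metric.ball (ψ x₀) ρ) Metric.isOpen_ball).symm with hφ
  have htarget : φ.target = Metric.ball (ψ x₀) ρ := by
    rw [hφ, OpenPartialHomeomorph.symm_target, OpenPartialHomeomorph.restrOpen_source]
    exact inter_eq_right.mpr fun y hy => (hball hy).1
  have hφψ : ∀ x, φ x = Φ x := fun x => rfl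
  have hsymm : ∀ y, φ.symm y = ψ.symm y := fun y => rfl
  have hsub : φ.source ⊆ s' := by
    intro x hx
    have h1 := φ.map_source hx
    rw [htarget] at h1
    have h2 := (hball h1).2
    rw [mem_preimage, ← hsymm, φ.left_inv hx] at h2
    exact h2
  have hx₀s : x₀ ∈ φ.source := by
    have h1 : ψ x₀ ∈ φ.target := by rw [htarget]; exact Metric.mem_ball_self hρ
    have h2 := φ.map_target h1
    rwa [hsymm, ψ.left_inv hψx₀] at h2
  have hsm : ContDiffOn ℝ ∞ φ.symm φ.target := by
    intro y hy
    have h1 := hsub (φ.map_target hy)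
    exact (φ.contDiffAt_symm (f₀' := equiv _ h1.2) hy (hΦd _ h1.1) (hΦc _ h1.1)).contDiffWithinAt
  refine ⟨φ, hx₀s, fun x hx => (hsub hx).1, fun x hx => (hΦc x (hsub hx).1).contDiffWithinAt, hsm,
    ⟨ρ, hρ, htarget⟩, ?_⟩
  have hconst : ∀ y ∈ φ.target, ∀ v : A,
      HasFDerivAt (fun z => f (φ.symm z)) (fderiv ℝ (fun z => f (φ.symm z)) y) y ∧
      fderiv ℝ (fun z => f (φ.symm z)) y (v, 0) = 0 := by
    intro y hy v
    have h1 := hsub (φ.map_target hy)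
    have h2 : HasFDerivAt φ.symm (fderiv ℝ φ.symm y) y :=
      ((hsm.contDiffAt (φ.open_target.mem_nhds hy)).differentiableAt (by simp)).hasFDerivAt
    have h3 : HasFDerivAt f (fderiv ℝ f (φ.symm y)) (φ.symm y) :=
      ((hfx _ h1.1).differentiableAt (by simp)).hasFDerivAt
    have h4 := h3.comp y h2
    have h5 := (hΦd _ h1.1).comp y h2
    have h6 : Φ ∘ φ.symm =ᶠ[𝓝 y] id := Filter.eventually_of_mem (φ.open_target.mem_nhds hy)
      fun z hz => φ.right_inv hz
    have h7 := congrArg (fun S : A × R →L[ℝ] A × R => S (v, 0))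
      (h5.unique ((hasFDerivAt_id y).congr_of_eventuallyEq h6))
    refine ⟨h4.differentiableAt.hasFDerivAt, ?_⟩
    have h4' : fderiv ℝ (fun z => f (φ.symm z)) y = _ := h4.fderiv
    rw [h4']
    set w := fderiv ℝ φ.symm y (v, 0) with hw
    have h8 : P (fderiv ℝ f (φ.symm y) w) = 0 := congrArg Prod.snd h7
    set T := fderiv ℝ f (φ.symm y) with hT
    -- `P ∘ T` is onto `R`, so its kernel has the dimension of `A`; by constancy of the rank so does
    -- `ker T`, and the inclusion is an equality.
    have hle : T.toLinearMap.ker ≤ (P.comp T).toLinearMap.ker := by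
      intro u hu
      have hu' : T u = 0 := hu
      change P (T u) = 0
      rw [hu', map_zero]
    have hsurj : Function.Surjective (P.comp T).toLinearMap := by
      intro b
      obtain ⟨u, hu⟩ := (equiv _ h1.2).surjective (0, b)
      exact ⟨u, congrArg Prod.snd hu⟩
    have hdim := (P.comp T).toLinearMap.finrank_range_add_finrank_ker
    rw [LinearMap.range_eq_top.mpr hsurj, finrank_top] at hdim
    have hkeq : T.toLinearMap.ker = (P.comp T).toLinearMap.ker := by
      refine Submodule.eq_of_le_of_finrank_eq hle ?_
      have h9 := hker _ h1.1
      change Module.finrank ℝ T.toLinearMap.ker = _ at h9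
      omega
    have h10 : w ∈ T.toLinearMap.ker := by rw [hkeq]; exact h8
    exact h10
  intro x hx y hy
  constructor
  · intro hxy
    rw [hφψ, hφψ]
    exact congrArg P hxy
  · intro hxy
    have hX := φ.map_source hx
    have hY := φ.map_source hy
    have hXY : (φ y) = ((φ y).1, (φ x).2) := Prod.ext rfl hxy.symm
    set a₀ := (ψ x₀).1
    have hsl : ∀ a ∈ Metric.ball a₀ ρ, (a, (φ x).2) ∈ φ.target := by
      intro a ha
      rw [htarget, ← ball_prod_same] at hX ⊢
      exact ⟨ha, hX.2⟩
    have hda : ∀ a ∈ Metric.ball a₀ ρ,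
        HasFDerivAt (fun a => f (φ.symm (a, (φ x).2))) (0 : A →L[ℝ] W) a := by
      intro a ha
      have h1 := HasFDerivAt.comp (f := fun a => (a, (φ x).2)) a (hconst _ (hsl a ha) 0).1
        (hasFDerivAt_prodMk_left a (φ x).2)
      have h2 : (fderiv ℝ (fun z => f (φ.symm z)) (a, (φ x).2)).comp
          (ContinuousLinearMap.inl ℝ A R) = 0 := by
        ext v
        exact (hconst _ (hsl a ha) v).2
      rw [h2] at h1
      exact h1
    have hmem : ∀ z ∈ φ.source, (φ z).1 ∈ Metric.ball a₀ ρ := by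
      intro z hz
      have := φ.map_source hz
      rw [htarget, ← ball_prod_same] at this
      exact this.1
    have hfin := (convex_ball a₀ ρ).is_const_of_fderivWithin_eq_zero (𝕜 := ℝ)
      (f := fun a => f (φ.symm (a, (φ x).2)))
      (fun a ha => (hda a ha).differentiableAt.differentiableWithinAt)
      (fun a ha => by
        rw [fderivWithin_of_isOpen Metric.isOpen_ball ha]
        exact (hda a ha).fderiv) (hmem x hx) (hmem y hy)
    simp only [← hXY] at hfin
    rw [φ.left_inv hy] at hfin
    rw [← hfin]
    exact congrArg f (φ.left_inv hx).symm

variable {H M : Type*} [TopologicalSpace H] {I : ModelWithCorners ℝ V H} [I.Boundaryless]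
  [TopologicalSpace M] [ChartedSpace H M] [IsManifold I ∞ M]

variable (I) in
/-- The extended chart of a manifold without boundary, as an open partial homeomorphism. -/
def extChartHomeomorph (x : M) : OpenPartialHomeomorph M V where
  toPartialEquiv := extChartAt I x
  open_source := isOpen_extChartAt_source x
  open_target := isOpen_extChartAt_target x
  continuousOn_toFun := continuousOn_extChartAt x
  continuousOn_invFun := continuousOn_extChartAt_symm x

/-- The constant rank theorem: near `x₀`, a smooth map `f` is, in a suitable chart, an injective
function of the second component. -/
theorem exists_rank_chart {f : M → W} {x₀ : M} {s : Set M} (hs : IsOpen s) (hx₀ : x₀ ∈ s)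
    (hf : ContMDiffOn I 𝓘(ℝ, W) ∞ f s)
    (hker : ∀ x ∈ s, Module.finrank ℝ (md I 𝓘(ℝ, W) f x).ker = Module.finrank ℝ A)
    (hR : Module.finrank ℝ A + Module.finrank ℝ R = Module.finrank ℝ V) :
    ∃ φ : OpenPartialHomeomorph M (A × R), x₀ ∈ φ.source ∧ φ.source ⊆ s ∧
      ContMDiffOn I 𝓘(ℝ, A × R) ∞ φ φ.source ∧ ContMDiffOn 𝓘(ℝ, A × R) I ∞ φ.symm φ.target ∧
      (∃ ρ > 0, φ.target = Metric.ball (φ x₀) ρ) ∧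
      ∀ x ∈ φ.source, ∀ y ∈ φ.source, f x = f y ↔ (φ x).2 = (φ y).2 := by
  set e := extChartHomeomorph I x₀ with he
  have hex : x₀ ∈ e.source := mem_extChartAt_source x₀
  have heM : ContMDiffOn I 𝓘(ℝ, V) ∞ e e.source := by
    have h := contMDiffOn_extChartAt (I := I) (x := x₀) (n := ∞)
    rw [← extChartAt_source I] at h
    exact h
  have heS : ContMDiffOn 𝓘(ℝ, V) I ∞ e.symm e.target := contMDiffOn_extChartAt_symm x₀
  set t := e.target ∩ e.symm ⁻¹' s with ht
  have hto : IsOpen t := e.symm.isOpen_inter_preimage hs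
  have htx : e x₀ ∈ t := ⟨e.map_source hex, by rw [mem_preimage, e.left_inv hex]; exact hx₀⟩
  have hfe : ContMDiffOn 𝓘(ℝ, V) 𝓘(ℝ, W) ∞ (fun y => f (e.symm y)) t :=
    hf.comp (heS.mono inter_subset_left) inter_subset_right
  have hfe' : ContDiffOn ℝ ∞ (fun y => f (e.symm y)) t := contMDiffOn_iff_contDiffOn.mp hfe
  have hker' : ∀ y ∈ t, Module.finrank ℝ (fderiv ℝ (fun y => f (e.symm y)) y).ker =
      Module.finrank ℝ A := by
    intro y hy
    rw [← hker _ hy.2]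
    have h1 := hasMFDerivAt_md ((contMDiffAt_extChartAt_symm x₀ hy.1).mdifferentiableAt (by simp))
    have h2 := hasMFDerivAt_md ((hf.contMDiffAt (hs.mem_nhds hy.2)).mdifferentiableAt (by simp))
    have h3 := hasMFDerivAt_iff.mp (hasMFDerivAt_comp_of_eq h2 h1 rfl)
    have h4 : fderiv ℝ (fun y => f (e.symm y)) y = _ := h3.fderiv
    rw [h4]
    have i1 := md_extChartAt_symm_comp (I := I) x₀ hy.1
    have i2 := md_extChartAt_comp_symm (I := I) x₀ hy.1
    set S := md 𝓘(ℝ, V) I (extChartAt I x₀).symm y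
    set S' := md I 𝓘(ℝ, V) (extChartAt I x₀) ((extChartAt I x₀).symm y)
    set T := md I 𝓘(ℝ, W) f (e.symm y)
    have hinj : Function.Injective S.toLinearMap := by
      refine Function.LeftInverse.injective (g := S') fun v => ?_
      exact congrArg (fun S : V →L[ℝ] V => S v) i2
    -- The derivative `S` of the inverse chart is invertible, so passing to coordinates preserves
    -- the dimension of the kernel.
    have hmap : T.toLinearMap.ker = (T.comp S).toLinearMap.ker.map S.toLinearMap := by
      ext v
      rw [Submodule.mem_map]
      constructor
      · intro hv
        have hv' : S (S' v) = v := congrArg (fun S : V →L[ℝ] V => S v) i1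
        refine ⟨S' v, ?_, hv'⟩
        change T (S (S' v)) = 0
        rw [hv']
        exact hv
      · rintro ⟨u, hu, rfl⟩
        exact hu
    have hfin := finrank_map_eq_of_injective hinj (T.comp S).toLinearMap.ker
    rw [← hmap] at hfin
    exact hfin.symm
  obtain ⟨φ, h1, h2, h3, h4, ⟨ρ, hρ, h5⟩, h6⟩ := exists_rank_chart_vectorSpace (A := A) (R := R)
    hto htx hfe' hker' hR
  have hsrc : ∀ x, x ∈ (e.trans φ).source ↔ x ∈ e.source ∧ e x ∈ φ.source := fun x => by
    rw [OpenPartialHomeomorph.trans_source]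
    rfl
  have htgt : (e.trans φ).target = φ.target := by
    rw [OpenPartialHomeomorph.trans_target]
    exact inter_eq_left.mpr fun y hy => (h2 (φ.map_target hy)).1
  refine ⟨e.trans φ, (hsrc _).mpr ⟨hex, h1⟩, fun x hx => ?_, ?_, ?_, ⟨ρ, hρ, ?_⟩, ?_⟩
  · have h7 := (h2 ((hsrc x).mp hx).2).2
    rwa [mem_preimage, e.left_inv ((hsrc x).mp hx).1] at h7
  · exact (contMDiffOn_iff_contDiffOn.mpr h3).comp (heM.mono fun x hx => ((hsrc x).mp hx).1)
      fun x hx => ((hsrc x).mp hx).2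
  · rw [htgt]
    exact heS.comp (contMDiffOn_iff_contDiffOn.mpr h4) fun y hy => (h2 (φ.map_target hy)).1
  · rw [htgt]
    exact h5
  · intro x hx y hy
    have h7 := h6 _ ((hsrc x).mp hx).2 _ ((hsrc y).mp hy).2
    rw [e.left_inv ((hsrc x).mp hx).1, e.left_inv ((hsrc y).mp hy).1] at h7
    exact h7

end Rank

/-! ### Submersions -/

section Submersion

variable {V W : Type*} [NormedAddCommGroup V] [NormedSpace ℝ V] [FiniteDimensional ℝ V]
  [NormedAddCommGroup W] [NormedSpace ℝ W] [FiniteDimensional ℝ W]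

/-- If `S` is a right inverse of `T`, then `U ∘ S` is an injective endomorphism of `W`, hence onto,
for every `U` near `T`. -/
theorem isOpen_setOf_surjective_clm : IsOpen {T : V →L[ℝ] W | Function.Surjective T} := by
  rw [isOpen_iff_mem_nhds]
  intro T hT
  obtain ⟨S, hS⟩ := LinearMap.exists_rightInverse_of_surjective T.toLinearMap
    (LinearMap.range_eq_top.mpr hT)
  set S' : W →L[ℝ] V := LinearMap.toContinuousLinearMap S
  have hopen : IsOpen {U : V →L[ℝ] W | Function.Injective (U.comp S')} :=
    ContinuousLinearMap.isOpen_injective.preimage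
      (continuous_id.clm_comp (continuous_const (y := S')))
  have hTS : T.comp S' = ContinuousLinearMap.id ℝ W := by
    ext w
    exact congrArg (fun S => S w) hS
  refine Filter.mem_of_superset (hopen.mem_nhds ?_) fun U hU => ?_
  · change Function.Injective (T.comp S')
    rw [hTS]
    exact Function.injective_id
  · have h : Function.Surjective (U.comp S') :=
      LinearMap.injective_iff_surjective (f := (U.comp S').toLinearMap).mp hU
    exact Function.Surjective.of_comp (g := S') h

variable {H M : Type*} [TopologicalSpace H] {I : ModelWithCorners ℝ V H} [I.Boundaryless]
  [TopologicalSpace M] [ChartedSpace H M] [IsManifold I ∞ M]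

theorem contDiffOn_comp_extChartAt_symm {f : M → W} (hf : ContMDiff I 𝓘(ℝ, W) ∞ f) (x : M) :
    ContDiffOn ℝ ∞ (fun y => f ((extChartAt I x).symm y)) (extChartAt I x).target :=
  contMDiffOn_iff_contDiffOn.mp (hf.comp_contMDiffOn (contMDiffOn_extChartAt_symm x))

theorem fderiv_comp_extChartAt_symm {f : M → W} (hf : ContMDiff I 𝓘(ℝ, W) ∞ f) (x : M) {y : V}
    (hy : y ∈ (extChartAt I x).target) :
    fderiv ℝ (fun y => f ((extChartAt I x).symm y)) y =
      (md I 𝓘(ℝ, W) f ((extChartAt I x).symm y)).comp (md 𝓘(ℝ, V) I (extChartAt I x).symm y) := by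
  have h1 := hasMFDerivAt_md ((contMDiffAt_extChartAt_symm x hy).mdifferentiableAt (by simp))
  have h2 := hasMFDerivAt_md ((hf ((extChartAt I x).symm y)).mdifferentiableAt (by simp))
  exact (hasMFDerivAt_iff.mp (hasMFDerivAt_comp_of_eq h2 h1 rfl)).fderiv

theorem isOpen_setOf_surjective_md {f : M → W} (hf : ContMDiff I 𝓘(ℝ, W) ∞ f) :
    IsOpen {x | Function.Surjective (md I 𝓘(ℝ, W) f x)} := by
  rw [isOpen_iff_mem_nhds]
  intro x hx
  have hx' : Function.Surjective (fderiv ℝ (fun y => f ((extChartAt I x).symm y))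
      (extChartAt I x x)) := by
    rw [← md_eq_fderiv_comp_extChartAt_symm ((hf x).mdifferentiableAt (by simp))]
    exact hx
  have h1 : ContinuousOn (fderiv ℝ fun y => f ((extChartAt I x).symm y)) (extChartAt I x).target :=
    (contDiffOn_comp_extChartAt_symm hf x).continuousOn_fderiv_of_isOpen
      (isOpen_extChartAt_target x) (by simp)
  have h2 := h1.isOpen_inter_preimage (isOpen_extChartAt_target x)
    (isOpen_setOf_surjective_clm (V := V) (W := W))
  have h3 := (continuousOn_extChartAt (I := I) x).isOpen_inter_preimage
    (isOpen_extChartAt_source x) h2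
  refine Filter.mem_of_superset (h3.mem_nhds ⟨mem_extChartAt_source x,
    mem_extChartAt_target x, hx'⟩) ?_
  rintro z ⟨hz, hz1, hz2⟩
  rw [mem_preimage, mem_ofPred_eq, fderiv_comp_extChartAt_symm hf x hz1,
    (extChartAt I x).left_inv hz] at hz2
  exact Function.Surjective.of_comp (g := md 𝓘(ℝ, V) I (extChartAt I x).symm (extChartAt I x z)) hz2

/-- In a chart this is the openness of a strictly differentiable map with surjective derivative. It
makes `J(Y_r)` a neighbourhood of each of its points. -/
theorem image_mem_nhds_of_surjective_md {f : M → W} (hf : ContMDiff I 𝓘(ℝ, W) ∞ f) {x : M}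
    (hx : Function.Surjective (md I 𝓘(ℝ, W) f x)) {U : Set M} (hU : U ∈ 𝓝 x) :
    f '' U ∈ 𝓝 (f x) := by
  have := FiniteDimensional.complete ℝ V
  have := FiniteDimensional.complete ℝ W
  have h1 : ContDiffAt ℝ ∞ (fun y => f ((extChartAt I x).symm y)) (extChartAt I x x) :=
    (contDiffOn_comp_extChartAt_symm hf x).contDiffAt
      ((isOpen_extChartAt_target x).mem_nhds (mem_extChartAt_target x))
  have h2 := h1.hasStrictFDerivAt (by simp)
  rw [← md_eq_fderiv_comp_extChartAt_symm ((hf x).mdifferentiableAt (by simp))] at h2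
  have h3 := h2.map_nhds_eq_of_surj (LinearMap.range_eq_top.mpr hx)
  rw [extChartAt_to_inv] at h3
  rw [← h3, Filter.mem_map]
  have h4 : ContinuousAt (extChartAt I x).symm (extChartAt I x x) := continuousAt_extChartAt_symm x
  have h5 : U ∈ 𝓝 ((extChartAt I x).symm (extChartAt I x x)) := by rwa [extChartAt_to_inv]
  exact Filter.mem_of_superset (h4 h5) fun z hz => mem_image_of_mem f hz

end Submersion

/-! ### Regular elements -/

/-- Let `C` be a complement of `ker T₁`, `S` a left inverse of `T₁` on `C`, and `M₀` the restriction
of `S T₀` to `C`. On `C`, composing the pencil with `S` gives `(1 - t) M₀ + t`, which is injective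
outside finitely many `t`; the kernel then meets `C` trivially. -/
theorem eventually_finrank_ker_le {V W : Type*} [AddCommGroup V] [Module ℝ V]
    [FiniteDimensional ℝ V] [AddCommGroup W] [Module ℝ W] (T₀ T₁ : V →ₗ[ℝ] W) :
    ∀ᶠ t in 𝓝[≠] (0 : ℝ),
      Module.finrank ℝ (T₀ + t • (T₁ - T₀)).ker ≤ Module.finrank ℝ T₁.ker := by
  obtain ⟨C, hC⟩ := T₁.ker.exists_isCompl
  have hinj : (T₁ ∘ₗ C.subtype).ker = ⊥ := by
    rw [LinearMap.ker_eq_bot, injective_iff_map_eq_zero]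
    intro c hc
    have : (c : V) ∈ T₁.ker ⊓ C := ⟨hc, c.2⟩
    rw [hC.inf_eq_bot] at this
    exact Subtype.ext this
  obtain ⟨S, hS⟩ := LinearMap.exists_leftInverse_of_injective _ hinj
  set M₀ : Module.End ℝ C := S ∘ₗ T₀ ∘ₗ C.subtype with hM₀
  have hfin : {l | M₀.HasEigenvalue l}.Finite := Module.End.finite_hasEigenvalue M₀
  -- Failure at `t ≠ 1` means that `-t / (1 - t)` is an eigenvalue `l` of `M₀`, i.e. `t = l / (l -
  -- 1)`. The value `0` is removed because only a punctured neighbourhood of `0` is at stake.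
  set bad : Set ℝ := ({1} ∪ (fun l : ℝ => l / (l - 1)) '' {l | M₀.HasEigenvalue l}) \ {0}
    with hbad
  have hbadfin : bad.Finite :=
    ((finite_singleton 1).union (Set.Finite.image _ hfin)).subset sdiff_subset
  have h1 : badᶜ ∈ 𝓝[≠] (0 : ℝ) :=
    mem_nhdsWithin_of_mem_nhds (hbadfin.isClosed.isOpen_compl.mem_nhds (by simp [hbad]))
  filter_upwards [h1, self_mem_nhdsWithin] with t ht ht0
  have ht1 : t ≠ 1 := fun h => ht ⟨Or.inl h, ht0⟩
  have hdisj : (T₀ + t • (T₁ - T₀)).ker ⊓ C = ⊥ := by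
    rw [Submodule.eq_bot_iff]
    rintro c ⟨hc, hcC⟩
    by_contra hc0
    have hc' : T₀ c + t • (T₁ c - T₀ c) = 0 := hc
    have hSc : S (T₁ c) = ⟨c, hcC⟩ := congrArg (fun R => R ⟨c, hcC⟩) hS
    have h2 : M₀ ⟨c, hcC⟩ + t • ((⟨c, hcC⟩ : C) - M₀ ⟨c, hcC⟩) = 0 := by
      have := congrArg S hc'
      rw [map_add, map_smul, map_sub, hSc, map_zero] at this
      exact this
    have h3 : M₀ ⟨c, hcC⟩ = (-t / (1 - t)) • (⟨c, hcC⟩ : C) := by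
      have h1t : (1 - t) ≠ 0 := sub_ne_zero.mpr (Ne.symm ht1)
      have h4 : (1 - t) • M₀ ⟨c, hcC⟩ = (-t) • (⟨c, hcC⟩ : C) := by
        rw [← sub_eq_zero, ← h2]
        module
      rw [div_eq_inv_mul, mul_smul, ← h4, smul_smul, inv_mul_cancel₀ h1t, one_smul]
    refine ht ⟨Or.inr ⟨-t / (1 - t), ?_, ?_⟩, ht0⟩
    · exact Module.End.hasEigenvalue_of_hasEigenvector
        ⟨Module.End.mem_eigenspace_iff.mpr h3, fun h => hc0 (congrArg Subtype.val h)⟩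
    · have h1t : (1 - t) ≠ 0 := sub_ne_zero.mpr (Ne.symm ht1)
      field_simp
      ring
  have h5 := Submodule.finrank_sup_add_finrank_inf_eq (T₀ + t • (T₁ - T₀)).ker C
  rw [hdisj, finrank_bot, add_zero] at h5
  have h6 := Submodule.finrank_add_eq_of_isCompl hC
  have h7 := Submodule.finrank_le ((T₀ + t • (T₁ - T₀)).ker ⊔ C)
  omega

section Momentum

variable {E : Type*} [NormedAddCommGroup E] [NormedSpace ℝ E] [FiniteDimensional ℝ E]
variable {G : Type*} [TopologicalSpace G] [ChartedSpace E G] [Group G] [LieGroup 𝓘(ℝ, E) ∞ G]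
variable {D : ControlSystem E}
variable {E' : Type*} [NormedAddCommGroup E'] [NormedSpace ℝ E'] [FiniteDimensional ℝ E']
variable {F : Type*} [TopologicalSpace F] [ChartedSpace E' F] [IsManifold 𝓘(ℝ, E') ∞ F]
variable {j : F → D.a × (E →L[ℝ] ℝ)} {Aξ : F → E}

theorem isotropyAlgebra_eq_ker (η : E →L[ℝ] ℝ) :
    isotropyAlgebra G η = (adStar G η).toLinearMap.ker := by
  ext A
  exact mem_isotropyAlgebra_iff η A

theorem groupRank_le (η : E →L[ℝ] ℝ) :
    groupRank (E := E) G ≤ Module.finrank ℝ (isotropyAlgebra G η) :=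
  ciInf_le (OrderBot.bddBelow _) η

theorem exists_finrank_eq_groupRank :
    ∃ η : E →L[ℝ] ℝ, Module.finrank ℝ (isotropyAlgebra G η) = groupRank (E := E) G :=
  Nat.sInf_mem (range_nonempty fun η : E →L[ℝ] ℝ => Module.finrank ℝ (isotropyAlgebra G η))

/-- An open set on which `dim 𝔤_μ` is constant consists of regular elements. -/
theorem finrank_isotropyAlgebra_eq_groupRank {η : E →L[ℝ] ℝ} {d : ℕ}
    (h : ∀ᶠ ζ in 𝓝 η, Module.finrank ℝ (isotropyAlgebra G ζ) = d) :
    d = groupRank (E := E) G := by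
  obtain ⟨μ, hμ⟩ := exists_finrank_eq_groupRank (E := E) (G := G)
  -- On the line from `η` to an element `μ` of minimal isotropy, points near `η` have isotropy of
  -- dimension `d`, and those other than `η` have dimension at most the rank. A common parameter
  -- decides.
  have h1 := eventually_finrank_ker_le (adStar G η).toLinearMap (adStar G μ).toLinearMap
  have hc : Filter.Tendsto (fun t : ℝ => η + t • (μ - η)) (𝓝[≠] 0) (𝓝 η) := by
    have hc : Continuous fun t : ℝ => η + t • (μ - η) := by fun_prop
    have := hc.tendsto 0
    rw [zero_smul, add_zero] at this
    exact this.mono_left nhdsWithin_le_nhds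
  obtain ⟨t, ht1, ht2⟩ := (h1.and (hc.eventually h)).exists
  have h3 : (adStar G (η + t • (μ - η))).toLinearMap =
      (adStar G η).toLinearMap + t • ((adStar G μ).toLinearMap - (adStar G η).toLinearMap) := by
    ext A B
    simp [adStar_apply]
    ring
  rw [isotropyAlgebra_eq_ker, h3] at ht2
  rw [ht2, ← isotropyAlgebra_eq_ker, hμ] at ht1
  refine le_antisymm ht1 ?_
  have h4 := groupRank_le (G := G) (η + t • (μ - η))
  rwa [isotropyAlgebra_eq_ker, h3, ht2] at h4

theorem regularMomentum_eq (h : IsCharacteristic G D (E' := E') j Aξ) :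
    regularMomentum G D E' j = {y | Function.Surjective
      (md (yModel E E') 𝓘(ℝ, E →L[ℝ] ℝ) (momentJ (G := G) D j) y)} := by
  ext y
  rw [mem_ofPred_eq, md_eq_of_hasMFDerivAt (hasMFDerivAt_momentJ h.smooth y),
    momentDeriv_surjective_iff h]
  rfl

theorem isOpen_regularMomentum (h : IsCharacteristic G D (E' := E') j Aξ) :
    IsOpen (regularMomentum G D E' j) := by
  rw [regularMomentum_eq h]
  exact isOpen_setOf_surjective_md (contMDiff_momentJ h.smooth)

theorem finrank_isotropyAlgebra_momentJ (y : G × F) :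
    Module.finrank ℝ (isotropyAlgebra G (momentJ D j y)) =
      Module.finrank ℝ (isotropyAlgebra G (legendre D j y.2)) :=
  finrank_isotropyAlgebra_coAd _ _

/-- `J(Y_r)` is a neighbourhood of `J(1, p)` on which `dim 𝔤_μ` has the constant value `dim ℱ - 1`.
-/
theorem finrank_isotropyAlgebra_legendre (h : IsCharacteristic G D (E' := E') j Aξ) {p : F}
    (hp : p ∈ regularPhase G D E' j) :
    Module.finrank ℝ (isotropyAlgebra G (legendre D j p)) = groupRank (E := E) G := by
  have hy : ((1 : G), p) ∈ regularMomentum G D E' j := hp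
  have hs := hy
  rw [regularMomentum_eq h] at hs
  refine finrank_isotropyAlgebra_eq_groupRank (η := momentJ D j ((1 : G), p)) ?_
  refine Filter.mem_of_superset (image_mem_nhds_of_surjective_md (contMDiff_momentJ h.smooth) hs
    ((isOpen_regularMomentum h).mem_nhds hy)) ?_
  rintro _ ⟨z, hz, rfl⟩
  have h1 := finrank_isotropyAlgebra_add_one h hp
  have h2 := finrank_isotropyAlgebra_add_one h (p := z.2) hz
  rw [mem_ofPred_eq, finrank_isotropyAlgebra_momentJ]
  omega

theorem momentJ_mem_regularElements (h : IsCharacteristic G D (E' := E') j Aξ) {y : G × F}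
    (hy : y ∈ regularMomentum G D E' j) : momentJ D j y ∈ regularElements (E := E) G := by
  rw [regularElements, mem_ofPred_eq, finrank_isotropyAlgebra_momentJ]
  exact finrank_isotropyAlgebra_legendre h hy

end Momentum

/-! ### Constructing manifolds -/

/-- The smoothness of the given charts and of their inverses is part of the conclusion: once the
structure is hidden behind the existential, this is the only access to it. -/
theorem exists_chartedSpace {V S : Type*} [NormedAddCommGroup V] [NormedSpace ℝ V]
    [TopologicalSpace S] (e : S → OpenPartialHomeomorph S V) (hx : ∀ x, x ∈ (e x).source)
    (htr : ∀ x y, ContDiffOn ℝ ∞ (fun a => e y ((e x).symm a)) ((e x).symm.trans (e y)).source) :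
    ∃ _ : ChartedSpace V S, IsManifold 𝓘(ℝ, V) ∞ S ∧
      (∀ x, ContMDiffOn 𝓘(ℝ, V) 𝓘(ℝ, V) ∞ (e x) (e x).source) ∧
      ∀ x, ContMDiffOn 𝓘(ℝ, V) 𝓘(ℝ, V) ∞ (e x).symm (e x).target := by
  let _ : ChartedSpace V S :=
    { atlas := range e
      chartAt := e
      mem_chart_source := hx
      chart_mem_atlas := mem_range_self }
  have hM : IsManifold 𝓘(ℝ, V) ∞ S := by
    refine isManifold_of_contDiffOn _ _ _ ?_
    rintro _ _ ⟨x, rfl⟩ ⟨y, rfl⟩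
    exact (htr x y).mono fun a ha => ha.1
  have hmax : ∀ x, e x ∈ IsManifold.maximalAtlas 𝓘(ℝ, V) ∞ S := fun x =>
    IsManifold.subset_maximalAtlas (mem_range_self x)
  exact ⟨inferInstance, hM, fun x => contMDiffOn_of_mem_maximalAtlas (hmax x),
    fun x => contMDiffOn_symm_of_mem_maximalAtlas (hmax x)⟩

/-! ### Embedded submanifolds: local retractions and slice charts. -/

section Embedded

variable {V H M : Type*} [NormedAddCommGroup V] [NormedSpace ℝ V] [TopologicalSpace H]
  {I : ModelWithCorners ℝ V H} [TopologicalSpace M] [ChartedSpace H M]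
variable {A : Type*} [NormedAddCommGroup A] [NormedSpace ℝ A]
variable {R : Type*} [NormedAddCommGroup R] [NormedSpace ℝ R]

/-- The map `ι : S → M` of manifolds locally has smooth left inverses, defined on open subsets
of `M`.  This holds for the inclusions of embedded submanifolds. -/
def HasLocalRetractions (A : Type*) [NormedAddCommGroup A] [NormedSpace ℝ A]
    (I : ModelWithCorners ℝ V H) {S : Type*} [TopologicalSpace S] [ChartedSpace A S]
    (ι : S → M) : Prop :=
  ∀ x : S, ∃ U ∈ 𝓝 (ι x), ∃ r : M → S, ContMDiffOn I 𝓘(ℝ, A) ∞ r U ∧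
    ∀ z : S, ι z ∈ U → r (ι z) = z

section

variable {S : Type*} [TopologicalSpace S] [ChartedSpace A S] {ι : S → M}
  {V' H' N : Type*} [NormedAddCommGroup V'] [NormedSpace ℝ V'] [TopologicalSpace H']
  {I' : ModelWithCorners ℝ V' H'} [TopologicalSpace N] [ChartedSpace H' N] {g : N → S}

/-- Locally `g = r ∘ (ι ∘ g)`, so smoothness into `S` can be tested in `M`. -/
theorem HasLocalRetractions.contMDiffWithinAt (h : HasLocalRetractions A I ι) {s : Set N} {x : N}
    (hg : ContMDiffWithinAt I' I ∞ (fun z => ι (g z)) s x) :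
    ContMDiffWithinAt I' 𝓘(ℝ, A) ∞ g s x := by
  obtain ⟨U, hU, r, hr, hrU⟩ := h (g x)
  have h1 : ContMDiffWithinAt I' 𝓘(ℝ, A) ∞ (fun z => r (ι (g z))) s x :=
    (hr.contMDiffAt hU).comp_contMDiffWithinAt x hg
  refine h1.congr_of_eventuallyEq ?_ (hrU _ (mem_of_mem_nhds hU)).symm
  filter_upwards [hg.continuousWithinAt hU] with z hz
  exact (hrU _ hz).symm

theorem HasLocalRetractions.contMDiff (h : HasLocalRetractions A I ι)
    (hg : ContMDiff I' I ∞ (fun z => ι (g z))) : ContMDiff I' 𝓘(ℝ, A) ∞ g :=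
  fun x => h.contMDiffWithinAt (hg x)

theorem HasLocalRetractions.contMDiffOn (h : HasLocalRetractions A I ι) {s : Set N}
    (hg : ContMDiffOn I' I ∞ (fun z => ι (g z)) s) : ContMDiffOn I' 𝓘(ℝ, A) ∞ g s :=
  fun x hx => h.contMDiffWithinAt (hg x hx)

theorem HasLocalRetractions.injective_md (h : HasLocalRetractions A I ι)
    (hS : ContMDiff 𝓘(ℝ, A) I ∞ ι) (x : S) : Function.Injective (md 𝓘(ℝ, A) I ι x) := by
  obtain ⟨U, hU, r, hr, hrU⟩ := h x
  have h1 := hasMFDerivAt_md ((hr.contMDiffAt hU).mdifferentiableAt (by simp))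
  have h2 := hasMFDerivAt_md ((hS x).mdifferentiableAt (by simp))
  have h3 := md_eq_of_hasMFDerivAt (hasMFDerivAt_comp_of_eq h1 h2 rfl)
  have h4 : (fun z : S => r (ι z)) =ᶠ[𝓝 x] fun z => z := by
    filter_upwards [(hS x).continuousAt hU] with z hz
    exact hrU z hz
  have h5 : md 𝓘(ℝ, A) 𝓘(ℝ, A) (fun z : S => r (ι z)) x = ContinuousLinearMap.id ℝ A :=
    (md_congr h4).trans (md_id x)
  refine Function.LeftInverse.injective (g := md I 𝓘(ℝ, A) r (ι x)) fun v => ?_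
  exact congrArg (fun T : A →L[ℝ] A => T v) (h3.symm.trans h5)

end

theorem exists_sliceChart {S : Set M} (x : S) (φ : OpenPartialHomeomorph M (A × R)) (c : R)
    (h : ∀ z ∈ φ.source, z ∈ S ↔ (φ z).2 = c) :
    ∃ e : OpenPartialHomeomorph S A, e.source = Subtype.val ⁻¹' φ.source ∧
      e.target = {a | (a, c) ∈ φ.target} ∧ (∀ z : S, e z = (φ z).1) ∧
      ∀ a, (a, c) ∈ φ.target → (e.symm a : M) = φ.symm (a, c) := by
  classical
  have hmem : ∀ a, (a, c) ∈ φ.target → φ.symm (a, c) ∈ S := fun a ha =>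
    (h _ (φ.map_target ha)).mpr (by rw [φ.right_inv ha])
  have hc : Continuous fun a : A => (a, c) := by fun_prop
  -- Outside the target the value is irrelevant; `x` serves as a default point of `S`.
  let inv : A → S := fun a => if ha : (a, c) ∈ φ.target then ⟨φ.symm (a, c), hmem a ha⟩ else x
  have hinv : ∀ a, (a, c) ∈ φ.target → (inv a : M) = φ.symm (a, c) := fun a ha => by
    simp only [inv, dif_pos ha]
  have hpair : ∀ z : S, (z : M) ∈ φ.source → ((φ z).1, c) = φ z := fun z hz =>
    Prod.ext rfl ((h _ hz).mp z.2).symm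
  refine ⟨{
    toFun := fun z => (φ z).1
    invFun := inv
    source := Subtype.val ⁻¹' φ.source
    target := {a | (a, c) ∈ φ.target}
    map_source' := fun z hz => by
      change ((φ z).1, c) ∈ φ.target
      rw [hpair z hz]
      exact φ.map_source hz
    map_target' := fun a ha => by
      change (inv a : M) ∈ φ.source
      rw [hinv a ha]
      exact φ.map_target ha
    left_inv' := fun z hz => by
      have h1 := φ.map_source hz
      rw [← hpair z hz] at h1
      refine Subtype.ext ((hinv _ h1).trans ?_)
      rw [hpair z hz, φ.left_inv hz]
    right_inv' := fun a ha => by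
      rw [hinv a ha, φ.right_inv ha]
    open_source := φ.open_source.preimage continuous_subtype_val
    open_target := φ.open_target.preimage hc
    continuousOn_toFun := continuous_fst.comp_continuousOn
      (φ.continuousOn.comp continuous_subtype_val.continuousOn fun z hz => hz)
    continuousOn_invFun := by
      rw [continuousOn_iff_continuous_domRestrict, continuous_induced_rng]
      have h1 : ContinuousOn (fun a => (inv a : M)) {a | (a, c) ∈ φ.target} :=
        (φ.continuousOn_symm.comp hc.continuousOn fun a ha => ha).congr hinv
      exact continuousOn_iff_continuous_domRestrict.mp h1
    }, rfl, rfl, fun z => rfl, hinv⟩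

/-- Inverse slice charts are smooth as maps into `M`, and `z ↦ (φ z).1` is smooth on an open subset
of `M`. Their composites are the transition maps, and in the other order the local retractions. -/
theorem exists_embedded_chartedSpace {S : Set M}
    (h : ∀ x : S, ∃ φ : OpenPartialHomeomorph M (A × R), (x : M) ∈ φ.source ∧
      ContMDiffOn I 𝓘(ℝ, A × R) ∞ φ φ.source ∧ ContMDiffOn 𝓘(ℝ, A × R) I ∞ φ.symm φ.target ∧
      ∀ z ∈ φ.source, z ∈ S ↔ (φ z).2 = (φ x).2) :
    ∃ _ : ChartedSpace A S, IsManifold 𝓘(ℝ, A) ∞ S ∧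
      ContMDiff 𝓘(ℝ, A) I ∞ (Subtype.val : S → M) ∧ HasLocalRetractions A I (Subtype.val : S → M) := by
  choose φ hx hφ hφs hS using h
  choose e he1 he2 he3 he4 using fun x => exists_sliceChart x (φ x) _ (hS x)
  have hsl : ∀ x : S, ContMDiffOn 𝓘(ℝ, A) I ∞ (fun a => ((e x).symm a : M)) (e x).target := by
    intro x
    have h1 : ContMDiff 𝓘(ℝ, A) 𝓘(ℝ, A × R) ∞ fun a : A => (a, (φ x x).2) :=
      (contDiff_id.prodMk contDiff_const).contMDiff
    refine ((hφs x).comp h1.contMDiffOn (s := (e x).target) ?_).congr ?_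
    · intro a ha
      rw [he2] at ha
      exact ha
    · intro a ha
      rw [he2] at ha
      exact he4 x a ha
  have hfst : ContMDiff 𝓘(ℝ, A × R) 𝓘(ℝ, A) ∞ (Prod.fst : A × R → A) := contDiff_fst.contMDiff
  have hproj : ∀ x : S, ContMDiffOn I 𝓘(ℝ, A) ∞ (fun z => (φ x z).1) (φ x).source := fun x =>
    hfst.comp_contMDiffOn (hφ x)
  obtain ⟨cs, hM, hc1, hc2⟩ := exists_chartedSpace e
    (fun x => by rw [he1]; exact hx x) fun x y => by
      refine contMDiffOn_iff_contDiffOn.mp ?_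
      refine ((hproj y).comp ((hsl x).mono ?_) ?_).congr ?_
      · exact fun a ha => ha.1
      · intro a ha
        have h2 := ha.2
        rw [mem_preimage, he1] at h2
        exact h2
      · intro a _
        exact he3 y _
  refine ⟨cs, hM, fun x => ?_, fun x => ?_⟩
  · have hxs : x ∈ (e x).source := by rw [he1]; exact hx x
    have h1 : ContMDiffOn 𝓘(ℝ, A) I ∞ (fun z => ((e x).symm (e x z) : M)) (e x).source :=
      (hsl x).comp (hc1 x) fun z hz => (e x).map_source hz
    refine (h1.congr fun z hz => ?_).contMDiffAt ((e x).open_source.mem_nhds hxs)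
    rw [(e x).left_inv hz]
  · have hxs : x ∈ (e x).source := by rw [he1]; exact hx x
    -- Off `S`, the projection of a point to the slice may leave the domain of the inverse slice
    -- chart, so the retraction is restricted to this open set.
    let U : Set M := (φ x).source ∩ (fun z => (φ x z).1) ⁻¹' (e x).target
    have hU : IsOpen U := (hproj x).continuousOn.isOpen_inter_preimage (φ x).open_source
      (e x).open_target
    have hxU : (x : M) ∈ U := ⟨hx x, by
      rw [mem_preimage, ← he3]
      exact (e x).map_source hxs⟩
    refine ⟨U, hU.mem_nhds hxU, fun z => (e x).symm (φ x z).1, ?_, fun z hz => ?_⟩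
    · exact (hc2 x).comp ((hproj x).mono inter_subset_left) fun z hz => hz.2
    · change (e x).symm (φ x z).1 = z
      rw [← he3]
      refine (e x).left_inv ?_
      rw [he1]
      exact hz.1

end Embedded

/-! ### The fibres of the moment map and the isotropy groups -/

section Momentum

variable {E : Type*} [NormedAddCommGroup E] [NormedSpace ℝ E] [FiniteDimensional ℝ E]
variable {G : Type*} [TopologicalSpace G] [ChartedSpace E G] [Group G] [LieGroup 𝓘(ℝ, E) ∞ G]
variable {D : ControlSystem E}
variable {E' : Type*} [NormedAddCommGroup E'] [NormedSpace ℝ E'] [FiniteDimensional ℝ E']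
variable {F : Type*} [TopologicalSpace F] [ChartedSpace E' F] [IsManifold 𝓘(ℝ, E') ∞ F]
variable {j : F → D.a × (E →L[ℝ] ℝ)} {Aξ : F → E}

/-- A subset which is locally a fibre of a map of constant rank is an embedded submanifold. -/
theorem exists_chartedSpace_of_rank {V H M W A : Type*}
    [NormedAddCommGroup V] [NormedSpace ℝ V] [FiniteDimensional ℝ V] [TopologicalSpace H]
    {I : ModelWithCorners ℝ V H} [I.Boundaryless] [TopologicalSpace M] [ChartedSpace H M]
    [IsManifold I ∞ M]
    [NormedAddCommGroup W] [NormedSpace ℝ W] [FiniteDimensional ℝ W]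
    [NormedAddCommGroup A] [NormedSpace ℝ A] [FiniteDimensional ℝ A]
    {f : M → W} {s : Set M} (hs : IsOpen s) (hf : ContMDiffOn I 𝓘(ℝ, W) ∞ f s)
    (hker : ∀ x ∈ s, Module.finrank ℝ (md I 𝓘(ℝ, W) f x).ker = Module.finrank ℝ A)
    {S : Set M} {w : W} (hS : ∀ x, x ∈ S ↔ x ∈ s ∧ f x = w) :
    ∃ _ : ChartedSpace A S, IsManifold 𝓘(ℝ, A) ∞ S ∧
      ContMDiff 𝓘(ℝ, A) I ∞ (Subtype.val : S → M) ∧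
      HasLocalRetractions A I (Subtype.val : S → M) := by
  refine exists_embedded_chartedSpace
    (R := EuclideanSpace ℝ (Fin (Module.finrank ℝ V - Module.finrank ℝ A))) fun x => ?_
  obtain ⟨hxs, hxw⟩ := (hS x).mp x.2
  have hle : Module.finrank ℝ A ≤ Module.finrank ℝ V := by
    rw [← hker x hxs]
    exact Submodule.finrank_le _
  obtain ⟨φ, h1, h2, h3, h4, -, h5⟩ := exists_rank_chart (A := A)
    (R := EuclideanSpace ℝ (Fin (Module.finrank ℝ V - Module.finrank ℝ A))) hs hxs hf hker
    (by rw [finrank_euclideanSpace_fin]; omega)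
  refine ⟨φ, h1, h3, h4, fun z hz => ?_⟩
  rw [hS, ← h5 z hz x h1, hxw]
  exact and_iff_right (h2 hz)

theorem exists_chartedSpace_fiber (h : IsCharacteristic G D (E' := E') j Aξ) (μ : E →L[ℝ] ℝ) :
    ∃ _ : ChartedSpace (EuclideanSpace ℝ (Fin (groupRank (E := E) G + 1))) (fiber G D E' j μ),
      IsManifold (𝓡 (groupRank (E := E) G + 1)) ∞ (fiber G D E' j μ) ∧
      ContMDiff (𝓡 (groupRank (E := E) G + 1)) (yModel E E') ∞
        (Subtype.val : fiber G D E' j μ → G × F) ∧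
      HasLocalRetractions (EuclideanSpace ℝ (Fin (groupRank (E := E) G + 1))) (yModel E E')
        (Subtype.val : fiber G D E' j μ → G × F) := by
  refine exists_chartedSpace_of_rank (isOpen_regularMomentum h)
    (contMDiff_momentJ h.smooth).contMDiffOn (fun y hy => ?_) (w := μ) fun y => Iff.rfl
  rw [md_eq_of_hasMFDerivAt (hasMFDerivAt_momentJ h.smooth y), finrank_ker_momentDeriv h hy,
    finrank_isotropyAlgebra_legendre h hy, finrank_euclideanSpace_fin]

/-- The kernel at `g` is the left translate of `𝔤_η`. Hence the orbit map has constant rank and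
`G_η` is one of its level sets. -/
theorem finrank_ker_coAd (g : G) (η : E →L[ℝ] ℝ) :
    Module.finrank ℝ
      (md 𝓘(ℝ, E) 𝓘(ℝ, E →L[ℝ] ℝ) (fun x : G => coAd x η) g).ker =
      Module.finrank ℝ (isotropyAlgebra G η) := by
  rw [md_eq_of_hasMFDerivAt (hasMFDerivAt_coAd g η)]
  have h1 : Function.Injective (leftTrans (E := E) g).toLinearMap :=
    Function.LeftInverse.injective (g := maurerCartan g) fun A => maurerCartan_leftTrans g A
  rw [← finrank_map_eq_of_injective h1 (isotropyAlgebra G η)]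
  suffices h2 : ((coAdL G g).comp ((adStar G η).comp (maurerCartan g)) :
      E →L[ℝ] (E →L[ℝ] ℝ)).toLinearMap.ker =
      (isotropyAlgebra G η).map (leftTrans (E := E) g).toLinearMap from
    congrArg (fun K : Submodule ℝ E => Module.finrank ℝ K) h2
  ext u
  rw [Submodule.mem_map]
  constructor
  · intro hu
    refine ⟨maurerCartan g u, ?_, leftTrans_maurerCartan g u⟩
    rw [mem_isotropyAlgebra_iff]
    refine coAdL_injective g ?_
    rw [map_zero]
    exact hu
  · rintro ⟨A, hA, rfl⟩
    rw [mem_isotropyAlgebra_iff] at hA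
    change coAdL G g (adStar G η (maurerCartan g (leftTrans g A))) = 0
    rw [maurerCartan_leftTrans, hA, map_zero]

theorem exists_chartedSpace_isotropyGroup {μ : E →L[ℝ] ℝ}
    (hμ : μ ∈ regularElements (E := E) G) :
    ∃ _ : ChartedSpace (EuclideanSpace ℝ (Fin (groupRank (E := E) G)))
      (isotropyGroup (G := G) μ),
      IsManifold (𝓡 (groupRank (E := E) G)) ∞ (isotropyGroup (G := G) μ) ∧
      ContMDiff (𝓡 (groupRank (E := E) G)) 𝓘(ℝ, E) ∞
        (Subtype.val : isotropyGroup (G := G) μ → G) ∧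
      HasLocalRetractions (EuclideanSpace ℝ (Fin (groupRank (E := E) G))) 𝓘(ℝ, E)
        (Subtype.val : isotropyGroup (G := G) μ → G) := by
  refine exists_chartedSpace_of_rank (f := fun x : G => coAd x μ) isOpen_univ
    (contMDiff_coAd contMDiff_id contMDiff_const).contMDiffOn (fun g _ => ?_)
    (S := (isotropyGroup (G := G) μ : Set G)) (w := μ)
    fun g => (and_iff_right (mem_univ g)).symm
  rw [finrank_ker_coAd, finrank_euclideanSpace_fin]
  exact hμ

/-! #### Tangent spaces of the fibres -/

section Fiber

variable {μ : E →L[ℝ] ℝ}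
variable [ChartedSpace (EuclideanSpace ℝ (Fin (groupRank (E := E) G + 1))) (fiber G D E' j μ)]

/-- `J` is constant on the fibre, which gives one inclusion; both sides have dimension `k + 1`. -/
theorem range_md_val_fiber (h : IsCharacteristic G D (E' := E') j Aξ)
    (hv : ContMDiff (𝓡 (groupRank (E := E) G + 1)) (yModel E E') ∞
        (Subtype.val : fiber G D E' j μ → G × F))
    (hr : HasLocalRetractions (EuclideanSpace ℝ (Fin (groupRank (E := E) G + 1))) (yModel E E')
        (Subtype.val : fiber G D E' j μ → G × F)) (y : fiber G D E' j μ) :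
    (md (𝓡 (groupRank (E := E) G + 1)) (yModel E E')
      (Subtype.val : fiber G D E' j μ → G × F) y).range = (momentDeriv D j y.1).ker := by
  have h1 := hasMFDerivAt_md ((hv y).mdifferentiableAt (by simp))
  have h2 := md_eq_of_hasMFDerivAt (hasMFDerivAt_comp_of_eq (hasMFDerivAt_momentJ h.smooth y.1)
    h1 rfl)
  have h3 : (fun z : fiber G D E' j μ => momentJ D j (z : G × F)) = fun _ => μ :=
    funext fun z => z.2.2
  rw [h3] at h2
  have h4 := md_eq_of_hasMFDerivAt (hasMFDerivAt_const (I := 𝓡 (groupRank (E := E) G + 1))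
    (I' := 𝓘(ℝ, E →L[ℝ] ℝ)) μ y)
  refine Submodule.eq_of_le_of_finrank_eq ?_ ?_
  · rintro _ ⟨v, rfl⟩
    exact congrArg (fun T : EuclideanSpace ℝ (Fin (groupRank (E := E) G + 1)) →L[ℝ]
      (E →L[ℝ] ℝ) => T v) (h2.symm.trans h4)
  · rw [finrank_ker_momentDeriv h y.2.1, finrank_isotropyAlgebra_legendre h y.2.1]
    refine (LinearMap.finrank_range_of_inj ?_).trans finrank_euclideanSpace_fin
    exact hr.injective_md hv y

end Fiber

/-! #### The Lie group structure of `G_μ` and its action -/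

section Action

variable {μ : E →L[ℝ] ℝ}
variable {B C : Type*} [NormedAddCommGroup B] [NormedSpace ℝ B] [NormedAddCommGroup C]
  [NormedSpace ℝ C]
variable [ChartedSpace B (isotropyGroup (G := G) μ)]
  [ChartedSpace C (fiber G D E' j μ)]

theorem lieGroup_isotropyGroup [IsManifold 𝓘(ℝ, B) ∞ (isotropyGroup (G := G) μ)]
    (hv : ContMDiff 𝓘(ℝ, B) 𝓘(ℝ, E) ∞ (Subtype.val : isotropyGroup (G := G) μ → G))
    (hr : HasLocalRetractions B 𝓘(ℝ, E) (Subtype.val : isotropyGroup (G := G) μ → G)) :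
    LieGroup 𝓘(ℝ, B) ∞ (isotropyGroup (G := G) μ) where
  contMDiff_mul := hr.contMDiff ((hv.comp contMDiff_fst).mul (hv.comp contMDiff_snd))
  contMDiff_inv := hr.contMDiff hv.inv

theorem contMDiff_smul_fiber
    (hv : ContMDiff 𝓘(ℝ, B) 𝓘(ℝ, E) ∞ (Subtype.val : isotropyGroup (G := G) μ → G))
    (hw : ContMDiff 𝓘(ℝ, C) (yModel E E') ∞ (Subtype.val : fiber G D E' j μ → G × F))
    (hr : HasLocalRetractions C (yModel E E') (Subtype.val : fiber G D E' j μ → G × F)) :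
    ContMDiff (𝓘(ℝ, B).prod 𝓘(ℝ, C)) 𝓘(ℝ, C) ∞
      (fun x : isotropyGroup (G := G) μ × fiber G D E' j μ => x.1 • x.2) := by
  have h1 := hv.comp (contMDiff_fst (I := 𝓘(ℝ, B)) (J := 𝓘(ℝ, C)) (n := ∞)
    (M := isotropyGroup (G := G) μ) (N := fiber G D E' j μ))
  have h2 := hw.comp (contMDiff_snd (I := 𝓘(ℝ, B)) (J := 𝓘(ℝ, C)) (n := ∞)
    (M := isotropyGroup (G := G) μ) (N := fiber G D E' j μ))
  exact hr.contMDiff ((h1.mul (contMDiff_fst.comp h2)).prodMk (contMDiff_snd.comp h2))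

end Action

theorem smul_fiber_eq_self {μ : E →L[ℝ] ℝ} {h : isotropyGroup (G := G) μ}
    {y : fiber G D E' j μ} (hy : h • y = y) : h = 1 := by
  have h1 := congrArg (fun z : fiber G D E' j μ => z.1.1) hy
  exact Subtype.ext (mul_eq_right.mp h1)

/-- Two points of `J⁻¹(μ)` with the same component in `ℱ` differ by an element of `G_μ`. -/
theorem mul_inv_mem_isotropyGroup {μ : E →L[ℝ] ℝ} {y z : fiber G D E' j μ}
    (h : y.1.2 = z.1.2) : z.1.1 * y.1.1⁻¹ ∈ isotropyGroup (G := G) μ := by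
  have hy : coAd y.1.1 (legendre D j y.1.2) = μ := y.2.2
  have hz : coAd z.1.1 (legendre D j z.1.2) = μ := z.2.2
  change coAd _ μ = μ
  have h1 := coAd_inv_coAd y.1.1 (legendre D j y.1.2)
  rw [hy] at h1
  rw [coAd_mul, h1, h, hz]

/-- This presents the orbits as the level sets of a smooth map, which gives the properness of the
action and the structure of the quotient. -/
theorem smul_fiber_eq_iff {μ : E →L[ℝ] ℝ} (y z : fiber G D E' j μ) :
    (∃ h : isotropyGroup (G := G) μ, h • y = z) ↔ y.1.2 = z.1.2 := by
  constructor
  · rintro ⟨h, rfl⟩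
    rfl
  · intro h
    refine ⟨⟨_, mul_inv_mem_isotropyGroup h⟩, Subtype.ext (Prod.ext ?_ h)⟩
    exact inv_mul_cancel_right _ _

theorem continuous_smul_fiber (μ : E →L[ℝ] ℝ) :
    Continuous fun x : isotropyGroup (G := G) μ × fiber G D E' j μ => x.1 • x.2 := by
  have hG : IsTopologicalGroup G := topologicalGroup_of_lieGroup 𝓘(ℝ, E) ∞
  rw [continuous_induced_rng]
  change Continuous fun x : isotropyGroup (G := G) μ × fiber G D E' j μ =>
    (((x.1 : G) * x.2.1.1, x.2.1.2) : G × F)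
  fun_prop

/-- `(h, y) ↦ (h y, y)` is a closed embedding: its image is the closed set of pairs with equal
component in the Hausdorff space `ℱ`, and `h` is recovered continuously as a quotient of
`G`-components. -/
theorem properSMul_fiber [T2Space F] (μ : E →L[ℝ] ℝ) :
    ProperSMul (isotropyGroup (G := G) μ) (fiber G D E' j μ) where
  isProperMap_smul_pair := by
    have hG : IsTopologicalGroup G := topologicalGroup_of_lieGroup 𝓘(ℝ, E) ∞
    set f : isotropyGroup (G := G) μ × fiber G D E' j μ →
      fiber G D E' j μ × fiber G D E' j μ := fun x => (x.1 • x.2, x.2)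
    have hf : Continuous f := (continuous_smul_fiber μ).prodMk continuous_snd
    have hrange : range f = {x | x.2.1.2 = x.1.1.2} := by
      ext x
      constructor
      · rintro ⟨z, rfl⟩
        rfl
      · intro hx
        obtain ⟨h, hh⟩ := (smul_fiber_eq_iff x.2 x.1).mpr hx
        exact ⟨(h, x.2), Prod.ext hh rfl⟩
    have hclosed : IsClosed (range f) := by
      rw [hrange]
      exact isClosed_eq (by fun_prop) (by fun_prop)
    have hemb : IsEmbedding f := by
      have hg : Continuous fun x : fiber G D E' j μ × fiber G D E' j μ =>
          (x.1.1.1 * x.2.1.1⁻¹, x.2) := by fun_prop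
      refine IsEmbedding.of_comp hf hg ?_
      have h1 : (fun x : fiber G D E' j μ × fiber G D E' j μ => (x.1.1.1 * x.2.1.1⁻¹, x.2)) ∘ f =
          Prod.map Subtype.val id :=
        funext fun z => Prod.ext (mul_inv_cancel_right _ _) rfl
      rw [h1]
      exact IsEmbedding.subtypeVal.prodMap IsEmbedding.id
    exact (IsClosedEmbedding.mk hemb hclosed).isProperMap

end Momentum

/-! ### Quotients with one-dimensional base -/

section Quotient

variable {A N B K : Type*} [NormedAddCommGroup A] [NormedSpace ℝ A]
  [TopologicalSpace N] [TopologicalSpace B] {π : N → B}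

/-- The last coordinate of `φ` descends to the quotient, and its inverse is `π` on the slice through
the centre `a`. Since the target is a product of balls, this slice reaches every value of the last
coordinate. -/
theorem exists_quotientChart (hπ : IsOpenQuotientMap π) (φ : OpenPartialHomeomorph N (A × ℝ))
    {a : A} {t : ℝ} {ρ : ℝ} (hφ : φ.target = Metric.ball (a, t) ρ)
    (h : ∀ x ∈ φ.source, ∀ z ∈ φ.source, π x = π z ↔ (φ x).2 = (φ z).2) :
    ∃ e : OpenPartialHomeomorph B ℝ, e.source = π '' φ.source ∧
      e.target = {s | (a, s) ∈ φ.target} ∧ (∀ z ∈ φ.source, e (π z) = (φ z).2) ∧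
      ∀ s, e.symm s = π (φ.symm (a, s)) := by
  classical
  have hc : Continuous fun s : ℝ => (a, s) := by fun_prop
  let q : B → ℝ := fun b => if hb : ∃ z ∈ φ.source, π z = b then (φ hb.choose).2 else 0
  have hq : ∀ z ∈ φ.source, q (π z) = (φ z).2 := fun z hz => by
    have hb : ∃ z' ∈ φ.source, π z' = π z := ⟨z, hz, rfl⟩
    simp only [q, dif_pos hb]
    exact (h _ hb.choose_spec.1 _ hz).mp hb.choose_spec.2
  have hmem : ∀ z ∈ φ.source, (a, (φ z).2) ∈ φ.target := fun z hz => by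
    have h1 := φ.map_source hz
    rw [hφ, ← ball_prod_same] at h1
    rw [hφ, ← ball_prod_same]
    exact ⟨Metric.mem_ball_self (Metric.pos_of_mem_ball h1.2), h1.2⟩
  refine ⟨{
    toFun := q
    invFun := fun s => π (φ.symm (a, s))
    source := π '' φ.source
    target := {s | (a, s) ∈ φ.target}
    map_source' := ?_
    map_target' := fun s hs => mem_image_of_mem π (φ.map_target hs)
    left_inv' := ?_
    right_inv' := fun s hs => by rw [hq _ (φ.map_target hs), φ.right_inv hs]
    open_source := hπ.isOpenMap _ φ.open_source
    open_target := φ.open_target.preimage hc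
    continuousOn_toFun := ?_
    continuousOn_invFun := hπ.continuous.comp_continuousOn
      (φ.continuousOn_symm.comp hc.continuousOn fun s hs => hs) }, rfl, rfl, hq, fun s => rfl⟩
  · rintro _ ⟨z, hz, rfl⟩
    rw [mem_ofPred_eq, hq z hz]
    exact hmem z hz
  · rintro _ ⟨z, hz, rfl⟩
    rw [hq z hz, h _ (φ.map_target (hmem z hz)) _ hz, φ.right_inv (hmem z hz)]
  · rintro _ ⟨z, hz, rfl⟩
    refine ContinuousAt.continuousWithinAt ?_
    rw [ContinuousAt, ← hπ.map_nhds_eq, Filter.tendsto_map'_iff]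
    have h1 : ContinuousAt (fun w => (φ w).2) z :=
      continuous_snd.continuousAt.comp (φ.continuousAt hz)
    rw [hq z hz]
    refine h1.congr' ?_
    filter_upwards [φ.open_source.mem_nhds hz] with w hw
    exact (hq w hw).symm

variable {C : Type*} [NormedAddCommGroup C] [NormedSpace ℝ C] [ChartedSpace C N]
  [Group K] [MulAction K N]

/-- The orbit space of a smooth action is a 1-manifold, over which the projection has local smooth
sections, as soon as there are charts separating the orbits by one of the coordinates. -/
theorem exists_chartedSpace_quotient (hπ : IsOpenQuotientMap π)
    (hK : ∀ x z, π x = π z ↔ ∃ h : K, h • x = z)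
    (hs : ∀ h : K, ContMDiff 𝓘(ℝ, C) 𝓘(ℝ, C) ∞ fun x : N => h • x)
    (hch : ∀ x : N, ∃ φ : OpenPartialHomeomorph N (A × ℝ), x ∈ φ.source ∧
      ContMDiffOn 𝓘(ℝ, C) 𝓘(ℝ, A × ℝ) ∞ φ φ.source ∧
      ContMDiffOn 𝓘(ℝ, A × ℝ) 𝓘(ℝ, C) ∞ φ.symm φ.target ∧
      (∃ ρ > 0, φ.target = Metric.ball (φ x) ρ) ∧
      ∀ x ∈ φ.source, ∀ z ∈ φ.source, π x = π z ↔ (φ x).2 = (φ z).2) :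
    ∃ _ : ChartedSpace ℝ B, IsManifold 𝓘(ℝ, ℝ) ∞ B ∧ ContMDiff 𝓘(ℝ, C) 𝓘(ℝ, ℝ) ∞ π ∧
      ∀ b : B, ∃ U : Set B, IsOpen U ∧ b ∈ U ∧ ∃ σ : B → N,
        ContMDiffOn 𝓘(ℝ, ℝ) 𝓘(ℝ, C) ∞ σ U ∧ ∀ b' ∈ U, π (σ b') = b' := by
  have key : ∀ b : B, ∃ (e : OpenPartialHomeomorph B ℝ) (s : ℝ → N), b ∈ e.source ∧
      ContMDiffOn 𝓘(ℝ, C) 𝓘(ℝ, ℝ) ∞ (fun x => e (π x)) (π ⁻¹' e.source) ∧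
      ContMDiffOn 𝓘(ℝ, ℝ) 𝓘(ℝ, C) ∞ s e.target ∧ ∀ t, e.symm t = π (s t) := by
    intro b
    obtain ⟨x, rfl⟩ := hπ.surjective b
    obtain ⟨φ, hx, hφ, hφs, ⟨ρ, -, hρ⟩, hsep⟩ := hch x
    obtain ⟨e, he1, he2, he3, he4⟩ := exists_quotientChart hπ φ (a := (φ x).1) (t := (φ x).2)
      hρ hsep
    refine ⟨e, fun t => φ.symm ((φ x).1, t), ?_, fun z hz => ?_, ?_, he4⟩
    · rw [he1]
      exact mem_image_of_mem π hx
    · rw [mem_preimage, he1] at hz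
      obtain ⟨w, hw, hwz⟩ := hz
      obtain ⟨h, rfl⟩ := (hK w z).mp hwz
      -- A point over the chart domain need not lie in `φ.source`, only in its saturation;
      -- translating by `h⁻¹` brings a neighbourhood back without changing `π`.
      have h0 : h⁻¹ • h • w = w := inv_smul_smul h w
      have h1 : ContMDiffAt 𝓘(ℝ, C) 𝓘(ℝ, ℝ) ∞ (fun u => (φ (h⁻¹ • u)).2) (h • w) := by
        have h2 : ContMDiffAt 𝓘(ℝ, C) 𝓘(ℝ, A × ℝ) ∞ φ (h⁻¹ • h • w) := by
          rw [h0]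
          exact hφ.contMDiffAt (φ.open_source.mem_nhds hw)
        have h3 : ContMDiff 𝓘(ℝ, A × ℝ) 𝓘(ℝ, ℝ) ∞ (Prod.snd : A × ℝ → ℝ) :=
          contDiff_snd.contMDiff
        exact (h3 _).comp _ (h2.comp _ (hs h⁻¹ (h • w)))
      refine (h1.congr_of_eventuallyEq ?_).contMDiffWithinAt
      have h4 : (fun u => h⁻¹ • u) ⁻¹' φ.source ∈ 𝓝 (h • w) := by
        refine (hs h⁻¹).continuous.continuousAt.preimage_mem_nhds ?_
        rw [h0]
        exact φ.open_source.mem_nhds hw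
      filter_upwards [h4] with u hu
      rw [← he3 _ hu, (hK u (h⁻¹ • u)).mpr ⟨h⁻¹, rfl⟩]
    · have h1 : ContMDiff 𝓘(ℝ, ℝ) 𝓘(ℝ, A × ℝ) ∞ fun t : ℝ => ((φ x).1, t) :=
        (contDiff_const.prodMk contDiff_id).contMDiff
      refine hφs.comp h1.contMDiffOn fun t ht => ?_
      rw [he2] at ht
      exact ht
  choose e s he1 he2 he3 he4 using key
  -- A transition map is the chart at `c` composed with `π` and then with the local section at `b`,
  -- hence smooth.
  obtain ⟨cs, hM, hc1, hc2⟩ := exists_chartedSpace e he1 fun b c => by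
    refine contMDiffOn_iff_contDiffOn.mp ?_
    refine ((he2 c).comp ((he3 b).mono fun t ht => ht.1) fun t ht => ?_).congr fun t _ => ?_
    · have h2 := ht.2
      change (e b).symm t ∈ (e c).source at h2
      rw [he4] at h2
      exact h2
    · rw [he4]
      rfl
  refine ⟨cs, hM, fun x => ?_, fun b => ⟨(e b).source, (e b).open_source, he1 b,
    fun b' => s b (e b b'), (he3 b).comp (hc1 b) fun b' hb' => (e b).map_source hb',
    fun b' hb' => by rw [← he4, (e b).left_inv hb']⟩⟩
  have h1 : ContMDiffOn 𝓘(ℝ, C) 𝓘(ℝ, ℝ) ∞ (fun z => (e (π x)).symm (e (π x) (π z)))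
      (π ⁻¹' (e (π x)).source) :=
    (hc2 (π x)).comp (he2 (π x)) fun z hz => (e (π x)).map_source hz
  refine (h1.congr fun z hz => ((e (π x)).left_inv hz).symm).contMDiffAt ?_
  exact hπ.continuous.continuousAt.preimage_mem_nhds ((e (π x)).open_source.mem_nhds (he1 _))

end Quotient

/-! ### The reduced spaces -/

section Momentum

variable {E : Type*} [NormedAddCommGroup E] [NormedSpace ℝ E] [FiniteDimensional ℝ E]
variable {G : Type*} [TopologicalSpace G] [ChartedSpace E G] [Group G] [LieGroup 𝓘(ℝ, E) ∞ G]
variable {D : ControlSystem E}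
variable {E' : Type*} [NormedAddCommGroup E'] [NormedSpace ℝ E'] [FiniteDimensional ℝ E']
variable {F : Type*} [TopologicalSpace F] [ChartedSpace E' F] [IsManifold 𝓘(ℝ, E') ∞ F]
variable {j : F → D.a × (E →L[ℝ] ℝ)} {Aξ : F → E} {μ : E →L[ℝ] ℝ}

theorem reducedProj_eq_iff' (y z : fiber G D E' j μ) :
    reducedProj G D E' j μ y = reducedProj G D E' j μ z ↔
      ∃ h : isotropyGroup (G := G) μ, h • y = z := by
  refine Quotient.eq.trans ?_
  rw [MulAction.orbitRel_apply]
  constructor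
  · rintro ⟨h, rfl⟩
    exact ⟨h⁻¹, inv_smul_smul h z⟩
  · rintro ⟨h, rfl⟩
    exact ⟨h⁻¹, inv_smul_smul h y⟩

theorem reducedProj_eq_iff (y z : fiber G D E' j μ) :
    reducedProj G D E' j μ y = reducedProj G D E' j μ z ↔ y.1.2 = z.1.2 :=
  (reducedProj_eq_iff' y z).trans (smul_fiber_eq_iff y z)

theorem continuousConstSMul_fiber :
    ContinuousConstSMul (isotropyGroup (G := G) μ) (fiber G D E' j μ) where
  continuous_const_smul h := (continuous_smul_fiber μ).comp (by fun_prop : Continuous fun y => (h, y))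

theorem isOpenQuotientMap_reducedProj : IsOpenQuotientMap (reducedProj G D E' j μ) :=
  have := continuousConstSMul_fiber (G := G) (D := D) (E' := E') (j := j) (μ := μ)
  MulAction.isOpenQuotientMap_quotientMk

/-- The map `[(g, p)] ↦ p`. -/
def reducedToPhase (b : ReducedSpace G D E' j μ) : F :=
  Quotient.lift (fun y : fiber G D E' j μ => y.1.2)
    (fun y z h => (reducedProj_eq_iff y z).mp (Quotient.sound h)) b

theorem injective_reducedToPhase :
    Function.Injective (reducedToPhase : ReducedSpace G D E' j μ → F) := by
  intro b c h
  obtain ⟨y, rfl⟩ := isOpenQuotientMap_reducedProj.surjective b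
  obtain ⟨z, rfl⟩ := isOpenQuotientMap_reducedProj.surjective c
  exact (reducedProj_eq_iff y z).mpr h

theorem t2Space_reducedSpace [T2Space F] : T2Space (ReducedSpace G D E' j μ) :=
  T2Space.of_injective_continuous (f := reducedToPhase) injective_reducedToPhase
    (continuous_quot_lift _ (by fun_prop))

theorem secondCountableTopology_reducedSpace [SecondCountableTopology G]
    [SecondCountableTopology F] : SecondCountableTopology (ReducedSpace G D E' j μ) :=
  have := continuousConstSMul_fiber (G := G) (D := D) (E' := E') (j := j) (μ := μ)
  ContinuousConstSMul.secondCountableTopology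

section Fiber

variable [ChartedSpace (EuclideanSpace ℝ (Fin (groupRank (E := E) G + 1))) (fiber G D E' j μ)]

theorem contMDiff_snd_fiber
    (hv : ContMDiff (𝓡 (groupRank (E := E) G + 1)) (yModel E E') ∞
        (Subtype.val : fiber G D E' j μ → G × F)) :
    ContMDiff (𝓡 (groupRank (E := E) G + 1)) 𝓘(ℝ, E') ∞ fun y : fiber G D E' j μ => y.1.2 :=
  contMDiff_snd.comp hv

/-- Of the tangent space `span ξ + 𝔤_η`, the second summand has no component in `E'`, and `ξ` has
component `Φ_ξ`. -/
theorem range_md_legendre_fiber (h : IsCharacteristic G D (E' := E') j Aξ)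
    (hv : ContMDiff (𝓡 (groupRank (E := E) G + 1)) (yModel E E') ∞
        (Subtype.val : fiber G D E' j μ → G × F))
    (hr : HasLocalRetractions (EuclideanSpace ℝ (Fin (groupRank (E := E) G + 1))) (yModel E E')
        (Subtype.val : fiber G D E' j μ → G × F)) (y : fiber G D E' j μ) :
    (md (𝓡 (groupRank (E := E) G + 1)) 𝓘(ℝ, E →L[ℝ] ℝ)
      (fun y : fiber G D E' j μ => legendre D j y.1.2) y).range =
    Submodule.span ℝ {legendreDeriv D j y.1.2 (phaseField G D E' j y.1.2)} := by
  have h1 := hasMFDerivAt_md ((hv y).mdifferentiableAt (by simp))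
  have h2 : HasMFDerivAt (yModel E E') 𝓘(ℝ, E') (Prod.snd : G × F → F) y.1
    (ContinuousLinearMap.snd ℝ E E' : E × E' →L[ℝ] E') := hasMFDerivAt_snd y.1
  have h3 : HasMFDerivAt 𝓘(ℝ, E') 𝓘(ℝ, E →L[ℝ] ℝ) (legendre D j) y.1.2
      (legendreDeriv D j y.1.2 : E' →L[ℝ] (E →L[ℝ] ℝ)) :=
    hasMFDerivAt_md ((h.smooth y.1.2).mdifferentiableAt (by simp))
  have h4 := md_eq_of_hasMFDerivAt (hasMFDerivAt_comp_of_eq h3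
    (hasMFDerivAt_comp_of_eq h2 h1 rfl) rfl)
  have h5 := (range_md_val_fiber h hv hr y).trans (ker_momentDeriv h y.2.1)
  set T := md (𝓡 (groupRank (E := E) G + 1)) (yModel E E')
    (Subtype.val : fiber G D E' j μ → G × F) y
  have h6 : ∀ v, md (𝓡 (groupRank (E := E) G + 1)) 𝓘(ℝ, E →L[ℝ] ℝ)
      (fun y : fiber G D E' j μ => legendre D j y.1.2) y v = legendreDeriv D j y.1.2 (T v).2 :=
    fun v => congrArg (fun S : EuclideanSpace ℝ (Fin (groupRank (E := E) G + 1)) →L[ℝ]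
      (E →L[ℝ] ℝ) => S v) h4
  have h7 : ∀ u : E × E', (∃ v, T v = u) ↔ u ∈ fiberTangent (G := G) (E' := E') D j y.1 :=
    fun u => by rw [← h5]; exact Iff.rfl
  have hc : (charField D j y.1 : E × E').2 = phaseField G D E' j y.1.2 :=
    (congrArg Prod.snd (h.charField_eq y.1.1 y.1.2) :)
  ext w
  rw [Submodule.mem_span_singleton]
  constructor
  · rintro ⟨v, rfl⟩
    obtain ⟨c, A, -, hu⟩ := (mem_fiberTangent_iff y.1 (T v)).mp ((h7 _).mp ⟨v, rfl⟩)
    refine ⟨c, ?_⟩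
    change _ = md (𝓡 (groupRank (E := E) G + 1)) 𝓘(ℝ, E →L[ℝ] ℝ)
      (fun y : fiber G D E' j μ => legendre D j y.1.2) y v
    rw [h6, hu, ← hc, ← map_smul]
    simp
  · rintro ⟨c, rfl⟩
    obtain ⟨v, hv⟩ := (h7 (c • charField D j y.1)).mpr
      ((mem_fiberTangent_iff y.1 _).mpr ⟨c, 0, zero_mem _, by simp⟩)
    refine ⟨v, (h6 v).trans ?_⟩
    rw [hv, ← hc, ← map_smul]
    rfl

theorem legendreDeriv_phaseField_ne_zero (h : IsCharacteristic G D (E' := E') j Aξ) {p : F}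
    (hp : p ∈ regularPhase G D E' j) : legendreDeriv D j p (phaseField G D E' j p) ≠ 0 :=
  fun h0 => hp (h.injective p (h0.trans (map_zero _).symm))

/-- The constant rank theorem is applied to `(g, p) ↦ Λ(p)` rather than to the projection onto `ℱ`,
because it needs values in a vector space. The rank is one, so the kernel has dimension `k`, and
injectivity of `Λ` makes the level sets the orbits. -/
theorem exists_chartedSpace_reducedSpace (h : IsCharacteristic G D (E' := E') j Aξ)
    (hΛ : Function.Injective (legendre D j))
    [IsManifold (𝓡 (groupRank (E := E) G + 1)) ∞ (fiber G D E' j μ)]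
    (hv : ContMDiff (𝓡 (groupRank (E := E) G + 1)) (yModel E E') ∞
        (Subtype.val : fiber G D E' j μ → G × F))
    (hr : HasLocalRetractions (EuclideanSpace ℝ (Fin (groupRank (E := E) G + 1))) (yModel E E')
        (Subtype.val : fiber G D E' j μ → G × F)) :
    ∃ _ : ChartedSpace ℝ (ReducedSpace G D E' j μ),
      IsManifold 𝓘(ℝ, ℝ) ∞ (ReducedSpace G D E' j μ) ∧
      ContMDiff (𝓡 (groupRank (E := E) G + 1)) 𝓘(ℝ, ℝ) ∞ (reducedProj G D E' j μ) ∧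
      ∀ b : ReducedSpace G D E' j μ, ∃ U : Set (ReducedSpace G D E' j μ), IsOpen U ∧ b ∈ U ∧
        ∃ σ : ReducedSpace G D E' j μ → fiber G D E' j μ,
          ContMDiffOn 𝓘(ℝ, ℝ) (𝓡 (groupRank (E := E) G + 1)) ∞ σ U ∧
          ∀ b' ∈ U, reducedProj G D E' j μ (σ b') = b' := by
  refine exists_chartedSpace_quotient (A := EuclideanSpace ℝ (Fin (groupRank (E := E) G)))
    (K := isotropyGroup (G := G) μ) isOpenQuotientMap_reducedProj reducedProj_eq_iff'
    (fun g => ?_) fun y => ?_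
  · have h1 : ContMDiff (yModel E E') (yModel E E') ∞
        fun z : G × F => ((g : G) * z.1, z.2) :=
      (contMDiff_const.mul contMDiff_fst).prodMk contMDiff_snd
    exact hr.contMDiff (h1.comp hv)
  · have hsm : ContMDiff (𝓡 (groupRank (E := E) G + 1)) 𝓘(ℝ, E →L[ℝ] ℝ) ∞
        fun y : fiber G D E' j μ => legendre D j y.1.2 := h.smooth.comp (contMDiff_snd_fiber hv)
    obtain ⟨φ, h1, -, h3, h4, h5, h6⟩ := exists_rank_chart
      (A := EuclideanSpace ℝ (Fin (groupRank (E := E) G))) (R := ℝ) isOpen_univ (mem_univ y)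
      hsm.contMDiffOn (fun x _ => by
        have h7 := (md (𝓡 (groupRank (E := E) G + 1)) 𝓘(ℝ, E →L[ℝ] ℝ)
          (fun y : fiber G D E' j μ => legendre D j y.1.2) x).finrank_range_add_finrank_ker
        have h8 := finrank_span_singleton (K := ℝ) (legendreDeriv_phaseField_ne_zero h x.2.1)
        rw [← range_md_legendre_fiber h hv hr x] at h8
        rw [finrank_euclideanSpace_fin] at h7 ⊢
        have h9 := h8.symm.trans_le le_rfl
        exact Nat.add_left_cancel ((congrArg (· + _) h8).symm.trans (h7.trans (add_comm _ _))))
      (by rw [finrank_euclideanSpace_fin, finrank_euclideanSpace_fin, Module.finrank_self])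
    exact ⟨φ, h1, h3, h4, h5, fun x hx z hz => (reducedProj_eq_iff x z).trans
      (hΛ.eq_iff.symm.trans (h6 x hx z hz))⟩

end Fiber

section Bundle

variable {V C : Type*} [NormedAddCommGroup V] [NormedSpace ℝ V] [NormedAddCommGroup C]
  [NormedSpace ℝ C] [ChartedSpace V (isotropyGroup (G := G) μ)] [ChartedSpace C (fiber G D E' j μ)]
  [ChartedSpace ℝ (ReducedSpace G D E' j μ)]

theorem isSmoothPrincipalBundle_reducedProj
    (hk : ContMDiff 𝓘(ℝ, V) 𝓘(ℝ, E) ∞ (Subtype.val : isotropyGroup (G := G) μ → G))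
    (hkr : HasLocalRetractions V 𝓘(ℝ, E) (Subtype.val : isotropyGroup (G := G) μ → G))
    (hv : ContMDiff 𝓘(ℝ, C) (yModel E E') ∞ (Subtype.val : fiber G D E' j μ → G × F))
    (hr : HasLocalRetractions C (yModel E E') (Subtype.val : fiber G D E' j μ → G × F))
    (hπ : ContMDiff 𝓘(ℝ, C) 𝓘(ℝ, ℝ) ∞ (reducedProj G D E' j μ))
    (hσ : ∀ b : ReducedSpace G D E' j μ, ∃ U : Set (ReducedSpace G D E' j μ), IsOpen U ∧ b ∈ U ∧
        ∃ σ : ReducedSpace G D E' j μ → fiber G D E' j μ,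
          ContMDiffOn 𝓘(ℝ, ℝ) 𝓘(ℝ, C) ∞ σ U ∧ ∀ b' ∈ U, reducedProj G D E' j μ (σ b') = b') :
    IsSmoothPrincipalBundle (K := isotropyGroup (G := G) μ) 𝓘(ℝ, V) 𝓘(ℝ, C) 𝓘(ℝ, ℝ)
      (reducedProj G D E' j μ) where
  smooth_proj := hπ
  surjective_proj := isOpenQuotientMap_reducedProj.surjective
  fibre_eq_orbit := reducedProj_eq_iff'
  locally_trivial b := by
    classical
    obtain ⟨U, hU, hb, σ, hsU, hs⟩ := hσ b
    set π := reducedProj G D E' j μ with hπdef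
    have hπh : ∀ (g : isotropyGroup (G := G) μ) (y : fiber G D E' j μ), π (g • y) = π y :=
      fun g y => ((reducedProj_eq_iff' y _).mpr ⟨g, rfl⟩).symm
    let q : fiber G D E' j μ → isotropyGroup (G := G) μ := fun y =>
      if h : ∃ g : isotropyGroup (G := G) μ, g • σ (π y) = y then h.choose else 1
    have hq : ∀ y, π y ∈ U → q y • σ (π y) = y := fun y hy => by
      have h : ∃ g : isotropyGroup (G := G) μ, g • σ (π y) = y :=
        (reducedProj_eq_iff' _ _).mp (hs _ hy)
      simp only [q, dif_pos h]
      exact h.choose_spec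
    -- The group coordinate, chosen pointwise, has an explicit smooth formula in `G`; the local
    -- retractions of `G_μ` turn this into smoothness into `G_μ`.
    have hqc : ∀ y, π y ∈ U → (q y : G) = y.1.1 * (σ (π y)).1.1⁻¹ := fun y hy =>
      eq_mul_inv_of_mul_eq (congrArg (fun z : fiber G D E' j μ => z.1.1) (hq y hy))
    have hτ : ContMDiffOn (𝓘(ℝ, ℝ).prod 𝓘(ℝ, V)) 𝓘(ℝ, C) ∞
        (fun x : ReducedSpace G D E' j μ × isotropyGroup (G := G) μ => x.2 • σ x.1)
        (U ×ˢ univ) := by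
      have h1 : ContMDiffOn (𝓘(ℝ, ℝ).prod 𝓘(ℝ, V)) 𝓘(ℝ, C) ∞
          (fun x : ReducedSpace G D E' j μ × isotropyGroup (G := G) μ => σ x.1) (U ×ˢ univ) :=
        hsU.comp contMDiffOn_fst fun x hx => hx.1
      exact (contMDiff_smul_fiber hk hv hr).comp_contMDiffOn (contMDiffOn_snd.prodMk h1)
    have hqs : ContMDiffOn 𝓘(ℝ, C) 𝓘(ℝ, V) ∞ q (π ⁻¹' U) := by
      refine hkr.contMDiffOn ?_
      have h1 : ContMDiffOn 𝓘(ℝ, C) (yModel E E') ∞ (fun y => (σ (π y)).1) (π ⁻¹' U) :=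
        hv.comp_contMDiffOn (hsU.comp hπ.contMDiffOn fun y hy => hy)
      have h2 : ContMDiffOn 𝓘(ℝ, C) 𝓘(ℝ, E) ∞ (fun y => (σ (π y)).1.1) (π ⁻¹' U) :=
        contMDiff_fst.comp_contMDiffOn h1
      exact ((contMDiff_fst.comp hv).contMDiffOn.mul h2.inv).congr hqc
    have hinv : ContMDiffOn 𝓘(ℝ, C) (𝓘(ℝ, ℝ).prod 𝓘(ℝ, V)) ∞ (fun y => (π y, q y)) (π ⁻¹' U) :=
      hπ.contMDiffOn.prodMk hqs
    refine ⟨U, hU, hb, {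
      toFun := fun x => x.2 • σ x.1
      invFun := fun y => (π y, q y)
      source := U ×ˢ univ
      target := π ⁻¹' U
      map_source' := fun x hx => by
        rw [mem_preimage, hπh, hs _ hx.1]
        exact hx.1
      map_target' := fun y hy => ⟨hy, mem_univ _⟩
      left_inv' := fun x hx => by
        have h1 : π (x.2 • σ x.1) = x.1 := (hπh _ _).trans (hs _ hx.1)
        have h2 := hqc (x.2 • σ x.1) (by rw [h1]; exact hx.1)
        refine Prod.ext h1 (Subtype.ext (h2.trans ?_))
        rw [h1]
        exact mul_inv_cancel_right _ _
      right_inv' := fun y hy => hq y hy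
      open_source := hU.prod isOpen_univ
      open_target := hU.preimage hπ.continuous
      continuousOn_toFun := hτ.continuousOn
      continuousOn_invFun := hinv.continuousOn }, rfl, rfl, hτ, hinv, fun b' hb' g => ⟨?_, ?_⟩⟩
    · exact (hπh _ _).trans (hs _ hb')
    · exact fun g' => mul_smul g' g (σ b')

end Bundle

end Momentum

/-! ### The phase portraits -/

/-- Transport of the manifold structure along a bijection. -/
theorem exists_chartedSpace_of_equiv {V B P : Type*} [NormedAddCommGroup V] [NormedSpace ℝ V]
    [TopologicalSpace B] [ChartedSpace V B] [IsManifold 𝓘(ℝ, V) ∞ B] (Ψ : B ≃ P) :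
    ∃ (_ : TopologicalSpace P) (_ : ChartedSpace V P), IsManifold 𝓘(ℝ, V) ∞ P ∧
      ∃ Φ : B ≃ₘ⟮𝓘(ℝ, V), 𝓘(ℝ, V)⟯ P, ∀ b, Φ b = Ψ b := by
  let _ : TopologicalSpace P := TopologicalSpace.induced Ψ.symm inferInstance
  let Θ : P ≃ₜ B := Ψ.symm.toHomeomorphOfIsInducing ⟨rfl⟩
  have hΘ : ∀ p, Θ p = Ψ.symm p := fun _ => rfl
  have hΘs : ∀ b, Θ.symm b = Ψ b := fun _ => rfl
  have hc1 : ∀ b : B, ContMDiffOn 𝓘(ℝ, V) 𝓘(ℝ, V) ∞ (chartAt V b) (chartAt V b).source :=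
    fun b => contMDiffOn_chart
  have hc2 : ∀ b : B, ContMDiffOn 𝓘(ℝ, V) 𝓘(ℝ, V) ∞ (chartAt V b).symm (chartAt V b).target :=
    fun b => contMDiffOn_chart_symm
  let e : P → OpenPartialHomeomorph P V := fun p => Θ.transOpenPartialHomeomorph (chartAt V (Θ p))
  have he : ∀ p, (e p).source = Θ ⁻¹' (chartAt V (Θ p)).source := fun _ => rfl
  have ht : ∀ p, (e p).target = (chartAt V (Θ p)).target := fun _ => rfl
  have hs : ∀ p t, (e p).symm t = Θ.symm ((chartAt V (Θ p)).symm t) := fun _ _ => rfl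
  have hx : ∀ p, p ∈ (e p).source := fun p => mem_chart_source V (Θ p)
  obtain ⟨cs, hM, h1, h2⟩ := exists_chartedSpace e hx fun p q => by
    refine contMDiffOn_iff_contDiffOn.mp (((hc1 (Θ q)).comp ((hc2 (Θ p)).mono fun t ht => ht.1)
      fun t ht => ?_).congr fun t _ => ?_)
    · have h3 := ht.2
      change Θ (Θ.symm ((chartAt V (Θ p)).symm t)) ∈ (chartAt V (Θ q)).source at h3
      rwa [Θ.apply_symm_apply] at h3
    · change chartAt V (Θ q) (Θ (Θ.symm ((chartAt V (Θ p)).symm t))) = _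
      rw [Θ.apply_symm_apply]
      rfl
  have hf : ContMDiff 𝓘(ℝ, V) 𝓘(ℝ, V) ∞ Θ := fun p => by
    have h3 : ContMDiffOn 𝓘(ℝ, V) 𝓘(ℝ, V) ∞
        (fun q => (chartAt V (Θ p)).symm (e p q)) (e p).source :=
      (hc2 (Θ p)).comp (h1 p) fun q hq => (e p).map_source hq
    refine (h3.congr fun q hq => ?_).contMDiffAt ((e p).open_source.mem_nhds (hx p))
    exact ((chartAt V (Θ p)).left_inv hq).symm
  have hg : ContMDiff 𝓘(ℝ, V) 𝓘(ℝ, V) ∞ Θ.symm := fun b => by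
    obtain ⟨p, rfl⟩ := Θ.surjective b
    have h3 : ContMDiffOn 𝓘(ℝ, V) 𝓘(ℝ, V) ∞
        (fun c => (e p).symm (chartAt V (Θ p) c)) (chartAt V (Θ p)).source :=
      (h2 p).comp (hc1 (Θ p)) fun c hc => (chartAt V (Θ p)).map_source hc
    refine (h3.congr fun c hc => ?_).contMDiffAt
      ((chartAt V (Θ p)).open_source.mem_nhds (mem_chart_source V (Θ p)))
    rw [hs, (chartAt V (Θ p)).left_inv hc]
  exact ⟨inferInstance, cs, hM, ⟨Θ.symm.toEquiv, hg, hf⟩, hΘs⟩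

section Momentum

variable {E : Type*} [NormedAddCommGroup E] [NormedSpace ℝ E] [FiniteDimensional ℝ E]
variable {G : Type*} [TopologicalSpace G] [ChartedSpace E G] [Group G] [LieGroup 𝓘(ℝ, E) ∞ G]
variable {D : ControlSystem E}
variable {E' : Type*} [NormedAddCommGroup E'] [NormedSpace ℝ E'] [FiniteDimensional ℝ E']
variable {F : Type*} [TopologicalSpace F] [ChartedSpace E' F] [IsManifold 𝓘(ℝ, E') ∞ F]
variable {j : F → D.a × (E →L[ℝ] ℝ)} {Aξ : F → E} {μ : E →L[ℝ] ℝ}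

theorem mem_phasePortrait (b : ReducedSpace G D E' j μ) :
    reducedToPhase b ∈ regularPhase G D E' j ∧
      legendre D j (reducedToPhase b) ∈ coadjointOrbit G μ := by
  obtain ⟨y, rfl⟩ := isOpenQuotientMap_reducedProj.surjective b
  refine ⟨y.2.1, y.1.1⁻¹, ?_⟩
  have hy : coAd y.1.1 (legendre D j y.1.2) = μ := y.2.2
  have h := coAd_inv_coAd y.1.1 (legendre D j y.1.2)
  rwa [hy] at h

variable (G D E' j μ) in
/-- The bijection `[(g, p)] ↦ p` from `Y_μ` to `𝒫(μ)`. -/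
def reducedEquiv : ReducedSpace G D E' j μ ≃ PhasePortrait G D E' j μ :=
  Equiv.ofBijective (fun b => ⟨reducedToPhase b, mem_phasePortrait b⟩) (by
    refine ⟨fun b c h => injective_reducedToPhase (congrArg Subtype.val h), ?_⟩
    -- If `Λ(p) = Ad*(g)μ`, then `(g⁻¹, p)` lies in `J⁻¹(μ)`.
    rintro ⟨p, hp, g, hg⟩
    have hy : momentJ D j (g⁻¹, p) = μ := by
      change coAd g⁻¹ (legendre D j p) = μ
      rw [← hg]
      exact coAd_inv_coAd g μ
    exact ⟨reducedProj G D E' j μ ⟨(g⁻¹, p), hp, hy⟩, rfl⟩)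

theorem incl_reducedEquiv (y : fiber G D E' j μ) :
    (reducedEquiv G D E' j μ (reducedProj G D E' j μ y)).incl = y.1.2 := rfl

theorem mem_orbitTangent_iff (η v : E →L[ℝ] ℝ) : v ∈ orbitTangent G η ↔ ∃ A, v = adStar G η A := by
  refine exists_congr fun A => ?_
  rw [ContinuousLinearMap.ext_iff]
  exact forall_congr' fun B => by rw [adStar_apply]

/-- An equality `dΛ(e) = ad*(A)η` says that `(-A, e)` is orthogonal to the orbit, so coisotropy
makes `e` a multiple of `Φ_ξ`. Conversely `dΛ(Φ_ξ) = ad*(-A_ξ)η`. -/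
theorem linearizedPortrait_eq (h : IsCharacteristic G D (E' := E') j Aξ) {p : F}
    (hp : p ∈ regularPhase G D E' j) : linearizedPortrait G D E' j p =
      (Submodule.span ℝ {legendreDeriv D j p (phaseField G D E' j p)} : Set (E →L[ℝ] ℝ)) := by
  ext w
  rw [SetLike.mem_coe, Submodule.mem_span_singleton, linearizedPortrait, mem_inter_iff,
    mem_orbitTangent_iff]
  constructor
  · rintro ⟨⟨e, rfl⟩, A, hA⟩
    obtain ⟨c, rfl⟩ := h.coisotropic p hp (-A) e (by rw [map_neg, neg_neg]; exact hA)
    exact ⟨c, (map_smul _ _ _).symm⟩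
  · rintro ⟨c, rfl⟩
    refine ⟨⟨c • phaseField G D E' j p, map_smul _ _ _⟩, c • -Aξ p, ?_⟩
    rw [map_smul, map_neg, (h.isKernelVector p).1]

section Portrait

variable {C : Type*} [NormedAddCommGroup C] [NormedSpace ℝ C] [ChartedSpace C (fiber G D E' j μ)]
  [TopologicalSpace (PhasePortrait G D E' j μ)] [ChartedSpace ℝ (PhasePortrait G D E' j μ)]
  {ψ : fiber G D E' j μ → PhasePortrait G D E' j μ}

theorem contMDiff_incl
    (hv : ContMDiff 𝓘(ℝ, C) (yModel E E') ∞ (Subtype.val : fiber G D E' j μ → G × F))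
    (hψi : ∀ y, (ψ y).incl = y.1.2)
    (hσ : ∀ q : PhasePortrait G D E' j μ, ∃ U ∈ 𝓝 q, ∃ σ : PhasePortrait G D E' j μ →
      fiber G D E' j μ, ContMDiffOn 𝓘(ℝ, ℝ) 𝓘(ℝ, C) ∞ σ U ∧ ∀ q' ∈ U, ψ (σ q') = q') :
    ContMDiff 𝓘(ℝ, ℝ) 𝓘(ℝ, E') ∞ (PhasePortrait.incl : PhasePortrait G D E' j μ → F) := by
  intro q
  obtain ⟨U, hU, σ, hs, hσ⟩ := hσ q
  have h1 : ContMDiffOn 𝓘(ℝ, ℝ) 𝓘(ℝ, E') ∞ (fun q' => (σ q').1.2) U :=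
    (contMDiff_snd.comp hv).comp_contMDiffOn hs
  refine (h1.congr fun q' hq' => ?_).contMDiffAt hU
  rw [← hψi, hσ q' hq']

/-- Composing with `ψ` shows that the range contains the line of `dΛ(Φ_ξ)`; as the portrait is
one-dimensional, it cannot be larger. -/
theorem range_md_legendre_incl (h : IsCharacteristic G D (E' := E') j Aξ)
    (hψ : ContMDiff 𝓘(ℝ, C) 𝓘(ℝ, ℝ) ∞ ψ) (hψi : ∀ y, (ψ y).incl = y.1.2)
    (hi : ContMDiff 𝓘(ℝ, ℝ) 𝓘(ℝ, E') ∞ (PhasePortrait.incl : PhasePortrait G D E' j μ → F))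
    (y : fiber G D E' j μ)
    (hy : (md 𝓘(ℝ, C) 𝓘(ℝ, E →L[ℝ] ℝ) (fun y : fiber G D E' j μ => legendre D j y.1.2) y).range =
      Submodule.span ℝ {legendreDeriv D j y.1.2 (phaseField G D E' j y.1.2)}) :
    (md 𝓘(ℝ, ℝ) 𝓘(ℝ, E →L[ℝ] ℝ)
      (fun q : PhasePortrait G D E' j μ => legendre D j q.incl) (ψ y)).range =
      Submodule.span ℝ {legendreDeriv D j y.1.2 (phaseField G D E' j y.1.2)} := by
  have h1 := hasMFDerivAt_md ((hψ y).mdifferentiableAt (by simp))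
  have h2 := hasMFDerivAt_md (((h.smooth.comp hi) (ψ y)).mdifferentiableAt (by simp))
  have h3 := md_eq_of_hasMFDerivAt (hasMFDerivAt_comp_of_eq h2 h1 rfl)
  have h4 : (fun z => (legendre D j ∘ (PhasePortrait.incl : PhasePortrait G D E' j μ → F)) (ψ z)) =
      fun z : fiber G D E' j μ => legendre D j z.1.2 :=
    funext fun z => congrArg (legendre D j) (hψi z)
  rw [h4] at h3
  have hne := finrank_span_singleton (K := ℝ) (legendreDeriv_phaseField_ne_zero h y.2.1)
  refine (Submodule.eq_of_le_of_finrank_le ?_ ?_).symm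
  · rw [← hy, h3]
    rintro _ ⟨v, rfl⟩
    exact ⟨_, rfl⟩
  · rw [hne, ← Module.finrank_self ℝ]
    exact LinearMap.finrank_range_le _

/-- The differential of `Λ ∘ incl` is nonzero, hence so is that of `incl`, and a nonzero linear map
on `ℝ` is injective. -/
theorem isImmersedSubmanifold_incl (h : IsCharacteristic G D (E' := E') j Aξ)
    (hi : ContMDiff 𝓘(ℝ, ℝ) 𝓘(ℝ, E') ∞ (PhasePortrait.incl : PhasePortrait G D E' j μ → F))
    (hrange : ∀ q : PhasePortrait G D E' j μ, (md 𝓘(ℝ, ℝ) 𝓘(ℝ, E →L[ℝ] ℝ)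
      (fun q : PhasePortrait G D E' j μ => legendre D j q.incl) q).range =
      Submodule.span ℝ {legendreDeriv D j q.incl (phaseField G D E' j q.incl)}) :
    IsImmersedSubmanifold 𝓘(ℝ, ℝ) 𝓘(ℝ, E')
      (PhasePortrait.incl : PhasePortrait G D E' j μ → F) := by
  refine ⟨hi, fun _ _ => Subtype.ext, fun q => ?_⟩
  have h1 := hasMFDerivAt_md ((hi q).mdifferentiableAt (by simp))
  have h2 := hasMFDerivAt_md ((h.smooth q.incl).mdifferentiableAt (by simp))
  have h3 := md_eq_of_hasMFDerivAt (hasMFDerivAt_comp_of_eq h2 h1 rfl)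
  have h4 := hrange q
  rw [h3] at h4
  set S := md 𝓘(ℝ, ℝ) 𝓘(ℝ, E') (PhasePortrait.incl : PhasePortrait G D E' j μ → F) q with hS
  set T := md 𝓘(ℝ, E') 𝓘(ℝ, E →L[ℝ] ℝ) (legendre D j) q.incl
  have h5 : S 1 ≠ 0 := by
    intro h0
    have h6 : legendreDeriv D j q.incl (phaseField G D E' j q.incl) ∈
        (T.comp S).toLinearMap.range := by
      have h7 := Submodule.mem_span_singleton_self (R := ℝ)
        (legendreDeriv D j q.incl (phaseField G D E' j q.incl))
      rwa [← h4] at h7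
    obtain ⟨c, hc⟩ := h6
    refine legendreDeriv_phaseField_ne_zero h q.2.1 (hc.symm.trans ?_)
    change T (S c) = 0
    rw [← mul_one c, ← smul_eq_mul, map_smul, h0, smul_zero, map_zero]
  have h8 : Function.Injective S := by
    refine (injective_iff_map_eq_zero S).mpr fun c hc => ?_
    rw [← mul_one c, ← smul_eq_mul, map_smul] at hc
    exact (smul_eq_zero.mp hc).resolve_right h5
  exact h8

end Portrait

end Momentum
end
end CoisotropicVP

/-! ### The main theorem. -/

theorem mainTheorem2
    -- a Lie group `G`, with Lie algebra `E`
    {E : Type*} [NormedAddCommGroup E] [NormedSpace ℝ E] [FiniteDimensional ℝ E]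
    {G : Type*} [TopologicalSpace G] [T2Space G] [SecondCountableTopology G]
    [ChartedSpace E G] [Group G] [LieGroup 𝓘(ℝ, E) ∞ G]
    -- an invariant Lagrangian `L` on the affine space `𝔸 = P + 𝔞`
    (D : ControlSystem E) (L : D.a → ℝ) (_hL : ContDiff ℝ ∞ L)
    -- the phase space `ℱ ⊂ 𝔸 × 𝔤*`, so that `Y = G × ℱ` is the momentum space
    {E' : Type*} [NormedAddCommGroup E'] [NormedSpace ℝ E'] [FiniteDimensional ℝ E']
    {F : Type*} [TopologicalSpace F] [T2Space F] [SecondCountableTopology F]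
    [ChartedSpace E' F] [IsManifold 𝓘(ℝ, E') ∞ F]
    (j : F → D.a × (E →L[ℝ] ℝ)) (_hY : IsPhaseSpace G D E' j L)
    -- the Legendre transform is one-to-one
    (_hΛ : Function.Injective (legendre D j))
    -- `L` is coisotropic
    (_hnd : IsNondegenerate G D E' j) (_hco : IsCoisotropic G D E' j) :
    -- `J` takes its values in the regular elements
    (∀ y ∈ regularMomentum G D E' j, momentJ D j y ∈ regularElements (E := E) G) ∧
    -- `J` is a submersion on the open set `Y_r`
    IsOpen (regularMomentum G D E' j) ∧
    ContMDiff (yModel E E') 𝓘(ℝ, E →L[ℝ] ℝ) ∞ (momentJ (G := G) D j) ∧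
    (∀ y ∈ regularMomentum G D E' j,
      Function.Surjective
        (mfderiv (yModel E E') 𝓘(ℝ, E →L[ℝ] ℝ) (momentJ (G := G) D j) y)) ∧
    ∀ μ ∈ momentJ D j '' regularMomentum G D E' j,
      ∃ (_ : ChartedSpace (EuclideanSpace ℝ (Fin (groupRank (E := E) G + 1))) (fiber G D E' j μ))
        (_ : ChartedSpace (EuclideanSpace ℝ (Fin (groupRank (E := E) G)))
          (isotropyGroup (G := G) μ))
        (_ : ChartedSpace ℝ (ReducedSpace G D E' j μ))
        (_ : TopologicalSpace (PhasePortrait G D E' j μ))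
        (_ : ChartedSpace ℝ (PhasePortrait G D E' j μ)),
        -- `J⁻¹(μ)` is a `(k + 1)`-dimensional embedded submanifold of `Y`, where `k = rank G`
        IsManifold (𝓡 (groupRank (E := E) G + 1)) ∞ (fiber G D E' j μ) ∧
        IsImmersedSubmanifold (𝓡 (groupRank (E := E) G + 1)) (yModel E E')
          (Subtype.val : fiber G D E' j μ → G × F) ∧
        -- its tangent spaces are `ker dJ = span ξ + 𝔤_η`, and `ξ` is tangent to it
        (∀ y : fiber G D E' j μ,
          let T : Set (E × E') := range (mfderiv (𝓡 (groupRank (E := E) G + 1)) (yModel E E')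
            (Subtype.val : fiber G D E' j μ → G × F) y)
          T = {v : E × E' |
              mfderiv (yModel E E') 𝓘(ℝ, E →L[ℝ] ℝ) (momentJ (G := G) D j) y.1 v = 0} ∧
          T = (fiberTangent (G := G) (E' := E') D j y.1 : Set (E × E')) ∧
          charField (E' := E') D j y.1 ∈ T) ∧
        -- `G_μ` is a `k`-dimensional Lie subgroup of `G`, acting smoothly, freely and properly
        LieGroup (𝓡 (groupRank (E := E) G)) ∞ (isotropyGroup (G := G) μ) ∧
        IsImmersedSubmanifold (𝓡 (groupRank (E := E) G)) 𝓘(ℝ, E)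
          (Subtype.val : isotropyGroup (G := G) μ → G) ∧
        ContMDiff ((𝓡 (groupRank (E := E) G)).prod (𝓡 (groupRank (E := E) G + 1)))
          (𝓡 (groupRank (E := E) G + 1)) ∞
          (fun x : isotropyGroup (G := G) μ × fiber G D E' j μ => x.1 • x.2) ∧
        (∀ (h : isotropyGroup (G := G) μ) (y : fiber G D E' j μ), h • y = y → h = 1) ∧
        ProperSMul (isotropyGroup (G := G) μ) (fiber G D E' j μ) ∧
        -- `Y_μ` is a 1-manifold and `J⁻¹(μ) → Y_μ` is a principal `G_μ`-bundle
        T2Space (ReducedSpace G D E' j μ) ∧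
        SecondCountableTopology (ReducedSpace G D E' j μ) ∧
        IsManifold 𝓘(ℝ, ℝ) ∞ (ReducedSpace G D E' j μ) ∧
        IsSmoothPrincipalBundle (K := isotropyGroup (G := G) μ) (𝓡 (groupRank (E := E) G))
          (𝓡 (groupRank (E := E) G + 1)) 𝓘(ℝ, ℝ) (reducedProj G D E' j μ) ∧
        -- `𝒫(μ)` is a 1-dimensional immersed submanifold of `ℱ` with `T_η 𝒫(μ) = Π(η)`
        IsManifold 𝓘(ℝ, ℝ) ∞ (PhasePortrait G D E' j μ) ∧
        IsImmersedSubmanifold 𝓘(ℝ, ℝ) 𝓘(ℝ, E')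
          (PhasePortrait.incl : PhasePortrait G D E' j μ → F) ∧
        (∀ p : PhasePortrait G D E' j μ,
          range (mfderiv 𝓘(ℝ, ℝ) 𝓘(ℝ, E →L[ℝ] ℝ)
            (fun q : PhasePortrait G D E' j μ => legendre D j q.incl) p) =
          linearizedPortrait G D E' j p.incl) ∧
        -- `[(g, η)] ↦ η` is a diffeomorphism from `Y_μ` to `𝒫(μ)`
        ∃ Φ : ReducedSpace G D E' j μ ≃ₘ⟮𝓘(ℝ, ℝ), 𝓘(ℝ, ℝ)⟯ PhasePortrait G D E' j μ,
          ∀ y : fiber G D E' j μ, (Φ (reducedProj G D E' j μ y)).incl = y.1.2 := by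
  obtain ⟨Aξ, h⟩ := exists_isCharacteristic (G := G) _hL _hY _hnd _hco
  refine ⟨fun y hy => momentJ_mem_regularElements h hy, isOpen_regularMomentum h,
    contMDiff_momentJ h.smooth, fun y hy => ?_, ?_⟩
  · rw [regularMomentum_eq h] at hy
    exact hy
  rintro μ ⟨y₀, hy₀, hμ⟩
  have hreg : μ ∈ regularElements (E := E) G := hμ ▸ momentJ_mem_regularElements h hy₀
  obtain ⟨csN, hMN, hv, hr⟩ := exists_chartedSpace_fiber h μ
  obtain ⟨csK, hMK, hk, hkr⟩ := exists_chartedSpace_isotropyGroup hreg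
  obtain ⟨csB, hMB, hπ, hσ⟩ := exists_chartedSpace_reducedSpace h _hΛ hv hr
  -- The portrait receives its topology and charts from `Y_μ`, not from `ℱ`, so the diffeomorphism
  -- is built in and only the immersion property remains.
  obtain ⟨tP, csP, hMP, Φ, hΦ⟩ := exists_chartedSpace_of_equiv (V := ℝ) (reducedEquiv G D E' j μ)
  have hψ : ContMDiff (𝓡 (groupRank (E := E) G + 1)) 𝓘(ℝ, ℝ) ∞
      fun y : fiber G D E' j μ => Φ (reducedProj G D E' j μ y) := Φ.contMDiff.comp hπ
  have hψi : ∀ y : fiber G D E' j μ, (Φ (reducedProj G D E' j μ y)).incl = y.1.2 := fun y => by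
    rw [hΦ]
    exact incl_reducedEquiv y
  -- Local sections of `J⁻¹(μ) → Y_μ`, carried over by `Φ`, express the inclusion locally as a
  -- section followed by `(g, p) ↦ p`.
  have hi := contMDiff_incl hv hψi fun q => by
    obtain ⟨U, hU, hb, σ, hs, hσ⟩ := hσ (Φ.symm q)
    refine ⟨Φ.symm ⁻¹' U, (hU.preimage Φ.symm.continuous).mem_nhds hb, fun q' => σ (Φ.symm q'),
      hs.comp Φ.symm.contMDiff.contMDiffOn fun q' hq' => hq', fun q' hq' => ?_⟩
    rw [hσ _ hq', Φ.apply_symm_apply]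
  have hrange : ∀ q : PhasePortrait G D E' j μ, (md 𝓘(ℝ, ℝ) 𝓘(ℝ, E →L[ℝ] ℝ)
      (fun q : PhasePortrait G D E' j μ => legendre D j q.incl) q).range =
      Submodule.span ℝ {legendreDeriv D j q.incl (phaseField G D E' j q.incl)} := fun q => by
    obtain ⟨b, rfl⟩ := Φ.surjective q
    obtain ⟨y, rfl⟩ := isOpenQuotientMap_reducedProj.surjective b
    have h1 := range_md_legendre_incl h hψ hψi hi y (range_md_legendre_fiber h hv hr y)
    rw [← hψi y] at h1
    exact h1
  refine ⟨csN, csK, csB, tP, csP, hMN, ⟨hv, Subtype.val_injective, hr.injective_md hv⟩,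
    fun y => ?_, lieGroup_isotropyGroup hk hkr, ⟨hk, Subtype.val_injective, hkr.injective_md hk⟩,
    contMDiff_smul_fiber hk hv hr, fun g y hg => smul_fiber_eq_self hg, properSMul_fiber μ,
    t2Space_reducedSpace, secondCountableTopology_reducedSpace, hMB,
    isSmoothPrincipalBundle_reducedProj hk hkr hv hr hπ hσ, hMP,
    isImmersedSubmanifold_incl h hi hrange, fun q => ?_, Φ, hψi⟩
  · have h1 := congrArg (fun S : Submodule ℝ (E × E') => (S : Set (E × E')))
      (range_md_val_fiber h hv hr y)
    have h2 := congrArg (fun S : Submodule ℝ (E × E') => (S : Set (E × E')))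
      (ker_momentDeriv h y.2.1)
    have h3 : charField D j y.1 ∈ fiberTangent (G := G) (E' := E') D j y.1 :=
      (mem_fiberTangent_iff y.1 _).mpr ⟨1, 0, zero_mem _, by simp⟩
    refine ⟨h1.trans ?_, h1.trans h2, (h1.trans h2).symm.subset h3⟩
    rw [← md_eq_of_hasMFDerivAt (hasMFDerivAt_momentJ h.smooth y.1)]
    rfl
  · have h1 := congrArg (fun S : Submodule ℝ (E →L[ℝ] ℝ) => (S : Set (E →L[ℝ] ℝ))) (hrange q)
    exact h1.trans (linearizedPortrait_eq h q.2.1).symm
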